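/- Let $X$ be a complete connected Riemannian manifold and let $\Gamma$ be a group acting on $X$ by smooth isometries with compact quotient $X/\Gamma$ (in particular, $\Gamma$ may be a second countable locally compact group acting properly, isometrically and cocompactly, such as the central $U(1)^{\mathbb N}$-extension $\Gamma_\alpha$ of such a group, acting through the quotient by $U(1)^{\mathbb N}$). Let $B_k$ ($k\in\mathbb N$) be non-zero unital $C^*$-algebras, and let $\prod_k B_k$ be the $C^*$-algebra of bounded sequences. A Hilbert $B$-module $\Gamma$-bundle over $X$ is a locally trivial bundle of Hilbert $B$-modules with a typical fibre $\mathcal E$, unitary trivializations and norm-continuous transition functions, on which $\Gamma$ acts by bundle automorphisms: each $\gamma\in\Gamma$ acts by unitary isomorphisms $E_x\to E_{\gamma x}$ that are norm continuous in the charts. A parallel transport $\Phi$ of $E$ is a functor which assigns to each piecewise smooth path $p$ from $x$ to $y$, up to thin homotopy and reparametrization, a unitary isomorphism $\Phi_p\colon E_x\to E_y$, and which is continuous along smooth finite-dimensional families of paths. It is $\Gamma$-equivariant if $\Phi_{\gamma p}\,\gamma=\gamma\,\Phi_p$. It is $\varepsilon$-close to the identity if $\|\Phi_p-\mathrm{id}\|\le\varepsilon\cdot\mathrm{area}(D)$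 for every loop $p$ and every (possibly degenerate) two-dimensional disk $D$ in $X$ spanning $p$. Let $E^k$ be Hilbert $B_k$-module $\Gamma$-bundles over $X$ with typical fibres $\mathcal E^k$, each $\mathcal E^k$ being generated over $B_k$ by at most $n$ elements with $n$ independent of $k$. Let $\Phi^k$ be $\Gamma$-equivariant parallel transports of $E^k$ which are all $\varepsilon$-close to the identity with the same $\varepsilon$. Then the $\prod_k B_k$-module $\prod_k\mathcal E^k$ of bounded sequences is finitely generated, and there is a Hilbert $\prod_k B_k$-module $\Gamma$-bundle $V$ over $X$ with typical fibre $\prod_k\mathcal E^k$ such that 1. $V$ has an atlas whose transition functions are in diagonal form $(\psi^k)_k$, with $\psi^k$ unitary on $\mathcal E^k$, and are Lipschitz continuous in the operator norm, with one constant for all pairs of charts; 2. for every $k$ the $k$-th component $V\otimes_{p_k}B_k$, where $p_k\colon\prod_j B_j\to B_k$ is the projection, is isomorphic to $E^k$ as a Hilbert $B_k$-module $\Gamma$-bundle; 3. if moreover all $E^k$ are smooth and the $\Phi^k$ are the parallel transports of $\Gamma$-invariant connections $\nabla^k$ on $E^k$ (compatible with the inner products), then the isomorphisms in 2 are smooth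 in the charts, and $V$ carries a continuous $\Gamma$-invariant connection $\nabla$ induced by the $\nabla^k$. That is, $\nabla$ is defined on the sections $s=(s_k)_k$ of $V$ that are locally Lipschitz and have smooth components $s_k$; its components are $(\nabla_v s)_k=\nabla^k_v s_k$; it is additive and $\prod_k B_k$-linear, satisfies the Leibniz rule, is compatible with the inner product (with componentwise derivatives) and commutes with $\Gamma$; and it is continuous in the sense that there is a constant $C$ with $\|\nabla_v s(x)\|\le C\,(K+\|s(x)\|)\,\|v\|$ for all such $s$, all $x\in X$ and all $v\in T_xX$, whenever $s$ is $K$-Lipschitz near $x$ in a chart of the atlas around $x$. -/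

import Mathlib

open Bundle
open scoped Manifold ContDiff ENNReal NNReal Topology unitInterval

universe v

attribute [local instance] CStarAlgebra.spectralOrder CStarAlgebra.spectralOrderedRing

/-! ### Hilbert modules -/

/-- The `C⋆`-algebra `∏ₖ Bₖ` of bounded sequences of a sequence of unital `C⋆`-algebras. -/
noncomputable instance prodCStarAlgebra {B : ℕ → Type*} [∀ k, CStarAlgebra (B k)]
    [∀ k, Nontrivial (B k)] : CStarAlgebra (lp B ∞) where

/-- A unitary isomorphism of Hilbert `B`-modules: a bijection which is `ℂ`-linear, `B`-linear and
preserves the `B`-valued inner product (being isometric is a consequence of the latter). -/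
structure HilbertModuleIso (B : Type*) [CStarAlgebra B] (E F : Type*)
    [NormedAddCommGroup E] [NormedSpace ℂ E] [Module B E] [CStarModule B E]
    [NormedAddCommGroup F] [NormedSpace ℂ F] [Module B F] [CStarModule B F]
    extends E ≃ₗᵢ[ℂ] F where
  map_smul_alg : ∀ (b : B) (v : E), toFun (b • v) = b • toFun v
  map_inner : ∀ v w : E, inner B (toFun v) (toFun w) = inner B v w

namespace HilbertModuleIso

variable {B : Type*} [CStarAlgebra B] {E F : Type*}
  [NormedAddCommGroup E] [NormedSpace ℂ E] [Module B E] [CStarModule B E]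
  [NormedAddCommGroup F] [NormedSpace ℂ F] [Module B F] [CStarModule B F]

instance : CoeFun (HilbertModuleIso B E F) fun _ => E → F :=
  ⟨fun T => T.toLinearIsometryEquiv⟩

/-- The underlying bounded operator. -/
def toCLM (T : HilbertModuleIso B E F) : E →L[ℂ] F :=
  (T.toLinearIsometryEquiv.toContinuousLinearEquiv : E →L[ℂ] F)

/-- The inverse, as a bounded operator. -/
def invCLM (T : HilbertModuleIso B E F) : F →L[ℂ] E :=
  (T.toLinearIsometryEquiv.symm.toContinuousLinearEquiv : F →L[ℂ] E)

end HilbertModuleIso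

section Product

variable {B : ℕ → Type*} [∀ k, CStarAlgebra (B k)]
  {F : ℕ → Type*} [∀ k, NormedAddCommGroup (F k)] [∀ k, NormedSpace ℂ (F k)]
  [∀ k, Module (B k) (F k)] [∀ k, CStarModule (B k) (F k)]

theorem CStarModule.norm_alg_smul_le {A G : Type*} [CStarAlgebra A] [NormedAddCommGroup G]
    [NormedSpace ℂ G] [Module A G] [CStarModule A G] (b : A) (v : G) : ‖b • v‖ ≤ ‖b‖ * ‖v‖ := by
  have h : ‖b • v‖ ^ 2 ≤ (‖b‖ * ‖v‖) ^ 2 := by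
    rw [CStarModule.norm_sq_eq A, CStarModule.inner_op_smul_right,
      CStarModule.inner_op_smul_left]
    calc ‖b * (inner A v v * star b)‖ ≤ ‖b‖ * (‖inner A v v‖ * ‖star b‖) :=
          (norm_mul_le _ _).trans (by gcongr; exact norm_mul_le _ _)
      _ = (‖b‖ * ‖v‖) ^ 2 := by
          rw [norm_star, ← CStarModule.norm_sq_eq A]; ring
  exact (pow_le_pow_iff_left₀ (norm_nonneg _) (by positivity) (by simp)).mp h

/-- The product `∏ₖ Fₖ` (bounded sequences) of Hilbert `Bₖ`-modules is a `∏ₖ Bₖ`-module, with the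
componentwise action. -/
noncomputable instance prodSMul : SMul (lp B ∞) (lp F ∞) where
  smul b v := ⟨fun k => b k • v k, memℓp_infty ⟨‖b‖ * ‖v‖, by
    rintro _ ⟨k, rfl⟩
    exact (CStarModule.norm_alg_smul_le _ _).trans (by
      gcongr
      · exact lp.norm_apply_le_norm (by simp) b k
      · exact lp.norm_apply_le_norm (by simp) v k)⟩⟩

@[simp] theorem prod_smul_apply (b : lp B ∞) (v : lp F ∞) (k : ℕ) : (b • v) k = b k • v k := rfl

variable [∀ k, Nontrivial (B k)]

noncomputable instance prodModule : Module (lp B ∞) (lp F ∞) where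
  one_smul v := by ext k; simp [lp.infty_coeFn_one]
  mul_smul a b v := by ext k; simp [lp.infty_coeFn_mul, mul_smul]
  smul_zero a := by ext k; simp
  smul_add a v w := by ext k; simp
  add_smul a b v := by ext k; simp [add_smul]
  zero_smul v := by ext k; simp

/-- The product `∏ₖ Fₖ` is a Hilbert `∏ₖ Bₖ`-module with the componentwise inner product. -/
noncomputable instance prodCStarModule : CStarModule (lp B ∞) (lp F ∞) where
  inner v w := ⟨fun k => inner (B k) (v k) (w k), memℓp_infty ⟨‖v‖ * ‖w‖, by
    rintro _ ⟨k, rfl⟩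
    exact (CStarModule.norm_inner_le _).trans (by
      gcongr
      · exact lp.norm_apply_le_norm (by simp) v k
      · exact lp.norm_apply_le_norm (by simp) w k)⟩⟩
  inner_add_right := by
    intros
    ext k
    exact CStarModule.inner_add_right
  inner_self_nonneg := by
    intro v
    choose b hb using fun k => CStarAlgebra.nonneg_iff_eq_star_mul_self.mp
      (CStarModule.inner_self_nonneg (A := B k) (x := v k))
    have hn : ∀ k, ‖b k‖ = ‖v k‖ := fun k => by
      have h : ‖v k‖ ^ 2 = ‖b k‖ ^ 2 := by
        rw [CStarModule.norm_sq_eq (B k), hb k, CStarRing.norm_star_mul_self, sq]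
      exact ((pow_left_inj₀ (norm_nonneg _) (norm_nonneg _) two_ne_zero).mp h).symm
    let c : lp B ∞ := ⟨b, memℓp_infty ⟨‖v‖, by
      rintro _ ⟨k, rfl⟩
      exact (hn k).le.trans (lp.norm_apply_le_norm (by simp) v k)⟩⟩
    refine le_of_le_of_eq (star_mul_self_nonneg c) ?_
    ext k
    exact (hb k).symm
  inner_self := by
    intro v
    constructor
    · intro h
      ext k
      exact CStarModule.inner_self.mp (congrFun (congrArg Subtype.val h) k)
    · rintro rfl
      ext k
      exact CStarModule.inner_self.mpr rfl
  inner_op_smul_right := by intros; ext k; simp [lp.infty_coeFn_mul]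
  inner_smul_right_complex := by intros; ext k; simp
  star_inner := by intros; ext k; simp
  norm_eq_sqrt_norm_inner_self := by
    intro v
    let w : lp B ∞ := ⟨fun k => inner (B k) (v k) (v k), memℓp_infty ⟨‖v‖ * ‖v‖, by
      rintro _ ⟨k, rfl⟩
      exact (CStarModule.norm_inner_le _).trans (by
        gcongr <;> exact lp.norm_apply_le_norm (by simp) v k)⟩⟩
    change ‖v‖ = √‖w‖
    apply le_antisymm
    · refine lp.norm_le_of_forall_le (Real.sqrt_nonneg _) fun k => ?_
      rw [CStarModule.norm_eq_sqrt_norm_inner_self (A := B k) (v k)]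
      exact Real.sqrt_le_sqrt (lp.norm_apply_le_norm (by simp) w k)
    · refine Real.sqrt_le_iff.mpr ⟨norm_nonneg _, ?_⟩
      refine lp.norm_le_of_forall_le (by positivity) fun k => ?_
      rw [sq]
      exact (CStarModule.norm_inner_le _).trans (by
        gcongr <;> exact lp.norm_apply_le_norm (by simp) v k)

end Product

/-! ### Piecewise smooth paths and thin homotopies -/

section Paths

variable {d : ℕ} {X : Type*} [TopologicalSpace X] [ChartedSpace (EuclideanSpace ℝ (Fin d)) X]

/-- A path is piecewise smooth if there is a finite set of break points such that the path is
smooth on every closed interval whose interior contains no break point. -/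
def Path.IsPiecewiseSmooth (d : ℕ) {X : Type*} [TopologicalSpace X]
    [ChartedSpace (EuclideanSpace ℝ (Fin d)) X] {x y : X} (p : Path x y) : Prop :=
  ∃ S : Finset ℝ, ∀ s t : ℝ, 0 ≤ s → t ≤ 1 → (∀ u ∈ S, u ∉ Set.Ioo s t) →
    ContMDiffOn 𝓘(ℝ, ℝ) (𝓡 d) ∞ p.extend (Set.Icc s t)

/-- Piecewise smooth paths from `x` to `y`, parametrised by the unit interval. -/
def PSPath (d : ℕ) {X : Type*} [TopologicalSpace X]
    [ChartedSpace (EuclideanSpace ℝ (Fin d)) X] (x y : X) : Type _ :=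
  {p : Path x y // p.IsPiecewiseSmooth d}

namespace PSPath

instance (x y : X) : CoeFun (PSPath d x y) fun _ => I → X := ⟨fun p => p.1⟩

/-- The restriction of a smooth curve `c : ℝ → X` to the unit interval. -/
def ofSmooth {x y : X} (c : ℝ → X) (hc : ContMDiff 𝓘(ℝ, ℝ) (𝓡 d) ∞ c) (h₀ : c 0 = x)
    (h₁ : c 1 = y) : PSPath d x y :=
  ⟨Path.ofLine hc.continuous.continuousOn h₀ h₁, ∅, fun s t hs ht _ =>
    hc.contMDiffOn.congr fun u hu => by
      rw [Path.extend_apply _ ⟨hs.trans hu.1, hu.2.trans ht⟩]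
      rfl⟩

/-- The constant path. -/
def refl (x : X) : PSPath d x x :=
  ofSmooth (fun _ => x) contMDiff_const rfl rfl

/-- Concatenation of paths: first `p`, then `q`, each at double speed. -/
noncomputable def trans {x y z : X} (p : PSPath d x y) (q : PSPath d y z) : PSPath d x z :=
  ⟨p.1.trans q.1, by
    obtain ⟨p, S, hS⟩ := p
    obtain ⟨q, T, hT⟩ := q
    classical
    refine ⟨insert (1 / 2) (S.image (fun u => u / 2) ∪ T.image (fun u => (u + 1) / 2)),
      fun s t hs ht h => ?_⟩
    have hhalf : ¬ ((s : ℝ) < 1 / 2 ∧ 1 / 2 < t) := fun hh =>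
      h (1 / 2) (Finset.mem_insert_self _ _) hh
    by_cases hle : t ≤ 1 / 2
    · have h1 : ContMDiffOn 𝓘(ℝ, ℝ) (𝓡 d) ∞ p.extend (Set.Icc (2 * s) (2 * t)) := by
        refine hS _ _ (by linarith) (by linarith) fun u hu hmem => ?_
        refine h (u / 2) ?_ ⟨by linarith [hmem.1], by linarith [hmem.2]⟩
        exact Finset.mem_insert_of_mem (Finset.mem_union_left _ (Finset.mem_image_of_mem _ hu))
      have h2 : ContMDiff 𝓘(ℝ, ℝ) 𝓘(ℝ, ℝ) ∞ (fun u : ℝ => 2 * u) :=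
        ContDiff.contMDiff (by fun_prop)
      refine (h1.comp h2.contMDiffOn (s := Set.Icc s t) fun u hu =>
        ⟨by linarith [hu.1], by linarith [hu.2]⟩).congr fun u hu => ?_
      exact Path.extend_trans_of_le_half _ _ (hu.2.trans hle)
    · by_cases hge : 1 / 2 ≤ s
      · have h1 : ContMDiffOn 𝓘(ℝ, ℝ) (𝓡 d) ∞ q.extend (Set.Icc (2 * s - 1) (2 * t - 1)) := by
          refine hT _ _ (by linarith) (by linarith) fun u hu hmem => ?_
          refine h ((u + 1) / 2) ?_ ⟨by linarith [hmem.1], by linarith [hmem.2]⟩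
          exact Finset.mem_insert_of_mem (Finset.mem_union_right _ (Finset.mem_image_of_mem _ hu))
        have h2 : ContMDiff 𝓘(ℝ, ℝ) 𝓘(ℝ, ℝ) ∞ (fun u : ℝ => 2 * u - 1) :=
          ContDiff.contMDiff (by fun_prop)
        refine (h1.comp h2.contMDiffOn (s := Set.Icc s t) fun u hu =>
          ⟨by linarith [hu.1], by linarith [hu.2]⟩).congr fun u hu => ?_
        exact Path.extend_trans_of_half_le _ _ (hge.trans hu.1)
      · exact absurd ⟨not_le.mp hge, not_le.mp hle⟩ hhalf⟩

/-- The geometric realization of a finite graph on the vertex set `{0, …, n - 1}`: vertices are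
the standard basis vectors of `ℝⁿ`, edges are the segments joining them. -/
def realization {n : ℕ} (T : SimpleGraph (Fin n)) : Set (Fin n → ℝ) :=
  {v | ∃ a b : Fin n, (a = b ∨ T.Adj a b) ∧ v ∈ segment ℝ (Pi.single a 1) (Pi.single b 1)}

/-- A map on the unit interval is piecewise linear if there is a finite set of break points such
that it is affine on every interval whose interior contains no break point. -/
def IsPiecewiseLinear {n : ℕ} (f : I → (Fin n → ℝ)) : Prop :=
  ∃ S : Finset ℝ, ∀ s t : ℝ, (∀ u ∈ S, u ∉ Set.Ioo s t) →
    ∃ a b : Fin n → ℝ, ∀ u : I, (u : ℝ) ∈ Set.Icc s t → f u = a + (u : ℝ) • b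

/-- Two paths from `x` to `y` are thinly homotopic if they are joined by a homotopy with fixed ends
`(s, t) ↦ h₂ (h₁ (s, t))` that factors through a finite tree, `h₁ (0, ·)` and `h₁ (1, ·)` being
piecewise linear. -/
def ThinHomotopic {x y : X} (p q : PSPath d x y) : Prop :=
  ∃ (n : ℕ) (T : SimpleGraph (Fin n)), T.IsTree ∧
    ∃ (h₁ : I × I → (Fin n → ℝ)) (h₂ : (Fin n → ℝ) → X),
      Continuous h₁ ∧ (∀ z, h₁ z ∈ realization T) ∧ ContinuousOn h₂ (realization T) ∧
      IsPiecewiseLinear (fun t => h₁ (0, t)) ∧ IsPiecewiseLinear (fun t => h₁ (1, t)) ∧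
      (∀ t, h₂ (h₁ (0, t)) = p t) ∧ (∀ t, h₂ (h₁ (1, t)) = q t) ∧
      (∀ s, h₂ (h₁ (s, 0)) = x) ∧ (∀ s, h₂ (h₁ (s, 1)) = y)

/-- `q` is a reparametrization of `p`. -/
def IsReparametrization {x y : X} (p q : PSPath d x y) : Prop :=
  ∃ r : I → I, Continuous r ∧ Monotone r ∧ r 0 = 0 ∧ r 1 = 1 ∧ ∀ t, q t = p (r t)

end PSPath

/-- A (possibly degenerate) smooth two-dimensional disk in `X`, parametrised by the unit square:
the restriction to `[0,1] × [0,1]` of a smooth map defined on the plane. Sides of the square may be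
collapsed to points. -/
structure SmoothDisk (d : ℕ) (X : Type*) [TopologicalSpace X]
    [ChartedSpace (EuclideanSpace ℝ (Fin d)) X] where
  toFun : ℝ × ℝ → X
  smooth : ContMDiff 𝓘(ℝ, ℝ × ℝ) (𝓡 d) ∞ toFun

namespace SmoothDisk

theorem smooth_comp (D : SmoothDisk d X) {f : ℝ → ℝ × ℝ} (hf : ContDiff ℝ ∞ f) :
    ContMDiff 𝓘(ℝ, ℝ) (𝓡 d) ∞ (fun t => D.toFun (f t)) :=
  D.smooth.comp hf.contMDiff

/-- The boundary loop of the disk, based at the image of the corner `(0, 0)`. -/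
noncomputable def boundary (D : SmoothDisk d X) :
    PSPath d (D.toFun (0, 0)) (D.toFun (0, 0)) :=
  (((PSPath.ofSmooth (fun t => D.toFun (t, 0)) (D.smooth_comp (by fun_prop)) rfl rfl :
      PSPath d (D.toFun (0, 0)) (D.toFun (1, 0))).trans
    (PSPath.ofSmooth (fun t => D.toFun (1, t)) (D.smooth_comp (by fun_prop)) rfl rfl :
      PSPath d (D.toFun (1, 0)) (D.toFun (1, 1)))).trans
    (PSPath.ofSmooth (fun t => D.toFun (1 - t, 1)) (D.smooth_comp (by fun_prop))
      (by simp) (by simp) : PSPath d (D.toFun (1, 1)) (D.toFun (0, 1)))).trans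
    (PSPath.ofSmooth (fun t => D.toFun (0, 1 - t)) (D.smooth_comp (by fun_prop))
      (by simp) (by simp) : PSPath d (D.toFun (0, 1)) (D.toFun (0, 0)))

/-- The area of the disk: the integral over the unit square of the area of the parallelogram
spanned by the two partial derivatives. -/
noncomputable def area [RiemannianBundle (fun x : X => TangentSpace (𝓡 d) x)]
    (D : SmoothDisk d X) : ℝ :=
  ∫ z in Set.Icc (0 : ℝ) 1 ×ˢ Set.Icc (0 : ℝ) 1,
    let v : TangentSpace (𝓡 d) (D.toFun z) :=
      mfderiv 𝓘(ℝ, ℝ × ℝ) (𝓡 d) D.toFun z ((1, 0) : ℝ × ℝ)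
    let w : TangentSpace (𝓡 d) (D.toFun z) :=
      mfderiv 𝓘(ℝ, ℝ × ℝ) (𝓡 d) D.toFun z ((0, 1) : ℝ × ℝ)
    √(‖v‖ ^ 2 * ‖w‖ ^ 2 - (inner ℝ v w) ^ 2)

end SmoothDisk

end Paths

/-- The derivative at `x` of a function on `X` with values in a normed space. -/
noncomputable def dirDeriv (d : ℕ) {X : Type*} [TopologicalSpace X]
    [ChartedSpace (EuclideanSpace ℝ (Fin d)) X] {G : Type*} [NormedAddCommGroup G]
    [NormedSpace ℝ G] (f : X → G) (x : X) : TangentSpace (𝓡 d) x →L[ℝ] G :=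
  mfderiv (𝓡 d) 𝓘(ℝ, G) f x

/-! ### Hilbert module bundles with a group action -/

/-- A Hilbert `B`-module `Γ`-bundle over the `Γ`-space `X` with typical fibre the Hilbert
`B`-module `F`. It consists of Hilbert `B`-modules `fiber x`, an atlas with (for every `a : X`) one
chart defined on an open neighbourhood `dom a` of `a`, whose trivializations
`triv a x : fiber x ≃ F` (only relevant for `x ∈ dom a`) are unitary and whose transition functions
are norm continuous, and an action of `Γ` by bundle automorphisms: every `γ` acts by unitary maps
`fiber x → fiber (γ • x)` that are norm continuous in the charts. -/
structure HilbertGBundle (Γ : Type*) [Group Γ] (X : Type*) [TopologicalSpace X] [MulAction Γ X]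
    (B : Type*) [CStarAlgebra B] (F : Type v) [NormedAddCommGroup F] [NormedSpace ℂ F] [Module B F]
    [CStarModule B F] where
  fiber : X → Type v
  [normed : ∀ x, NormedAddCommGroup (fiber x)]
  [space : ∀ x, NormedSpace ℂ (fiber x)]
  [module : ∀ x, Module B (fiber x)]
  [hilbert : ∀ x, CStarModule B (fiber x)]
  dom : X → Set X
  isOpen_dom : ∀ a, IsOpen (dom a)
  mem_dom : ∀ a, a ∈ dom a
  triv : ∀ _a x : X, HilbertModuleIso B (fiber x) F
  continuousOn_transition : ∀ a b,
    ContinuousOn (fun x => (triv b x).toCLM ∘L (triv a x).invCLM) (dom a ∩ dom b)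
  act : ∀ (γ : Γ) {x y : X}, γ • x = y → HilbertModuleIso B (fiber x) (fiber y)
  act_one : ∀ (x : X) (h : (1 : Γ) • x = x) (v : fiber x), act 1 h v = v
  act_mul : ∀ (γ δ : Γ) {x y z : X} (h₁ : δ • x = y) (h₂ : γ • y = z) (h₃ : (γ * δ) • x = z)
    (v : fiber x), act (γ * δ) h₃ v = act γ h₂ (act δ h₁ v)
  continuousOn_act : ∀ (γ : Γ) (a b : X),
    ContinuousOn
      (fun x => (triv b (γ • x)).toCLM ∘L (act γ (rfl : γ • x = γ • x)).toCLM ∘L (triv a x).invCLM)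
      (dom a ∩ (fun x => γ • x) ⁻¹' dom b)

attribute [instance] HilbertGBundle.normed HilbertGBundle.space HilbertGBundle.module
  HilbertGBundle.hilbert

namespace HilbertGBundle

section

variable {d : ℕ} {X : Type*} [TopologicalSpace X] [ChartedSpace (EuclideanSpace ℝ (Fin d)) X]
  {Γ : Type*} [Group Γ] [MulAction Γ X]
  {B : Type*} [CStarAlgebra B] {F : Type*} [NormedAddCommGroup F] [NormedSpace ℂ F] [Module B F]
  [CStarModule B F]

/-- The transition function from the chart `a` to the chart `b`, as an operator on `F`. -/
def transition (E : HilbertGBundle Γ X B F) (a b x : X) : F →L[ℂ] F :=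
  (E.triv b x).toCLM ∘L (E.triv a x).invCLM

/-- The action of `γ` on the fibre at `x`, read in the charts `a` (at `x`) and `b` (at `γ • x`). -/
def actInCharts (E : HilbertGBundle Γ X B F) (γ : Γ) (a b x : X) : F →L[ℂ] F :=
  (E.triv b (γ • x)).toCLM ∘L (E.act γ (rfl : γ • x = γ • x)).toCLM ∘L (E.triv a x).invCLM

/-- The bundle is smooth: transition functions are smooth and `Γ` acts by smooth maps. -/
def IsSmooth (d : ℕ) {X : Type*} [TopologicalSpace X] [ChartedSpace (EuclideanSpace ℝ (Fin d)) X]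
    [MulAction Γ X] (E : HilbertGBundle Γ X B F) : Prop :=
  (∀ a b, ContMDiffOn (𝓡 d) 𝓘(ℝ, F →L[ℂ] F) ∞ (E.transition a b) (E.dom a ∩ E.dom b)) ∧
  ∀ (γ : Γ) (a b : X), ContMDiffOn (𝓡 d) 𝓘(ℝ, F →L[ℂ] F) ∞ (E.actInCharts γ a b)
    (E.dom a ∩ (fun x => γ • x) ⁻¹' E.dom b)

/-- Smooth sections of a smooth bundle. -/
def IsSmoothSection (d : ℕ) {X : Type*} [TopologicalSpace X]
    [ChartedSpace (EuclideanSpace ℝ (Fin d)) X] [MulAction Γ X] (E : HilbertGBundle Γ X B F)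
    (s : ∀ x, E.fiber x) : Prop :=
  ∀ a, ContMDiffOn (𝓡 d) 𝓘(ℝ, F) ∞ (fun x => E.triv a x (s x)) (E.dom a)

/-! ### Parallel transports -/

/-- A parallel transport of `E`: a continuous functor from the path groupoid of `X` to the
transport groupoid of `E`, that is, an assignment of unitary isomorphisms `E_x → E_y` to piecewise
smooth paths from `x` to `y`, which only depends on thin homotopy classes (reparametrizations
included), is compatible with constant paths and concatenation, and depends norm continuously on
the parameters of every smooth finite-dimensional family of paths. -/
structure ParallelTransport (d : ℕ) {X : Type*} [TopologicalSpace X]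
    [ChartedSpace (EuclideanSpace ℝ (Fin d)) X] [MulAction Γ X]
    (E : HilbertGBundle Γ X B F) where
  map : ∀ {x y : X}, PSPath d x y → HilbertModuleIso B (E.fiber x) (E.fiber y)
  map_thin : ∀ {x y : X} (p q : PSPath d x y), p.ThinHomotopic q → ∀ v, map p v = map q v
  map_reparametrization : ∀ {x y : X} (p q : PSPath d x y), p.IsReparametrization q →
    ∀ v, map p v = map q v
  map_refl : ∀ (x : X) (v : E.fiber x), map (PSPath.refl x) v = v
  map_trans : ∀ {x y z : X} (p : PSPath d x y) (q : PSPath d y z) (v : E.fiber x),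
    map (p.trans q) v = map q (map p v)
  continuous : ∀ (m : ℕ) (h : EuclideanSpace ℝ (Fin m) × ℝ → X)
    (_ : ContMDiff 𝓘(ℝ, EuclideanSpace ℝ (Fin m) × ℝ) (𝓡 d) ∞ h)
    (hc : ∀ u, ContMDiff 𝓘(ℝ, ℝ) (𝓡 d) ∞ (fun t => h (u, t))) (a b : X),
    ContinuousOn
      (fun u => (E.triv b (h (u, 1))).toCLM ∘L
        (map (PSPath.ofSmooth (fun t => h (u, t)) (hc u) rfl rfl)).toCLM ∘L
        (E.triv a (h (u, 0))).invCLM)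
      {u | h (u, 0) ∈ E.dom a ∧ h (u, 1) ∈ E.dom b}

namespace ParallelTransport

variable {E : HilbertGBundle Γ X B F}

/-- `‖Φ_p - id‖ ≤ ε · area D` for every loop `p` and every two-dimensional disk `D` spanning
`p`. -/
def IsCloseToId [RiemannianBundle (fun x : X => TangentSpace (𝓡 d) x)]
    (Φ : E.ParallelTransport d) (ε : ℝ) : Prop :=
  ∀ D : SmoothDisk d X,
    ‖(Φ.map D.boundary).toCLM - ContinuousLinearMap.id ℂ _‖ ≤ ε * D.area

/-- The parallel transport commutes with the action of `Γ`. -/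
def IsEquivariant (Φ : E.ParallelTransport d) : Prop :=
  ∀ (γ : Γ) {x y x' y' : X} (hx : γ • x = x') (hy : γ • y = y')
    (p : PSPath d x y) (q : PSPath d x' y'), (∀ t, q t = γ • p t) →
    ∀ v, Φ.map q (E.act γ hx v) = E.act γ hy (Φ.map p v)

end ParallelTransport

/-! ### Connections -/

/-- A `Γ`-invariant connection on a smooth Hilbert `B`-module `Γ`-bundle `E`: `nabla s x v` is the
covariant derivative at `x`, in the direction `v`, of the smooth section `s` (the value on
sections which are not smooth is irrelevant). It is additive and `B`-linear in `s`, satisfies the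
Leibniz rule, maps smooth sections to smooth sections, is compatible with the inner product and
commutes with the action of `Γ`. -/
structure InvariantConnection (d : ℕ) {X : Type*} [TopologicalSpace X]
    [ChartedSpace (EuclideanSpace ℝ (Fin d)) X] [IsManifold (𝓡 d) ∞ X] [MulAction Γ X]
    (E : HilbertGBundle Γ X B F) where
  nabla : (∀ x, E.fiber x) → ∀ x, TangentSpace (𝓡 d) x →L[ℝ] E.fiber x
  add : ∀ s t, E.IsSmoothSection d s → E.IsSmoothSection d t → ∀ x v,
    nabla (fun y => s y + t y) x v = nabla s x v + nabla t x v
  smul_alg : ∀ (b : B) (s), E.IsSmoothSection d s → ∀ x v,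
    nabla (fun y => b • s y) x v = b • nabla s x v
  leibniz : ∀ (f : X → ℝ) (s), ContMDiff (𝓡 d) 𝓘(ℝ, ℝ) ∞ f → E.IsSmoothSection d s → ∀ x v,
    nabla (fun y => f y • s y) x v =
      dirDeriv d f x v • s x + f x • nabla s x v
  smooth : ∀ (s) (W : ∀ x : X, TangentSpace (𝓡 d) x), E.IsSmoothSection d s →
    ContMDiff (𝓡 d) ((𝓡 d).prod (𝓡 d)) ∞
      (fun x => (⟨x, W x⟩ : TangentBundle (𝓡 d) X)) →
    E.IsSmoothSection d (fun x => nabla s x (W x))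
  metric : ∀ s t, E.IsSmoothSection d s → E.IsSmoothSection d t → ∀ x v,
    dirDeriv d (fun y => inner B (s y) (t y)) x v =
      inner B (nabla s x v) (t x) + inner B (s x) (nabla t x v)
  invariant : ∀ (γ : Γ) (s s'), E.IsSmoothSection d s → E.IsSmoothSection d s' →
    (∀ x, s' (γ • x) = E.act γ rfl (s x)) → ∀ x v,
    nabla s' (γ • x) (mfderiv (𝓡 d) (𝓡 d) (fun y => γ • y) x v) = E.act γ rfl (nabla s x v)

/-- The parallel transport `Φ` comes from the connection `∇`: along every smooth curve `c`, the
covariant derivative `∇_{c'(0)} s` is the derivative at `t = 0` of the section `s` at `c t`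
transported back to `c 0` along `c`. -/
def ParallelTransport.ComesFrom [IsManifold (𝓡 d) ∞ X] {E : HilbertGBundle Γ X B F}
    (Φ : E.ParallelTransport d) (C : E.InvariantConnection d) : Prop :=
  ∀ (c : ℝ → X) (_ : ContMDiff 𝓘(ℝ, ℝ) (𝓡 d) ∞ c)
    (hct : ∀ t : ℝ, ContMDiff 𝓘(ℝ, ℝ) (𝓡 d) ∞ (fun r : ℝ => c (r * t)))
    (s : ∀ x, E.fiber x), E.IsSmoothSection d s →
    HasDerivAt
      (fun t : ℝ => (Φ.map (PSPath.ofSmooth (x := c 0) (y := c t) (fun r : ℝ => c (r * t)) (hct t)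
        (by simp) (by simp))).invCLM (s (c t)))
      (C.nabla s (c 0) (mfderiv 𝓘(ℝ, ℝ) (𝓡 d) c 0 (1 : ℝ))) 0

end

/-! ### Bundles over the product algebra -/

section Product

variable {d : ℕ} {X : Type*} [MetricSpace X] [ChartedSpace (EuclideanSpace ℝ (Fin d)) X]
  {Γ : Type*} [Group Γ] [MulAction Γ X]
  {B : ℕ → Type*} [∀ k, CStarAlgebra (B k)] [∀ k, Nontrivial (B k)]
  {F : ℕ → Type*} [∀ k, NormedAddCommGroup (F k)] [∀ k, NormedSpace ℂ (F k)]
  [∀ k, Module (B k) (F k)] [∀ k, CStarModule (B k) (F k)]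

/-- The transition functions of the atlas are Lipschitz continuous, with a common constant. -/
def HasLipschitzTransitions {B : Type*} [CStarAlgebra B] {F : Type*} [NormedAddCommGroup F]
    [NormedSpace ℂ F] [Module B F] [CStarModule B F] (V : HilbertGBundle Γ X B F) : Prop :=
  ∃ L : ℝ≥0, ∀ a b, LipschitzOnWith L (V.transition a b) (V.dom a ∩ V.dom b)

/-- The transition functions, which are unitary operators on `∏ₖ Fₖ`, are in diagonal form
`(ψₖ)ₖ` with `ψₖ` a unitary operator on `Fₖ`. -/
def HasDiagonalTransitions (V : HilbertGBundle Γ X (lp B ∞) (lp F ∞)) : Prop :=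
  ∀ a b, ∀ x ∈ V.dom a ∩ V.dom b, ∃ ψ : ∀ k, HilbertModuleIso (B k) (F k) (F k),
    ∀ (w : lp F ∞) (k : ℕ), V.transition a b x w k = ψ k (w k)

/-- An isomorphism of Hilbert `Bₖ`-module `Γ`-bundles between the `k`-th component
`V ⊗_{pₖ} Bₖ` of `V` and `E`, where `pₖ : ∏ⱼ Bⱼ → Bₖ` is the projection. As `pₖ` is surjective,
`V_x ⊗_{pₖ} Bₖ` is the quotient of `V_x` by the null space of `pₖ ⟨v, v⟩`; the isomorphism is given
by its composition `proj x : V_x → E_x` with the quotient map. -/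
structure ComponentIso (V : HilbertGBundle Γ X (lp B ∞) (lp F ∞)) (k : ℕ)
    (E : HilbertGBundle Γ X (B k) (F k)) where
  proj : ∀ x, V.fiber x →L[ℂ] E.fiber x
  surjective : ∀ x, Function.Surjective (proj x)
  map_smul : ∀ x (b : lp B ∞) (v : V.fiber x), proj x (b • v) = b k • proj x v
  map_inner : ∀ x (v w : V.fiber x),
    inner (B k) (proj x v) (proj x w) = (inner (lp B ∞) v w : lp B ∞) k
  equivariant : ∀ (γ : Γ) {x y : X} (h : γ • x = y) (v : V.fiber x),
    proj y (V.act γ h v) = E.act γ h (proj x v)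
  continuousOn : ∀ a b, ContinuousOn
    (fun x => (E.triv b x).toCLM ∘L proj x ∘L (V.triv a x).invCLM) (V.dom a ∩ E.dom b)

/-- The isomorphism between the `k`-th component of `V` and `E` is smooth in the charts of `V`
and `E`. -/
def ComponentIso.IsSmooth (d : ℕ) {X : Type*} [MetricSpace X]
    [ChartedSpace (EuclideanSpace ℝ (Fin d)) X] [MulAction Γ X]
    {V : HilbertGBundle Γ X (lp B ∞) (lp F ∞)} {k : ℕ} {E : HilbertGBundle Γ X (B k) (F k)}
    (P : V.ComponentIso k E) : Prop :=
  ∀ a b, ContMDiffOn (𝓡 d) 𝓘(ℝ, lp F ∞ →L[ℂ] F k) ∞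
    (fun x => (E.triv b x).toCLM ∘L P.proj x ∘L (V.triv a x).invCLM) (V.dom a ∩ E.dom b)

/-- The sections of `V` that a connection on `V` differentiates: those which are locally Lipschitz
in the charts of `V` and whose components are smooth sections of the bundles `Eₖ`. -/
def IsLipschitzSection (d : ℕ) {X : Type*} [MetricSpace X]
    [ChartedSpace (EuclideanSpace ℝ (Fin d)) X] [MulAction Γ X]
    {V : HilbertGBundle Γ X (lp B ∞) (lp F ∞)}
    {E : ∀ k, HilbertGBundle Γ X (B k) (F k)} (P : ∀ k, V.ComponentIso k (E k))
    (s : ∀ x, V.fiber x) : Prop :=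
  (∀ a, LocallyLipschitzOn (V.dom a) (fun x => V.triv a x (s x))) ∧
  ∀ k, (E k).IsSmoothSection d (fun x => (P k).proj x (s x))

/-- A continuous `Γ`-invariant connection on `V` induced by the connections `∇ᵏ` on `Eₖ`: the
`k`-th component of `∇_v s` is `∇ᵏ_v` of the `k`-th component of `s`. It satisfies the rules of a
connection; the derivative of the `∏ₖ Bₖ`-valued Lipschitz function `⟨s, t⟩` is the componentwise
one. Continuity means that it is a bounded operator from Lipschitz sections to bounded sections:
if `s` is `K`-Lipschitz near `x` in some chart, then `‖∇_v s‖ ≤ C (K + ‖s x‖) ‖v‖` at `x`, with a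
constant `C` that depends neither on `s` nor on the chart and the point. -/
structure InducedConnection (d : ℕ) {X : Type*} [MetricSpace X]
    [ChartedSpace (EuclideanSpace ℝ (Fin d)) X] [IsManifold (𝓡 d) ∞ X]
    [RiemannianBundle (fun x : X => TangentSpace (𝓡 d) x)] [MulAction Γ X]
    {V : HilbertGBundle Γ X (lp B ∞) (lp F ∞)}
    {E : ∀ k, HilbertGBundle Γ X (B k) (F k)} (P : ∀ k, V.ComponentIso k (E k))
    (C : ∀ k, (E k).InvariantConnection d) where
  nabla : (∀ x, V.fiber x) → ∀ x, TangentSpace (𝓡 d) x →L[ℝ] V.fiber x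
  component : ∀ s, IsLipschitzSection d P s → ∀ k x v,
    (P k).proj x (nabla s x v) = (C k).nabla (fun y => (P k).proj y (s y)) x v
  add : ∀ s t, IsLipschitzSection d P s → IsLipschitzSection d P t → ∀ x v,
    nabla (fun y => s y + t y) x v = nabla s x v + nabla t x v
  smul_alg : ∀ (b : lp B ∞) (s), IsLipschitzSection d P s → ∀ x v,
    nabla (fun y => b • s y) x v = b • nabla s x v
  leibniz : ∀ (f : X → ℝ) (s), ContMDiff (𝓡 d) 𝓘(ℝ, ℝ) ∞ f → IsLipschitzSection d P s → ∀ x v,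
    nabla (fun y => f y • s y) x v =
      dirDeriv d f x v • s x + f x • nabla s x v
  metric : ∀ s t, IsLipschitzSection d P s → IsLipschitzSection d P t → ∀ (k : ℕ) x v,
    dirDeriv d (fun y => (inner (lp B ∞) (s y) (t y) : lp B ∞) k) x v =
      (inner (lp B ∞) (nabla s x v) (t x) + inner (lp B ∞) (s x) (nabla t x v) : lp B ∞) k
  invariant : ∀ (γ : Γ) (s s'), IsLipschitzSection d P s → IsLipschitzSection d P s' →
    (∀ x, s' (γ • x) = V.act γ rfl (s x)) → ∀ x v,
    nabla s' (γ • x) (mfderiv (𝓡 d) (𝓡 d) (fun y => γ • y) x v) = V.act γ rfl (nabla s x v)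
  continuous : ∃ c : ℝ, ∀ s, IsLipschitzSection d P s → ∀ a, ∀ x ∈ V.dom a, ∀ (K : ℝ≥0),
    ∀ U ∈ 𝓝 x, LipschitzOnWith K (fun y => V.triv a y (s y)) U →
    ∀ v : TangentSpace (𝓡 d) x, ‖nabla s x v‖ ≤ c * (K + ‖s x‖) * ‖v‖

end Product

end HilbertGBundle

/-! Finite generation of the product needs generators and coefficients bounded independently of `k`.
Let `T : Aⁿ → G` be the map given by the generators, with Gram matrix `h ≥ 0`. The images under `T`
of the rows of `(h + δ)^(-1/2)` have norm at most one, and for small `δ` their frame operator `∑ ⟨e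
j, ·⟩ e j` is within `1/2` of the identity. Inverting it gives coefficients of norm at most `2 ‖v‖`
(`CStarModule.exists_bounded_generators`), whatever the original generators were.

The fibres of `V` are the bounded sequences in the fibres of the bundles `E k`. Fix an almost
isometric chart of `X` around `a` and trivialize every `E k` over it by transport along rays from
`a` (`NormalChart.frame`). Transport along a curve, read in this trivialization, is the holonomy
around the cone over the curve. The area of the cone is at most a constant times the Lipschitz
constant `L` of the curve, so the transport is within `8 |ε| L` of the identity
(`NormalChart.norm_frame_map_sub_le_of_lipschitz`). Comparing two radial trivializations along a
short curve from `x` to `y` shows that the transition functions are Lipschitz with constant `128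
|ε|`; equivariance gives the same for the action of `Γ`. Since this constant involves neither `k`
nor the charts, the diagonal operators are norm continuous on bounded sequences, and
`HilbertGBundle.productBundle` is a bundle whose components are the `E k`.

For smoothness, let `H` be the inverse of the comparison of the radial trivialization with a chart
of `E k`. Along rays `d/dt H (t z) w = H (t z) (η (t z, z) w)`, where `η` is the connection form.
The axioms give smoothness of `η` only after evaluation on vectors; a finite dual basis of the fibre
(`CStarModule.exists_dual_frame`) turns it into smoothness in the operator norm. The equation then
becomes a Volterra equation for continuous paths of operators, whose solution is smooth in the
parameters (`contDiffAt_of_ray`), so that smoothness spreads along rays from the centre.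

Finally, `∇ᵏ` is the derivative of the section transported back along a curve. If a section is
`K`-Lipschitz in the radial trivialization, the transport estimate yields `‖∇ᵏ_v s‖ ≤ 4 (K + 8 |ε|
‖s‖) ‖v‖` (`NormalChart.norm_nabla_le`). This is uniform in `k`, so the componentwise covariant
derivatives form a bounded sequence. -/

/-! ### Finitely generated Hilbert modules -/

namespace CStarModule

section

variable {A G : Type*} [CStarAlgebra A] [NormedAddCommGroup G] [NormedSpace ℂ G] [Module A G]
  [CStarModule A G]

theorem ext_inner {v w : G} (h : ∀ x : G, inner A x v = inner A x w) : v = w := by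
  rw [← sub_eq_zero, ← CStarModule.inner_self (A := A), CStarModule.inner_sub_right, h, sub_self]

theorem complex_smul_smul (c : ℂ) (a : A) (v : G) : (c • a) • v = c • (a • v) :=
  ext_inner (A := A) fun x => by simp

theorem smul_complex_smul (c : ℂ) (a : A) (v : G) : a • (c • v) = c • (a • v) :=
  ext_inner (A := A) fun x => by simp

theorem smul_real_smul (c : ℝ) (a : A) (v : G) : a • (c • v) = c • (a • v) := by
  rw [← Complex.coe_smul, ← Complex.coe_smul, smul_complex_smul]

end

section FunctionalCalculus

variable {M : Type*} [CStarAlgebra M] {h : M}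

/-- A self-adjoint element `h` has nonnegative spectrum as soon as its negative part `p` vanishes,
and `q = √p` satisfies `q h q = - p²`. -/
theorem exists_negPart (hsa : IsSelfAdjoint h) : ∃ p q : M, IsSelfAdjoint p ∧ IsSelfAdjoint q ∧
    q * h * q = -(p * p) ∧ (p = 0 → ∀ x ∈ spectrum ℝ h, 0 ≤ x) := by
  set p := cfc (fun x : ℝ => max (-x) 0) h with hp
  set q := cfc (fun x : ℝ => √(max (-x) 0)) h with hq
  refine ⟨p, q, cfc_predicate _ h, cfc_predicate _ h, ?_, fun hp0 => ?_⟩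
  · have hid : h = cfc (fun x : ℝ => x) h := (cfc_id' ℝ h).symm
    calc q * h * q = q * cfc (fun x : ℝ => x) h * q := by rw [← hid]
      _ = -(p * p) := by
        rw [hq, hp, ← cfc_mul .., ← cfc_mul .., ← cfc_mul .., ← cfc_neg ..]
        refine cfc_congr fun x _ => ?_
        have := Real.mul_self_sqrt (le_max_right (-x) 0)
        rcases le_total x 0 with h0 | h0
        · rw [max_eq_left (by linarith)] at *
          linear_combination x * this
        · simp [max_eq_right (neg_nonpos.mpr h0)]
  · by_contra! hneg
    obtain ⟨x, hx, hneg⟩ := hneg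
    have := cfc_map_spectrum (R := ℝ) (fun x : ℝ => max (-x) 0) h
    rw [← hp, hp0] at this
    have hmem : max (-x) 0 ∈ spectrum ℝ (0 : M) := by
      rw [this]; exact ⟨x, hx, rfl⟩
    have h3 := spectrum.norm_le_norm_mul_of_mem hmem
    rw [norm_zero, zero_mul, norm_le_zero_iff] at h3
    have := le_max_left (-x) 0
    linarith

/-- Functional calculus with `a = (h + δ)^(-1/2)` and `k = δ (h + δ)⁻¹`. The two norm bounds are the
scalar inequalities `x / (x + δ) ≤ 1` and `4 δ x ≤ (x + δ)²`. -/
theorem exists_approx_inv_sqrt (hsa : IsSelfAdjoint h) (hspec : ∀ x ∈ spectrum ℝ h, 0 ≤ x) {δ : ℝ}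
    (hδ0 : 0 < δ) : ∃ a k : M, IsSelfAdjoint a ∧ IsSelfAdjoint k ∧ h * (a * a) = 1 - k ∧
      ‖a * h * a‖ ≤ 1 ^ 2 ∧ ‖k * h * k‖ ≤ (√δ / 2) ^ 2 := by
  have hid : h = cfc (fun x : ℝ => x) h := (cfc_id' ℝ h).symm
  have hcont : ContinuousOn (fun x : ℝ => (√(x + δ))⁻¹) (spectrum ℝ h) := by
    refine ContinuousOn.inv₀ (by fun_prop) fun x hx => ?_
    have := hspec x hx
    positivity
  have hcontk : ContinuousOn (fun x : ℝ => δ / (x + δ)) (spectrum ℝ h) := by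
    refine ContinuousOn.div (by fun_prop) (by fun_prop) fun x hx => ?_
    have := hspec x hx
    positivity
  set a := cfc (fun x : ℝ => (√(x + δ))⁻¹) h with ha
  set k := cfc (fun x : ℝ => δ / (x + δ)) h with hk
  refine ⟨a, k, cfc_predicate _ h, cfc_predicate _ h, ?_, ?_, ?_⟩
  · have : h * (a * a) = cfc (fun x : ℝ => x) h * (a * a) := by rw [← hid]
    rw [this, ha, hk, ← cfc_mul _ _ h hcont hcont,
      ← cfc_mul _ _ h (continuousOn_id' _)
        (show ContinuousOn (fun x : ℝ => (√(x + δ))⁻¹ * (√(x + δ))⁻¹) _ from hcont.mul hcont), ← cfc_one ℝ h,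
      ← cfc_sub _ _ h continuous_one.continuousOn hcontk]
    refine cfc_congr fun x hx => ?_
    have := hspec x hx
    have h0 : x + δ ≠ 0 := by positivity
    have h1 : (√(x + δ))⁻¹ * (√(x + δ))⁻¹ = (x + δ)⁻¹ := by
      rw [← mul_inv, Real.mul_self_sqrt (by positivity)]
    simp only [h1, Pi.one_apply]
    field_simp
    ring
  · have : a * h * a = a * cfc (fun x : ℝ => x) h * a := by rw [← hid]
    rw [this, ha, ← cfc_mul _ _ h hcont (continuousOn_id' _),
      ← cfc_mul _ _ h
        (show ContinuousOn (fun x : ℝ => (√(x + δ))⁻¹ * x) _ from hcont.mul (continuousOn_id' _)) hcont]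
    refine norm_cfc_le (by norm_num) fun x hx => ?_
    have h0 := hspec x hx
    have h1 : (√(x + δ))⁻¹ * x * (√(x + δ))⁻¹ = x / (x + δ) := by
      rw [mul_right_comm, ← mul_inv, Real.mul_self_sqrt (by positivity)]
      ring
    rw [h1, Real.norm_of_nonneg (by positivity), one_pow, div_le_one (by positivity)]
    linarith
  · have : k * h * k = k * cfc (fun x : ℝ => x) h * k := by rw [← hid]
    rw [this, hk, ← cfc_mul _ _ h hcontk (continuousOn_id' _),
      ← cfc_mul _ _ h
        (show ContinuousOn (fun x : ℝ => δ / (x + δ) * x) _ from hcontk.mul (continuousOn_id' _)) hcontk]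
    refine norm_cfc_le (by positivity) fun x hx => ?_
    have h0 := hspec x hx
    have h1 : δ / (x + δ) * x * (δ / (x + δ)) = δ ^ 2 * x / (x + δ) ^ 2 := by
      field_simp
    rw [h1, Real.norm_of_nonneg (by positivity), div_pow, Real.sq_sqrt hδ0.le,
      div_le_div_iff₀ (by positivity) (by norm_num)]
    nlinarith [mul_nonneg hδ0.le (sq_nonneg (x - δ))]

end FunctionalCalculus

section Frame

open CStarMatrix WithCStarModule

variable {A G : Type*} [CStarAlgebra A] [NormedAddCommGroup G] [NormedSpace ℂ G] [Module A G]
  [CStarModule A G] {n : ℕ}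

/-- The map `Aⁿ → G` given by `n` elements of `G`. -/
noncomputable def synthesis (g : Fin n → G) : C⋆ᵐᵒᵈ(A, Fin n → A) →L[ℂ] G :=
  LinearMap.mkContinuous
    { toFun := fun ξ => ∑ i, ξ i • g i
      map_add' := fun ξ η => by simp [add_smul, Finset.sum_add_distrib]
      map_smul' := fun c ξ => by simp [complex_smul_smul, Finset.smul_sum] }
    (∑ i, ‖g i‖) fun ξ => by
      change ‖∑ i, ξ i • g i‖ ≤ _
      rw [Finset.sum_mul]
      refine norm_sum_le_of_le _ fun i _ => ?_
      refine (CStarModule.norm_alg_smul_le _ _).trans ?_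
      rw [mul_comm]
      gcongr
      exact norm_apply_le_norm ξ i

theorem synthesis_apply (g : Fin n → G) (ξ : C⋆ᵐᵒᵈ(A, Fin n → A)) :
    synthesis g ξ = ∑ i, ξ i • g i := rfl

/-- The Gram matrix of a finite family. -/
def gram (A : Type*) {G : Type*} [Inner A G] (g : Fin n → G) : CStarMatrix (Fin n) (Fin n) A :=
  CStarMatrix.ofMatrix (Matrix.of fun i j => inner A (g j) (g i))

theorem inner_synthesis (g : Fin n → G) (ξ η : C⋆ᵐᵒᵈ(A, Fin n → A)) :
    inner A (synthesis g ξ) (synthesis g η) = inner A ξ (toCLM (gram A g) η) := by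
  simp only [synthesis_apply, inner_sum_left, inner_sum_right, inner_op_smul_left,
    inner_op_smul_right, toCLM_apply_eq_sum, pi_inner, equiv_symm_pi_apply, inner_def,
    Finset.sum_mul]
  rw [Finset.sum_comm]
  simp [gram, mul_assoc, Finset.mul_sum]

theorem isSelfAdjoint_gram (g : Fin n → G) : IsSelfAdjoint (gram A g) := by
  ext i j
  simp [gram, CStarMatrix.star_apply]

/-- Matrices act on row vectors from the right, so the order of the factors is reversed. -/
theorem toCLM_mul (M N : CStarMatrix (Fin n) (Fin n) A) (ξ : C⋆ᵐᵒᵈ(A, Fin n → A)) :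
    toCLM (M * N) ξ = toCLM N (toCLM M ξ) := by
  have h := map_mul (toCLMNonUnitalAlgHom (A := A) (n := Fin n)) M N
  simp only [toCLMNonUnitalAlgHom_eq_toCLM, ← MulOpposite.op_mul, MulOpposite.op_inj] at h
  rw [h]
  rfl

theorem inner_toCLM_left {M : CStarMatrix (Fin n) (Fin n) A} (hM : IsSelfAdjoint M)
    (ξ η : C⋆ᵐᵒᵈ(A, Fin n → A)) : inner A (toCLM M ξ) η = inner A ξ (toCLM M η) := by
  conv_lhs => rw [← hM.star_eq]
  exact inner_toCLM_conjTranspose_left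

/-- With `p` the negative part of the Gram matrix and `q = √p`, the nonnegative element `⟨T q ξ, T q
ξ⟩` equals `-⟨p ξ, p ξ⟩`, where `T` is `synthesis g`. Hence `p ξ = 0` for all `ξ`. -/
theorem nonneg_of_mem_spectrum_gram (g : Fin n → G) {x : ℝ} (hx : x ∈ spectrum ℝ (gram A g)) :
    0 ≤ x := by
  set h := gram A g with hh
  have hsa : IsSelfAdjoint h := isSelfAdjoint_gram g
  obtain ⟨p, q, hpsa, hqsa, hmul, hspec⟩ := exists_negPart hsa
  refine hspec ?_ x hx
  refine toCLM_injective ?_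
  rw [map_zero]
  ext1 ξ
  refine (CStarModule.inner_self (A := A)).mp (le_antisymm ?_ CStarModule.inner_self_nonneg)
  have h1 : inner A (synthesis g (toCLM q ξ)) (synthesis g (toCLM q ξ)) =
      -inner A (toCLM p ξ) (toCLM p ξ) := by
    rw [inner_synthesis, inner_toCLM_left hqsa, inner_toCLM_left hpsa, ← toCLM_mul, ← toCLM_mul,
      ← toCLM_mul, ← mul_assoc, hmul]
    simp
  have h2 : (0 : A) ≤ -inner A (toCLM p ξ) (toCLM p ξ) := h1 ▸ CStarModule.inner_self_nonneg
  exact neg_nonneg.mp h2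

theorem norm_inner_toCLM_le (M : CStarMatrix (Fin n) (Fin n) A) (ξ : C⋆ᵐᵒᵈ(A, Fin n → A)) :
    ‖inner A ξ (toCLM M ξ)‖ ≤ ‖M‖ * ‖ξ‖ ^ 2 := by
  refine (CStarModule.norm_inner_le _).trans ?_
  calc ‖ξ‖ * ‖toCLM M ξ‖ ≤ ‖ξ‖ * (‖M‖ * ‖ξ‖) := by
        gcongr
        exact (toCLM M).le_opNorm ξ
    _ = _ := by ring

/-- The squared norm of the left side is `‖⟨ξ, M h M ξ⟩‖`, with `h` the Gram matrix. -/
theorem norm_synthesis_toCLM_le (g : Fin n → G) {M : CStarMatrix (Fin n) (Fin n) A}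
    (hM : IsSelfAdjoint M) {c : ℝ} (hc : 0 ≤ c) (h : ‖M * gram A g * M‖ ≤ c ^ 2)
    (ξ : C⋆ᵐᵒᵈ(A, Fin n → A)) : ‖synthesis g (toCLM M ξ)‖ ≤ c * ‖ξ‖ := by
  refine (pow_le_pow_iff_left₀ (norm_nonneg _) (by positivity) two_ne_zero).mp ?_
  rw [CStarModule.norm_sq_eq A, inner_synthesis, inner_toCLM_left hM, ← toCLM_mul, ← toCLM_mul,
    ← mul_assoc, mul_pow]
  exact (norm_inner_toCLM_le _ _).trans (by gcongr)

variable [CompleteSpace G]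

/-- A Hilbert module generated by `n` elements has `n` generators of norm at most one for which the
coefficients of a vector can be chosen with norm at most twice the norm of the vector. -/
theorem exists_bounded_generators {g : Fin n → G} (hg : Submodule.span A (Set.range g) = ⊤) :
    ∃ e : Fin n → G, (∀ i, ‖e i‖ ≤ 1) ∧
      ∀ v, ∃ b : Fin n → A, (∀ i, ‖b i‖ ≤ 2 * ‖v‖) ∧ v = ∑ i, b i • e i := by
  classical
  have hsurj : Function.Surjective (synthesis (A := A) g) := fun v => by
    obtain ⟨c, hc⟩ := (Submodule.mem_span_range_iff_exists_fun A).mp (hg ▸ Submodule.mem_top :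
      v ∈ Submodule.span A (Set.range g))
    exact ⟨(WithCStarModule.equiv _ _).symm c, by simpa [synthesis_apply] using hc⟩
  obtain ⟨C, hC0, hC⟩ := (synthesis (A := A) g).exists_preimage_norm_le hsurj
  -- Chosen so that `√δ / 2 * C = 1 / 2`: the open mapping constant `C`, over which there is no
  -- control, drops out of all later bounds.
  set δ : ℝ := (C ^ 2)⁻¹ with hδ
  have hδ0 : 0 < δ := by positivity
  set h := gram A g with hh
  have hsa : IsSelfAdjoint h := isSelfAdjoint_gram g
  have hspec : ∀ x ∈ spectrum ℝ h, 0 ≤ x := fun x hx => nonneg_of_mem_spectrum_gram g hx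
  obtain ⟨a, k, hasa, hksa, hk1, hnorma, hnormk⟩ := exists_approx_inv_sqrt hsa hspec hδ0
  let e : Fin n → G := fun j =>
    synthesis g (toCLM a ((WithCStarModule.equiv A (Fin n → A)).symm (Pi.single j 1)))
  have he : ∀ j, ‖e j‖ ≤ 1 := fun j => by
    refine (norm_synthesis_toCLM_le g hasa zero_le_one hnorma _).trans ?_
    rw [one_mul, norm_single]
    rcases subsingleton_or_nontrivial A with _ | _
    · simp [Subsingleton.elim (1 : A) 0]
    · exact norm_one.le
  -- The frame operator of the family `e`. On `synthesis g ξ` it acts as `h a² = 1 - k` acts on `ξ`,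
  -- so its distance from the identity is governed by `k`.
  let P : G →ₗ[ℂ] G :=
    { toFun := fun v => ∑ j, inner A (e j) v • e j
      map_add' := fun v w => by simp [add_smul, Finset.sum_add_distrib]
      map_smul' := fun c v => by simp [complex_smul_smul, Finset.smul_sum] }
  have hP : ∀ ξ, P (synthesis g ξ) = synthesis g (toCLM (h * (a * a)) ξ) := fun ξ => by
    change ∑ j, inner A (e j) (synthesis g ξ) • e j = _
    have : ∀ j, inner A (e j) (synthesis g ξ) = toCLM (h * a) ξ j := fun j => by
      rw [inner_synthesis, ← hh, inner_toCLM_left hasa, ← toCLM_mul, inner_single_left]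
      simp [inner_def]
    simp only [this]
    rw [← mul_assoc, toCLM_mul (h * a) a]
    have hsum : ∀ η : C⋆ᵐᵒᵈ(A, Fin n → A), ∑ j, η j • e j = synthesis g (toCLM a η) := fun η => by
      simp only [e, synthesis_apply, Finset.smul_sum, toCLM_apply_eq_sum, equiv_symm_pi_apply,
        Finset.sum_smul, smul_smul]
      rw [Finset.sum_comm]
      simp [Pi.single_apply]
    exact hsum _
  have hR : ∀ v, ‖(LinearMap.id - P : G →ₗ[ℂ] G) v‖ ≤ 1 / 2 * ‖v‖ := fun v => by
    obtain ⟨ξ, rfl, hξ⟩ := hC v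
    have h1 : (LinearMap.id - P : G →ₗ[ℂ] G) (synthesis g ξ) = synthesis g (toCLM k ξ) := by
      rw [LinearMap.sub_apply, hP, LinearMap.id_apply, ← map_sub, hk1]
      congr 1
      have h2 : toCLM (1 : CStarMatrix (Fin n) (Fin n) A) ξ = ξ := by
        rw [toCLM_apply]
        exact congrArg (WithCStarModule.equiv A (Fin n → A)).symm (Matrix.vecMul_one _)
      simp [h2]
    rw [h1]
    refine (norm_synthesis_toCLM_le g hksa (by positivity) hnormk _).trans ?_
    calc √δ / 2 * ‖ξ‖ ≤ √δ / 2 * (C * ‖synthesis g ξ‖) := by gcongr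
      _ = 1 / 2 * ‖synthesis g ξ‖ := by
        rw [hδ, Real.sqrt_inv, Real.sqrt_sq hC0.le]
        field_simp
  let R : G →L[ℂ] G := (LinearMap.id - P : G →ₗ[ℂ] G).mkContinuous (1 / 2) hR
  have hR1 : ‖R‖ ≤ 1 / 2 := LinearMap.mkContinuous_norm_le _ (by norm_num) _
  refine ⟨e, he, fun v => ?_⟩
  -- This unit is `1 - R = P`, invertible by the Neumann series.
  let U := Units.oneSub R (hR1.trans_lt (by norm_num))
  set u : G := (↑U⁻¹ : G →L[ℂ] G) v with hu
  have hPu : P u = v := by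
    have h1 : ((U : G →L[ℂ] G) * ↑U⁻¹) v = v := by rw [Units.mul_inv]; rfl
    have h2 : (U : G →L[ℂ] G) u = P u := by
      change u - (u - P u) = P u
      abel
    rw [← h2]
    exact h1
  have hun : ‖u‖ ≤ 2 * ‖v‖ := by
    have h1 : u = P u + R u := by
      change u = P u + (u - P u)
      abel
    have h2 : ‖u‖ ≤ ‖v‖ + 1 / 2 * ‖u‖ := by
      conv_lhs => rw [h1, hPu]
      exact (norm_add_le _ _).trans (by gcongr; exact hR u)
    linarith
  refine ⟨fun j => inner A (e j) u, fun j => ?_, hPu.symm⟩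
  refine (CStarModule.norm_inner_le _).trans ?_
  calc ‖e j‖ * ‖u‖ ≤ 1 * (2 * ‖v‖) := by gcongr; exact he j
    _ = _ := one_mul _

end Frame

end CStarModule

/-! ### Finite generation of the product module -/

section ProductModule

variable {B : ℕ → Type*} [∀ k, CStarAlgebra (B k)] [∀ k, Nontrivial (B k)]
  {F : ℕ → Type*} [∀ k, NormedAddCommGroup (F k)] [∀ k, NormedSpace ℂ (F k)]
  [∀ k, Module (B k) (F k)] [∀ k, CStarModule (B k) (F k)]

/-- The element of `∏ₖ Gₖ` with the given uniformly bounded components. -/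
def lp.ofBounded {G : ℕ → Type*} [∀ k, NormedAddCommGroup (G k)] (v : ∀ k, G k) (C : ℝ)
    (h : ∀ k, ‖v k‖ ≤ C) : lp G ∞ :=
  ⟨v, memℓp_infty ⟨C, by rintro _ ⟨k, rfl⟩; exact h k⟩⟩

/-- A product of Hilbert modules which are generated by at most `n` elements is finitely
generated. -/
theorem finite_prod_of_generators [∀ k, CompleteSpace (F k)]
    (hF : ∃ n : ℕ, ∀ k, ∃ g : Fin n → F k, Submodule.span (B k) (Set.range g) = ⊤) :
    Module.Finite (lp B ∞) (lp F ∞) := by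
  classical
  obtain ⟨n, hF⟩ := hF
  choose g hg using hF
  choose e he b hb hsum using fun k => CStarModule.exists_bounded_generators (hg k)
  refine ⟨⟨Finset.univ.image fun i : Fin n => lp.ofBounded (fun k => e k i) 1 fun k => he k i, ?_⟩⟩
  rw [Finset.coe_image, Finset.coe_univ, Set.image_univ, eq_top_iff]
  intro v _
  -- The bound is independent of `k`, so the coefficients chosen in the separate components form
  -- elements of `∏ₖ Bₖ`.
  have hbv : ∀ i k, ‖b k (v k) i‖ ≤ 2 * ‖v‖ := fun i k =>
    (hb k (v k) i).trans (by gcongr; exact lp.norm_apply_le_norm (by simp) v k)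
  rw [Submodule.mem_span_range_iff_exists_fun]
  refine ⟨fun i => lp.ofBounded (fun k => b k (v k) i) (2 * ‖v‖) (hbv i), ?_⟩
  ext k
  rw [lp.coeFn_sum, Finset.sum_apply]
  exact (hsum k (v k)).symm

end ProductModule

namespace CStarModule

variable {A G H : Type*} [CStarAlgebra A] [NormedAddCommGroup G] [Module A G]
  [NormedAddCommGroup H] [NormedSpace ℂ H] [Module A H] [CStarModule A H]

end CStarModule

/-! ### Unitary isomorphisms and diagonal operators -/

namespace HilbertModuleIso

section

variable {B : Type*} [CStarAlgebra B] {E F G : Type*}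
  [NormedAddCommGroup E] [NormedSpace ℂ E] [Module B E] [CStarModule B E]
  [NormedAddCommGroup F] [NormedSpace ℂ F] [Module B F] [CStarModule B F]
  [NormedAddCommGroup G] [NormedSpace ℂ G] [Module B G] [CStarModule B G]

/-- The inverse of a unitary isomorphism. -/
def symm (T : HilbertModuleIso B E F) : HilbertModuleIso B F E where
  toLinearIsometryEquiv := T.toLinearIsometryEquiv.symm
  map_smul_alg b v := by
    apply T.toLinearIsometryEquiv.injective
    have h := T.map_smul_alg b (T.toLinearIsometryEquiv.symm v)
    exact (T.toLinearIsometryEquiv.apply_symm_apply _).trans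
      ((congrArg (b • ·) (T.toLinearIsometryEquiv.apply_symm_apply v).symm).trans h.symm)
  map_inner v w := by
    have h := T.map_inner (T.toLinearIsometryEquiv.symm v) (T.toLinearIsometryEquiv.symm w)
    refine h.symm.trans ?_
    exact congrArg₂ (inner B) (T.toLinearIsometryEquiv.apply_symm_apply v)
      (T.toLinearIsometryEquiv.apply_symm_apply w)

/-- The composition of unitary isomorphisms: first `T`, then `S`. -/
def trans (T : HilbertModuleIso B E F) (S : HilbertModuleIso B F G) : HilbertModuleIso B E G where
  toLinearIsometryEquiv := T.toLinearIsometryEquiv.trans S.toLinearIsometryEquiv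
  map_smul_alg b v := (congrArg S.toFun (T.map_smul_alg b v)).trans (S.map_smul_alg b _)
  map_inner v w := (S.map_inner _ _).trans (T.map_inner v w)

@[simp] theorem toCLM_apply (T : HilbertModuleIso B E F) (v : E) : T.toCLM v = T v := rfl

@[simp] theorem symm_apply_apply (T : HilbertModuleIso B E F) (v : E) : T.symm (T v) = v :=
  T.toLinearIsometryEquiv.symm_apply_apply v

@[simp] theorem apply_symm_apply (T : HilbertModuleIso B E F) (v : F) : T (T.symm v) = v :=
  T.toLinearIsometryEquiv.apply_symm_apply v

@[simp] theorem trans_apply (T : HilbertModuleIso B E F) (S : HilbertModuleIso B F G) (v : E) :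
    T.trans S v = S (T v) := rfl

theorem map_alg_smul (T : HilbertModuleIso B E F) (b : B) (v : E) : T (b • v) = b • T v :=
  T.map_smul_alg b v

theorem inner_map (T : HilbertModuleIso B E F) (v w : E) :
    inner B (T v) (T w) = inner B v w := T.map_inner v w

@[simp] theorem norm_map (T : HilbertModuleIso B E F) (v : E) : ‖T v‖ = ‖v‖ :=
  T.toLinearIsometryEquiv.norm_map v

theorem map_add (T : HilbertModuleIso B E F) (v w : E) : T (v + w) = T v + T w :=
  T.toLinearIsometryEquiv.map_add v w

theorem map_sub (T : HilbertModuleIso B E F) (v w : E) : T (v - w) = T v - T w :=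
  T.toLinearIsometryEquiv.map_sub v w

theorem map_complex_smul (T : HilbertModuleIso B E F) (c : ℂ) (v : E) : T (c • v) = c • T v :=
  T.toLinearIsometryEquiv.map_smul c v

theorem map_real_smul (T : HilbertModuleIso B E F) (c : ℝ) (v : E) : T (c • v) = c • T v := by
  rw [← Complex.coe_smul, ← Complex.coe_smul, map_complex_smul]

end

section Product

variable {B : ℕ → Type*} [∀ k, CStarAlgebra (B k)] [∀ k, Nontrivial (B k)]
  {E : ℕ → Type*} [∀ k, NormedAddCommGroup (E k)] [∀ k, NormedSpace ℂ (E k)]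
  [∀ k, Module (B k) (E k)] [∀ k, CStarModule (B k) (E k)]
  {F : ℕ → Type*} [∀ k, NormedAddCommGroup (F k)] [∀ k, NormedSpace ℂ (F k)]
  [∀ k, Module (B k) (F k)] [∀ k, CStarModule (B k) (F k)]

/-- The componentwise action of a sequence of unitary isomorphisms on bounded sequences. -/
noncomputable def diag (T : ∀ k, HilbertModuleIso (B k) (E k) (F k)) :
    HilbertModuleIso (lp B ∞) (lp E ∞) (lp F ∞) where
  toFun v := lp.ofBounded (fun k => T k (v k)) ‖v‖ fun k => by
    rw [norm_map]
    exact lp.norm_apply_le_norm (by simp) v k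
  invFun v := lp.ofBounded (fun k => (T k).symm (v k)) ‖v‖ fun k => by
    rw [norm_map]
    exact lp.norm_apply_le_norm (by simp) v k
  map_add' v w := by ext k; exact (T k).map_add _ _
  map_smul' c v := by ext k; exact (T k).map_complex_smul _ _
  left_inv v := by ext k; exact (T k).symm_apply_apply _
  right_inv v := by ext k; exact (T k).apply_symm_apply _
  norm_map' v := by
    refine le_antisymm (lp.norm_le_of_forall_le (norm_nonneg _) fun k => ?_)
      (lp.norm_le_of_forall_le (norm_nonneg _) fun k => ?_)
    · exact ((T k).norm_map _).le.trans (lp.norm_apply_le_norm (by simp) v k)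
    · rw [← (T k).norm_map (v k)]
      exact lp.norm_apply_le_norm (E := F) (by simp)
        (lp.ofBounded (fun k => T k (v k)) ‖v‖ fun k => by
          rw [norm_map]
          exact lp.norm_apply_le_norm (by simp) v k) k
  map_smul_alg b v := by ext k; exact (T k).map_alg_smul _ _
  map_inner v w := by ext k; exact (T k).inner_map _ _

end Product

end HilbertModuleIso

/-- The norm of a difference of operators on bounded sequences which act componentwise. -/
theorem lp.opNorm_sub_le {E F : ℕ → Type*} [∀ k, NormedAddCommGroup (E k)]
    [∀ k, NormedSpace ℂ (E k)] [∀ k, NormedAddCommGroup (F k)] [∀ k, NormedSpace ℂ (F k)]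
    (S T : lp E ∞ →L[ℂ] lp F ∞) (s t : ∀ k, E k →L[ℂ] F k) (hS : ∀ v k, S v k = s k (v k))
    (hT : ∀ v k, T v k = t k (v k)) {C : ℝ} (hC : 0 ≤ C) (h : ∀ k, ‖s k - t k‖ ≤ C) :
    ‖S - T‖ ≤ C := by
  refine ContinuousLinearMap.opNorm_le_bound _ hC fun v => ?_
  refine lp.norm_le_of_forall_le (by positivity) fun k => ?_
  have : (S - T) v k = (s k - t k) (v k) := by
    change S v k - T v k = _
    rw [hS, hT]
    rfl
  rw [this]
  refine ((s k - t k).le_opNorm _).trans ?_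
  gcongr
  · exact h k
  · exact lp.norm_apply_le_norm (by simp) v k

/-! ### Parametrizations of the manifold -/

section Coordinates

open Set Metric MeasureTheory

variable {d : ℕ} {X : Type*}

local notation "𝔼" => EuclideanSpace ℝ (Fin d)

section

variable [TopologicalSpace X] [ChartedSpace (EuclideanSpace ℝ (Fin d)) X]

theorem mfderiv_param_comp {ψ : 𝔼 → X} (hψ : ContMDiff 𝓘(ℝ, 𝔼) (𝓡 d) ∞ ψ) {G : Type*}
    [NormedAddCommGroup G] [NormedSpace ℝ G] {f : G → 𝔼} {x : G} (hf : DifferentiableAt ℝ f x)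
    (v : G) : mfderiv 𝓘(ℝ, G) (𝓡 d) (fun y => ψ (f y)) x v =
      mfderiv 𝓘(ℝ, 𝔼) (𝓡 d) ψ (f x) (fderiv ℝ f x v) := by
  have h1 : MDifferentiableAt 𝓘(ℝ, 𝔼) (𝓡 d) ψ (f x) := hψ.mdifferentiableAt (by simp)
  have := mfderiv_comp x h1 hf.mdifferentiableAt
  rw [mfderiv_eq_fderiv] at this
  exact congrArg (fun L => L v) this

theorem injective_mfderiv_of_leftInverse {ψ : 𝔼 → X} {χ : X → 𝔼}
    (hψ : ContMDiff 𝓘(ℝ, 𝔼) (𝓡 d) ∞ ψ) (hχψ : ∀ z, χ (ψ z) = z) (ho : IsOpen (range ψ))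
    (hχ : ContMDiffOn (𝓡 d) 𝓘(ℝ, 𝔼) ∞ χ (range ψ)) (z : 𝔼) :
    Function.Injective (mfderiv 𝓘(ℝ, 𝔼) (𝓡 d) ψ z) := by
  have h1 : MDifferentiableAt 𝓘(ℝ, 𝔼) (𝓡 d) ψ z := hψ.mdifferentiableAt (by simp)
  have h2 : MDifferentiableAt (𝓡 d) 𝓘(ℝ, 𝔼) χ (ψ z) :=
    (hχ.contMDiffAt (ho.mem_nhds (mem_range_self z))).mdifferentiableAt (by simp)
  have h3 := mfderiv_comp z h2 h1
  have h4 : χ ∘ ψ = id := funext hχψ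
  rw [h4, mfderiv_id] at h3
  intro v w hvw
  have h5 : ∀ u, u = mfderiv (𝓡 d) 𝓘(ℝ, 𝔼) χ (ψ z) (mfderiv 𝓘(ℝ, 𝔼) (𝓡 d) ψ z u) := fun u =>
    congrArg (fun L => L u) h3
  rw [h5 v, h5 w, hvw]

end

section

variable [TopologicalSpace X] [ChartedSpace (EuclideanSpace ℝ (Fin d)) X] [IsManifold (𝓡 d) ∞ X]

/-- Around every point there is a parametrization by the whole model space. -/
theorem exists_global_parametrization (a : X) : ∃ (ψ : 𝔼 → X) (χ : X → 𝔼),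
    ContMDiff 𝓘(ℝ, 𝔼) (𝓡 d) ∞ ψ ∧ ψ 0 = a ∧ (∀ z, χ (ψ z) = z) ∧ IsOpen (range ψ) ∧
      ContMDiffOn (𝓡 d) 𝓘(ℝ, 𝔼) ∞ χ (range ψ) := by
  set φ := chartAt 𝔼 a
  obtain ⟨R, hR, hball⟩ := Metric.isOpen_iff.mp φ.open_target (φ a) (mem_chart_target _ a)
  -- A diffeomorphism of the model space onto a ball. Parametrizing by the whole space lets curves
  -- and disks be defined on all of `ℝ` and `ℝ × ℝ`, as `PSPath.ofSmooth` and `SmoothDisk` require.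
  set e := OpenPartialHomeomorph.univBall (φ a) R with he
  have hmem : ∀ z, e z ∈ ball (φ a) R := fun z => by
    have := e.map_source (x := z) (by rw [he, OpenPartialHomeomorph.univBall_source]; trivial)
    rwa [he, OpenPartialHomeomorph.univBall_target _ hR] at this
  have hinv : ∀ z, e.symm (e z) = z := fun z =>
    e.left_inv (by rw [he, OpenPartialHomeomorph.univBall_source]; trivial)
  have hrange : range (fun z => φ.symm (e z)) = φ.source ∩ φ ⁻¹' ball (φ a) R := by
    ext x
    constructor
    · rintro ⟨z, rfl⟩
      refine ⟨φ.map_target (hball (hmem z)), ?_⟩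
      simp only [mem_preimage]
      rw [φ.right_inv (hball (hmem z))]
      exact hmem z
    · rintro ⟨hx, hx'⟩
      refine ⟨e.symm (φ x), ?_⟩
      have : e (e.symm (φ x)) = φ x :=
        e.right_inv (by rw [he, OpenPartialHomeomorph.univBall_target _ hR]; exact hx')
      simp only [this]
      exact φ.left_inv hx
  refine ⟨fun z => φ.symm (e z), fun x => e.symm (φ x), ?_, ?_, fun z => ?_, ?_, ?_⟩
  · have h1 : ContMDiff 𝓘(ℝ, 𝔼) 𝓘(ℝ, 𝔼) ∞ e :=
      (OpenPartialHomeomorph.contDiff_univBall (c := φ a) (r := R)).contMDiff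
    exact (contMDiffOn_chart_symm (x := a) :
      ContMDiffOn 𝓘(ℝ, 𝔼) (𝓡 d) ∞ φ.symm φ.target).comp_contMDiff h1 fun z => hball (hmem z)
  · simp only [he, OpenPartialHomeomorph.univBall_apply_zero]
    exact φ.left_inv (mem_chart_source _ a)
  · simp only [φ.right_inv (hball (hmem z)), hinv]
  · rw [hrange]
    exact φ.isOpen_inter_preimage isOpen_ball
  · rw [hrange]
    have h1 : ContMDiffOn 𝓘(ℝ, 𝔼) 𝓘(ℝ, 𝔼) ∞ e.symm (ball (φ a) R) :=
      (OpenPartialHomeomorph.contDiffOn_univBall_symm (c := φ a) (r := R)).contMDiffOn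
    have h2 : ContMDiffOn (𝓡 d) 𝓘(ℝ, 𝔼) ∞ φ φ.source := contMDiffOn_chart
    exact h1.comp (h2.mono inter_subset_left) fun x hx => hx.2

end

section

variable [TopologicalSpace X] [ChartedSpace (EuclideanSpace ℝ (Fin d)) X] [IsManifold (𝓡 d) ∞ X]
  [RiemannianBundle (fun x : X => TangentSpace (𝓡 d) x)]

/-- Around every point there are global parametrizations that are isometric at the origin. -/
theorem exists_isometric_parametrization (a : X) : ∃ (ψ : 𝔼 → X) (χ : X → 𝔼),
    ContMDiff 𝓘(ℝ, 𝔼) (𝓡 d) ∞ ψ ∧ ψ 0 = a ∧ (∀ z, χ (ψ z) = z) ∧ IsOpen (range ψ) ∧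
      ContMDiffOn (𝓡 d) 𝓘(ℝ, 𝔼) ∞ χ (range ψ) ∧
      ∀ v : 𝔼, ‖mfderiv 𝓘(ℝ, 𝔼) (𝓡 d) ψ 0 v‖ = ‖v‖ := by
  obtain ⟨ψ, χ, hψ, h0, hχψ, ho, hχ⟩ := exists_global_parametrization (d := d) a
  set L := mfderiv 𝓘(ℝ, 𝔼) (𝓡 d) ψ 0 with hL
  have hfd : FiniteDimensional ℝ (TangentSpace (𝓡 d) (ψ 0)) :=
    inferInstanceAs (FiniteDimensional ℝ 𝔼)
  have hfr : Module.finrank ℝ (TangentSpace (𝓡 d) (ψ 0)) = Module.finrank ℝ 𝔼 := rfl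
  have hdim : Module.finrank ℝ (TangentSpace (𝓡 d) (ψ 0)) = d := by rw [hfr]; simp
  let iso : TangentSpace (𝓡 d) (ψ 0) ≃ₗᵢ[ℝ] 𝔼 :=
    ((stdOrthonormalBasis ℝ (TangentSpace (𝓡 d) (ψ 0))).reindex (finCongr hdim)).repr
  let Ll : 𝔼 →ₗ[ℝ] TangentSpace (𝓡 d) (ψ 0) :=
    { toFun := fun v => L v, map_add' := fun v w => L.map_add v w,
      map_smul' := fun c v => L.map_smul c v }
  have hinj : Function.Injective Ll :=
    injective_mfderiv_of_leftInverse hψ hχψ ho hχ 0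
  let Le : 𝔼 ≃ₗ[ℝ] TangentSpace (𝓡 d) (ψ 0) :=
    LinearEquiv.ofInjectiveOfFinrankEq Ll hinj hfr.symm
  -- The linear change of coordinates after which the differential at the origin is the isometry
  -- `iso.symm`.
  let A : 𝔼 ≃L[ℝ] 𝔼 := (iso.symm.toLinearEquiv.trans Le.symm).toContinuousLinearEquiv
  have hA : ∀ v, L (A v) = iso.symm v := fun v => Le.apply_symm_apply (iso.symm v)
  have hrange : range (fun z => ψ (A z)) = range ψ := A.surjective.range_comp ψ
  refine ⟨fun z => ψ (A z), fun x => A.symm (χ x), hψ.comp A.contDiff.contMDiff, by simpa using h0,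
    fun z => by simp [hχψ], hrange ▸ ho,
    hrange ▸ A.symm.contDiff.contMDiff.comp_contMDiffOn hχ, fun v => ?_⟩
  rw [mfderiv_param_comp hψ A.differentiableAt, A.fderiv]
  -- The norm is that of the tangent space at `ψ z`, which depends on `z`; generalizing the point
  -- permits the substitution `A 0 = 0`.
  have h1 : ∀ z : 𝔼, z = 0 → ∀ u : 𝔼, ‖mfderiv 𝓘(ℝ, 𝔼) (𝓡 d) ψ z u‖ = ‖L u‖ := by
    rintro z rfl u; rfl
  rw [h1 (A 0) (map_zero A)]
  change ‖L (A v)‖ = _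
  rw [hA, iso.symm.norm_map]

variable [IsContMDiffRiemannianBundle (𝓡 d) ∞ (EuclideanSpace ℝ (Fin d))
      (fun x : X => TangentSpace (𝓡 d) x)]

/-- The tangent map is continuous into the tangent bundle, on which the Riemannian metric is
continuous. -/
theorem continuous_norm_mfderiv {ψ : 𝔼 → X} (hψ : ContMDiff 𝓘(ℝ, 𝔼) (𝓡 d) ∞ ψ) :
    Continuous fun p : 𝔼 × 𝔼 => ‖mfderiv 𝓘(ℝ, 𝔼) (𝓡 d) ψ p.1 p.2‖ := by
  have h1 : Continuous (tangentMap 𝓘(ℝ, 𝔼) (𝓡 d) ψ) := hψ.continuous_tangentMap (by simp)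
  have h2 : Continuous fun p : 𝔼 × 𝔼 => tangentMap 𝓘(ℝ, 𝔼) (𝓡 d) ψ
      ((tangentBundleModelSpaceHomeomorph 𝓘(ℝ, 𝔼)).symm p) :=
    h1.comp (tangentBundleModelSpaceHomeomorph 𝓘(ℝ, 𝔼)).symm.continuous
  have : IsContinuousRiemannianBundle 𝔼 (fun x : X => TangentSpace (𝓡 d) x) := by
    obtain ⟨g, hg, h⟩ := IsContMDiffRiemannianBundle.exists_contMDiff (IB := 𝓡 d) (n := ∞) (F := 𝔼)
      (E := fun x : X => TangentSpace (𝓡 d) x)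
    exact ⟨⟨g, hg.continuous, h⟩⟩
  have h3 := Continuous.inner_bundle (F := 𝔼) (E := fun x : X => TangentSpace (𝓡 d) x)
    (b := fun p : 𝔼 × 𝔼 => ψ p.1) (v := fun p => mfderiv 𝓘(ℝ, 𝔼) (𝓡 d) ψ p.1 p.2)
    (w := fun p => mfderiv 𝓘(ℝ, 𝔼) (𝓡 d) ψ p.1 p.2) h2 h2
  simp only [norm_eq_sqrt_real_inner]
  exact h3.sqrt

end

end Coordinates

/-! ### Almost isometric charts -/

section NormalChart

open Set Metric MeasureTheory Filter Manifold

/-- Normal coordinates around the point `a` of a Riemannian manifold: a smooth map `ψ : ℝᵈ → X`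
with `ψ 0 = a` and with smooth inverse `χ` on its open image, such that the differential of `ψ`
on the ball of radius `r` and the maps `ψ` and `χ` on the balls of radius `r` and `ρ` distort norms
and distances by a factor of at most two. -/
structure NormalChart (d : ℕ) {X : Type*} [MetricSpace X]
    [ChartedSpace (EuclideanSpace ℝ (Fin d)) X]
    [RiemannianBundle (fun x : X => TangentSpace (𝓡 d) x)] (a : X) where
  ψ : EuclideanSpace ℝ (Fin d) → X
  χ : X → EuclideanSpace ℝ (Fin d)
  r : ℝ
  ρ : ℝ
  smooth_ψ : ContMDiff 𝓘(ℝ, EuclideanSpace ℝ (Fin d)) (𝓡 d) ∞ ψ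
  ψ_zero : ψ 0 = a
  χ_ψ : ∀ z, χ (ψ z) = z
  isOpen_range : IsOpen (range ψ)
  smooth_χ : ContMDiffOn (𝓡 d) 𝓘(ℝ, EuclideanSpace ℝ (Fin d)) ∞ χ (range ψ)
  r_pos : 0 < r
  r_le_one : r ≤ 1
  ρ_pos : 0 < ρ
  norm_mfderiv_le : ∀ z ∈ ball (0 : EuclideanSpace ℝ (Fin d)) r, ∀ v : EuclideanSpace ℝ (Fin d),
    ‖mfderiv 𝓘(ℝ, EuclideanSpace ℝ (Fin d)) (𝓡 d) ψ z v‖ ≤ 2 * ‖v‖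
  le_norm_mfderiv : ∀ z ∈ ball (0 : EuclideanSpace ℝ (Fin d)) r, ∀ v : EuclideanSpace ℝ (Fin d),
    ‖v‖ ≤ 2 * ‖mfderiv 𝓘(ℝ, EuclideanSpace ℝ (Fin d)) (𝓡 d) ψ z v‖
  dist_ψ_le : ∀ z ∈ ball (0 : EuclideanSpace ℝ (Fin d)) r,
    ∀ w ∈ ball (0 : EuclideanSpace ℝ (Fin d)) r, dist (ψ z) (ψ w) ≤ 2 * dist z w
  ball_subset : ball a ρ ⊆ ψ '' ball 0 r
  dist_χ_le : ∀ x ∈ ball a ρ, ∀ y ∈ ball a ρ, dist (χ x) (χ y) ≤ 2 * dist x y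

namespace NormalChart

variable {d : ℕ} {X : Type*} [MetricSpace X] [ChartedSpace (EuclideanSpace ℝ (Fin d)) X]
  [RiemannianBundle (fun x : X => TangentSpace (𝓡 d) x)]

theorem ofReal_le_two_mul_ofReal_iff {a b : ℝ} (hb : 0 ≤ b) :
    ENNReal.ofReal a ≤ 2 * ENNReal.ofReal b ↔ a ≤ 2 * b := by
  have : (2 : ℝ≥0∞) = ENNReal.ofReal 2 := by simp
  rw [this, ← ENNReal.ofReal_mul (by norm_num), ENNReal.ofReal_le_ofReal_iff (by positivity)]

theorem ofReal_norm_tangent {x : X} (v : TangentSpace (𝓡 d) x) :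
    ‖v‖ₑ = ENNReal.ofReal ‖v‖ := (ofReal_norm v).symm

section Distance

variable [IsRiemannianManifold (𝓡 d) X]

/-- The image of the straight segment from `z` to `w` has length at most `2 * dist z w`. -/
theorem dist_param_le {ψ : EuclideanSpace ℝ (Fin d) → X}
    (hψ : ContMDiff 𝓘(ℝ, EuclideanSpace ℝ (Fin d)) (𝓡 d) ∞ ψ) {r : ℝ}
    (h : ∀ z ∈ ball (0 : EuclideanSpace ℝ (Fin d)) r, ∀ v : EuclideanSpace ℝ (Fin d),
      ‖mfderiv 𝓘(ℝ, EuclideanSpace ℝ (Fin d)) (𝓡 d) ψ z v‖ ≤ 2 * ‖v‖)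
    {z w : EuclideanSpace ℝ (Fin d)} (hz : z ∈ ball 0 r) (hw : w ∈ ball 0 r) :
    dist (ψ z) (ψ w) ≤ 2 * dist z w := by
  have hl : ContDiff ℝ ∞ fun t : ℝ => z + t • (w - z) := by fun_prop
  have h1 : riemannianEDist (𝓡 d) (ψ z) (ψ w) ≤
      pathELength (𝓡 d) (fun t : ℝ => ψ (z + t • (w - z))) 0 1 := riemannianEDist_le_pathELength
    ((hψ.comp hl.contMDiff).contMDiffOn.of_le (by simp)) (by simp) (by simp) zero_le_one
  rw [← IsRiemannianManifold.out, pathELength_eq_lintegral_mfderiv_Icc] at h1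
  have h2 : ∫⁻ t in Icc (0 : ℝ) 1,
      ‖mfderiv 𝓘(ℝ, ℝ) (𝓡 d) (fun t : ℝ => ψ (z + t • (w - z))) t (1 : ℝ)‖ₑ ≤
      ∫⁻ _ in Icc (0 : ℝ) 1, ENNReal.ofReal (2 * dist z w) := by
    refine setLIntegral_mono' measurableSet_Icc fun t ht => ?_
    rw [ofReal_norm_tangent]
    refine ENNReal.ofReal_le_ofReal ?_
    rw [mfderiv_param_comp hψ (hl.differentiable (by simp) t)]
    have hmem : z + t • (w - z) ∈ ball (0 : EuclideanSpace ℝ (Fin d)) r :=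
      (convex_ball _ _).add_smul_sub_mem hz hw ht
    have hder : fderiv ℝ (fun t : ℝ => z + t • (w - z)) t (1 : ℝ) = w - z := by
      have h3 : HasDerivAt (fun t : ℝ => z + t • (w - z)) (w - z) t := by
        simpa using ((hasDerivAt_id t).smul_const (w - z)).const_add z
      rw [fderiv_apply_one_eq_deriv, h3.deriv]
    rw [hder, dist_comm z w, dist_eq_norm]
    exact h _ hmem _
  have h3 := h1.trans h2
  simp only [lintegral_const, MeasurableSet.univ, Measure.restrict_apply, univ_inter,
    Real.volume_Icc, sub_zero, ENNReal.ofReal_one, mul_one] at h3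
  rw [edist_dist] at h3
  exact (ENNReal.ofReal_le_ofReal_iff (by positivity)).mp h3

/-- A curve from `x` to `y` of length less than `dist x y + δ`, with `δ < ρ`, stays within `4 * ρ`
of `a`, hence in the image of the ball of radius `r`. There `χ` stretches lengths by at most two;
now let `δ` tend to zero. -/
theorem dist_inverse_le {ψ : EuclideanSpace ℝ (Fin d) → X} {χ : X → EuclideanSpace ℝ (Fin d)}
    (hψ : ContMDiff 𝓘(ℝ, EuclideanSpace ℝ (Fin d)) (𝓡 d) ∞ ψ) (hχψ : ∀ z, χ (ψ z) = z)
    (ho : IsOpen (range ψ))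
    (hχ : ContMDiffOn (𝓡 d) 𝓘(ℝ, EuclideanSpace ℝ (Fin d)) ∞ χ (range ψ)) {r : ℝ}
    (h : ∀ z ∈ ball (0 : EuclideanSpace ℝ (Fin d)) r, ∀ v : EuclideanSpace ℝ (Fin d),
      ‖v‖ ≤ 2 * ‖mfderiv 𝓘(ℝ, EuclideanSpace ℝ (Fin d)) (𝓡 d) ψ z v‖) {a : X} {ρ : ℝ}
    (hρ : 0 < ρ) (hball : ball a (4 * ρ) ⊆ ψ '' ball 0 r) {x y : X} (hx : x ∈ ball a ρ)
    (hy : y ∈ ball a ρ) : dist (χ x) (χ y) ≤ 2 * dist x y := by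
  suffices H : ∀ δ : ℝ, 0 < δ → δ < ρ → dist (χ x) (χ y) ≤ 2 * (dist x y + δ) by
    refine le_of_forall_pos_le_add fun η hη => ?_
    have := H (min (η / 2) (ρ / 2)) (by positivity)
      ((min_le_right _ _).trans_lt (by linarith))
    have h2 := min_le_left (η / 2) (ρ / 2)
    linarith
  intro δ hδ hδρ
  have hlt : riemannianEDist (𝓡 d) x y < ENNReal.ofReal (dist x y + δ) := by
    rw [← IsRiemannianManifold.out, edist_dist]
    exact (ENNReal.ofReal_lt_ofReal_iff (by positivity)).mpr (by linarith)
  obtain ⟨γ, hγ0, hγ1, hγ, hlen, -, -⟩ :=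
    exists_lt_locally_constant_of_riemannianEDist_lt hlt zero_lt_one
  have hxy : dist x y < 2 * ρ := by
    have := dist_triangle_right x y a
    rw [mem_ball] at hx hy
    linarith
  have hmem : ∀ t ∈ Icc (0 : ℝ) 1, γ t ∈ ψ '' ball 0 r := fun t ht => by
    refine hball ?_
    have h1 : riemannianEDist (𝓡 d) x (γ t) ≤ pathELength (𝓡 d) γ 0 t :=
      riemannianEDist_le_pathELength hγ.contMDiffOn hγ0 rfl ht.1
    have h2 : edist x (γ t) < ENNReal.ofReal (dist x y + δ) := by
      rw [show edist x (γ t) = riemannianEDist (𝓡 d) x (γ t) from IsRiemannianManifold.out _ _]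
      exact h1.trans_lt ((pathELength_mono le_rfl ht.2).trans_lt hlen)
    rw [edist_dist, ENNReal.ofReal_lt_ofReal_iff (by positivity)] at h2
    rw [mem_ball] at hx ⊢
    have := dist_triangle_left (γ t) a x
    linarith
  have hrange : ∀ t ∈ Icc (0 : ℝ) 1, γ t ∈ range ψ := fun t ht =>
    image_subset_range _ _ (hmem t ht)
  have hψχ : ∀ x ∈ range ψ, ψ (χ x) = x := by
    rintro _ ⟨z, rfl⟩
    rw [hχψ]
  have hη : ∀ t ∈ Icc (0 : ℝ) 1, ContDiffAt ℝ 1 (fun s => χ (γ s)) t := fun t ht => by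
    have h1 : ContMDiffAt (𝓡 d) 𝓘(ℝ, EuclideanSpace ℝ (Fin d)) 1 χ (γ t) :=
      (hχ.contMDiffAt (ho.mem_nhds (hrange t ht))).of_le (by simp)
    exact (ContMDiffAt.comp t h1 hγ.contMDiffAt).contDiffAt
  have key := enorm_sub_le_lintegral_deriv_of_contDiffOn_Icc
    (f := fun s => χ (γ s)) (a := 0) (b := 1) (fun t ht => (hη t ht).contDiffWithinAt) zero_le_one
  have h2 : ∫⁻ t in Icc (0 : ℝ) 1, ‖deriv (fun s => χ (γ s)) t‖ₑ ≤
      ∫⁻ t in Icc (0 : ℝ) 1, 2 * ‖mfderiv 𝓘(ℝ, ℝ) (𝓡 d) γ t (1 : ℝ)‖ₑ := by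
    refine setLIntegral_mono' measurableSet_Icc fun t ht => ?_
    have hev : γ =ᶠ[𝓝 t] fun s => ψ (χ (γ s)) :=
      Filter.mem_of_superset
        (hγ.continuous.continuousAt.preimage_mem_nhds (ho.mem_nhds (hrange t ht)))
        fun s hs => (hψχ _ hs).symm
    have hd : DifferentiableAt ℝ (fun s => χ (γ s)) t := (hη t ht).differentiableAt (by simp)
    have h3 : ‖deriv (fun s => χ (γ s)) t‖ ≤ 2 * ‖mfderiv 𝓘(ℝ, ℝ) (𝓡 d) γ t (1 : ℝ)‖ := by
      have hz : χ (γ t) ∈ ball (0 : EuclideanSpace ℝ (Fin d)) r := by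
        obtain ⟨z, hz, hz'⟩ := hmem t ht
        rw [← hz', hχψ]
        exact hz
      refine (h _ hz _).trans_eq ?_
      have h4 := mfderiv_param_comp hψ hd 1
      rw [fderiv_apply_one_eq_deriv] at h4
      rw [← h4]
      have h5 : ∀ g : ℝ → X, γ =ᶠ[𝓝 t] g → ‖mfderiv 𝓘(ℝ, ℝ) (𝓡 d) g t (1 : ℝ)‖ =
          ‖mfderiv 𝓘(ℝ, ℝ) (𝓡 d) γ t (1 : ℝ)‖ := by
        intro g hg
        have h6 : γ t = g t := hg.eq_of_nhds
        have h7 := (hg.mfderiv_eq : mfderiv 𝓘(ℝ, ℝ) (𝓡 d) γ t = mfderiv 𝓘(ℝ, ℝ) (𝓡 d) g t)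
        have h8 : ∀ (p q : X) (hpq : p = q) (v : TangentSpace (𝓡 d) p)
            (w : TangentSpace (𝓡 d) q),
            (v : EuclideanSpace ℝ (Fin d)) = (w : EuclideanSpace ℝ (Fin d)) → ‖w‖ = ‖v‖ := by
          rintro p _ rfl v w hvw
          exact congrArg (fun u : TangentSpace (𝓡 d) p => ‖u‖) hvw.symm
        refine h8 _ _ h6 _ _ ?_
        exact congrArg (fun L : ℝ →L[ℝ] EuclideanSpace ℝ (Fin d) => L 1) h7
      rw [h5 _ hev]
    rw [ofReal_norm_tangent, ← ofReal_norm]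
    exact (ofReal_le_two_mul_ofReal_iff (norm_nonneg _)).mpr h3
  rw [lintegral_const_mul' _ _ (by simp)] at h2
  have hpath : ∫⁻ t in Icc (0 : ℝ) 1, ‖mfderiv 𝓘(ℝ, ℝ) (𝓡 d) γ t (1 : ℝ)‖ₑ =
      pathELength (𝓡 d) γ 0 1 := pathELength_eq_lintegral_mfderiv_Icc.symm
  have h3 : ‖χ (γ 1) - χ (γ 0)‖ₑ ≤ 2 * ENNReal.ofReal (dist x y + δ) :=
    key.trans (h2.trans (mul_le_mul_right (hpath.trans_le hlen.le) 2))
  rw [hγ0, hγ1, ← ofReal_norm, ofReal_le_two_mul_ofReal_iff (by positivity)] at h3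
  rw [dist_comm, dist_eq_norm]
  exact h3

end Distance

section Existence

variable [IsManifold (𝓡 d) ∞ X]
  [IsContMDiffRiemannianBundle (𝓡 d) ∞ (EuclideanSpace ℝ (Fin d))
    (fun x : X => TangentSpace (𝓡 d) x)]

/-- At the origin the differential preserves norms. By joint continuity and compactness of the unit
sphere the norms of images of unit vectors stay between `1/2` and `2` nearby; homogeneity does the
rest. -/
theorem exists_radius_of_isometric {ψ : EuclideanSpace ℝ (Fin d) → X}
    (hψ : ContMDiff 𝓘(ℝ, EuclideanSpace ℝ (Fin d)) (𝓡 d) ∞ ψ)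
    (h0 : ∀ v : EuclideanSpace ℝ (Fin d),
      ‖mfderiv 𝓘(ℝ, EuclideanSpace ℝ (Fin d)) (𝓡 d) ψ 0 v‖ = ‖v‖) :
    ∃ r : ℝ, 0 < r ∧ r ≤ 1 ∧ ∀ z ∈ ball (0 : EuclideanSpace ℝ (Fin d)) r,
      ∀ v : EuclideanSpace ℝ (Fin d),
        ‖mfderiv 𝓘(ℝ, EuclideanSpace ℝ (Fin d)) (𝓡 d) ψ z v‖ ≤ 2 * ‖v‖ ∧
        ‖v‖ ≤ 2 * ‖mfderiv 𝓘(ℝ, EuclideanSpace ℝ (Fin d)) (𝓡 d) ψ z v‖ := by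
  have hc := continuous_norm_mfderiv hψ
  have h1 : ∀ᶠ z in 𝓝 (0 : EuclideanSpace ℝ (Fin d)),
      ∀ v ∈ sphere (0 : EuclideanSpace ℝ (Fin d)) 1,
        ‖mfderiv 𝓘(ℝ, EuclideanSpace ℝ (Fin d)) (𝓡 d) ψ z v‖ < 2 ∧
        1 / 2 < ‖mfderiv 𝓘(ℝ, EuclideanSpace ℝ (Fin d)) (𝓡 d) ψ z v‖ := by
    refine (isCompact_sphere _ _).eventually_forall_of_forall_eventually fun v hv => ?_
    have hv1 : ‖mfderiv 𝓘(ℝ, EuclideanSpace ℝ (Fin d)) (𝓡 d) ψ 0 v‖ = 1 := by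
      rw [h0]; simpa using hv
    exact (hc.tendsto (0, v)).eventually
      (Ioo_mem_nhds (by simp only [hv1]; norm_num) (by simp only [hv1]; norm_num) :
        Ioo (1 / 2 : ℝ) 2 ∈ _) |>.mono fun p hp => ⟨hp.2, hp.1⟩
  obtain ⟨r, hr, hball⟩ := Metric.eventually_nhds_iff_ball.mp h1
  refine ⟨min r 1, by positivity, min_le_right _ _, fun z hz v => ?_⟩
  rcases eq_or_ne v 0 with rfl | hv
  · have : mfderiv 𝓘(ℝ, EuclideanSpace ℝ (Fin d)) (𝓡 d) ψ z (0 : EuclideanSpace ℝ (Fin d)) = 0 :=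
      map_zero _
    rw [this]
    simp
  · have hvpos : 0 < ‖v‖ := norm_pos_iff.mpr hv
    obtain ⟨h2, h3⟩ := hball z (ball_subset_ball (min_le_left _ _) hz) (‖v‖⁻¹ • v)
      (by simp [norm_smul, hvpos.ne'])
    have h4 : mfderiv 𝓘(ℝ, EuclideanSpace ℝ (Fin d)) (𝓡 d) ψ z (‖v‖⁻¹ • v) =
        ‖v‖⁻¹ • mfderiv 𝓘(ℝ, EuclideanSpace ℝ (Fin d)) (𝓡 d) ψ z v := map_smul _ _ _
    rw [h4, norm_smul, norm_inv, norm_norm, inv_mul_eq_div] at h2 h3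
    rw [div_lt_iff₀ hvpos] at h2
    rw [lt_div_iff₀ hvpos] at h3
    constructor <;> linarith

variable [IsRiemannianManifold (𝓡 d) X]

variable (d) in
theorem exists_normalChart (a : X) : Nonempty (NormalChart d a) := by
  obtain ⟨ψ, χ, hψ, h0, hχψ, ho, hχ, hiso⟩ := exists_isometric_parametrization (d := d) a
  obtain ⟨r, hr, hr1, hbound⟩ := exists_radius_of_isometric hψ hiso
  have himg : ψ '' ball 0 r = range ψ ∩ χ ⁻¹' ball 0 r := by
    ext x
    constructor
    · rintro ⟨z, hz, rfl⟩
      exact ⟨mem_range_self z, by simpa [hχψ] using hz⟩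
    · rintro ⟨⟨z, rfl⟩, hz⟩
      exact ⟨z, by simpa [hχψ] using hz, rfl⟩
  have hopen : IsOpen (ψ '' ball 0 r) := by
    rw [himg]
    exact hχ.continuousOn.isOpen_inter_preimage ho isOpen_ball
  obtain ⟨ρ, hρ, hball⟩ := Metric.isOpen_iff.mp hopen a ⟨0, mem_ball_self hr, h0⟩
  -- The radius of the chart is a quarter of `ρ`, to leave the room that `dist_inverse_le` needs for
  -- nearly minimizing curves.
  have hball4 : ball a (4 * (ρ / 4)) ⊆ ψ '' ball 0 r := by
    rwa [mul_div_cancel₀ _ (by norm_num)]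
  exact ⟨⟨ψ, χ, r, ρ / 4, hψ, h0, hχψ, ho, hχ, hr, hr1, by positivity,
    fun z hz v => (hbound z hz v).1, fun z hz v => (hbound z hz v).2,
    fun z hz w hw => dist_param_le hψ (fun z hz v => (hbound z hz v).1) hz hw,
    (ball_subset_ball (by linarith)).trans hball,
    fun x hx y hy => dist_inverse_le hψ hχψ ho hχ (fun z hz v => (hbound z hz v).2)
      (by positivity) hball4 hx hy⟩⟩

end Existence

end NormalChart

end NormalChart

/-! ### Areas of disks -/

section Disks

variable {d : ℕ} {X : Type*} [TopologicalSpace X] [ChartedSpace (EuclideanSpace ℝ (Fin d)) X]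

theorem PSPath.ext {x y : X} {p q : PSPath d x y} (h : ∀ t, p t = q t) : p = q :=
  Subtype.ext (Path.ext (funext h))

theorem PSPath.source {x y : X} (p : PSPath d x y) : p 0 = x := p.1.source

theorem PSPath.target {x y : X} (p : PSPath d x y) : p 1 = y := p.1.target

namespace SmoothDisk

variable [RiemannianBundle (fun x : X => TangentSpace (𝓡 d) x)]

/-- The integrand is the root of a Gram determinant, which vanishes on parallel vectors. -/
theorem area_eq_zero (D : SmoothDisk d X)
    (h : ∀ z : ℝ × ℝ, ∃ (u : TangentSpace (𝓡 d) (D.toFun z)) (α β : ℝ),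
      mfderiv 𝓘(ℝ, ℝ × ℝ) (𝓡 d) D.toFun z ((1, 0) : ℝ × ℝ) = α • u ∧
      mfderiv 𝓘(ℝ, ℝ × ℝ) (𝓡 d) D.toFun z ((0, 1) : ℝ × ℝ) = β • u) : D.area = 0 := by
  refine MeasureTheory.integral_eq_zero_of_ae (Filter.Eventually.of_forall fun z => ?_)
  obtain ⟨u, α, β, hα, hβ⟩ := h z
  simp only [hα, hβ, Pi.zero_apply]
  rw [Real.sqrt_eq_zero', norm_smul, norm_smul, real_inner_smul_left, real_inner_smul_right,
    real_inner_self_eq_norm_sq, mul_pow, mul_pow, Real.norm_eq_abs, Real.norm_eq_abs, sq_abs,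
    sq_abs]
  exact le_of_eq (by ring)

theorem area_nonneg (D : SmoothDisk d X) : 0 ≤ D.area :=
  MeasureTheory.integral_nonneg fun _ => Real.sqrt_nonneg _

theorem area_le (D : SmoothDisk d X) {A C : ℝ} (hA : 0 ≤ A)
    (h : ∀ z ∈ Set.Icc (0 : ℝ) 1 ×ˢ Set.Icc (0 : ℝ) 1,
      ‖(mfderiv 𝓘(ℝ, ℝ × ℝ) (𝓡 d) D.toFun z ((1, 0) : ℝ × ℝ) :
        TangentSpace (𝓡 d) (D.toFun z))‖ ≤ A ∧
      ‖(mfderiv 𝓘(ℝ, ℝ × ℝ) (𝓡 d) D.toFun z ((0, 1) : ℝ × ℝ) :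
        TangentSpace (𝓡 d) (D.toFun z))‖ ≤ C) : D.area ≤ A * C := by
  have h1 := MeasureTheory.norm_setIntegral_le_of_norm_le_const
    (μ := MeasureTheory.volume) (s := Set.Icc (0 : ℝ) 1 ×ˢ Set.Icc (0 : ℝ) 1)
    (f := fun z => √(‖(mfderiv 𝓘(ℝ, ℝ × ℝ) (𝓡 d) D.toFun z ((1, 0) : ℝ × ℝ) :
        TangentSpace (𝓡 d) (D.toFun z))‖ ^ 2 *
      ‖(mfderiv 𝓘(ℝ, ℝ × ℝ) (𝓡 d) D.toFun z ((0, 1) : ℝ × ℝ) :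
        TangentSpace (𝓡 d) (D.toFun z))‖ ^ 2 -
      (inner ℝ (mfderiv 𝓘(ℝ, ℝ × ℝ) (𝓡 d) D.toFun z ((1, 0) : ℝ × ℝ) :
        TangentSpace (𝓡 d) (D.toFun z))
        (mfderiv 𝓘(ℝ, ℝ × ℝ) (𝓡 d) D.toFun z ((0, 1) : ℝ × ℝ) :
        TangentSpace (𝓡 d) (D.toFun z))) ^ 2)) (C := A * C)
    (by rw [MeasureTheory.Measure.volume_eq_prod, MeasureTheory.Measure.prod_prod]; simp)
    fun z hz => by
      obtain ⟨h1, h2⟩ := h z hz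
      have hC : 0 ≤ C := (norm_nonneg _).trans h2
      rw [Real.norm_of_nonneg (Real.sqrt_nonneg _)]
      refine Real.sqrt_le_iff.mpr ⟨by positivity, ?_⟩
      rw [mul_pow]
      refine (sub_le_self _ (sq_nonneg _)).trans ?_
      gcongr
  have h2 : (MeasureTheory.volume : MeasureTheory.Measure (ℝ × ℝ)).real
      (Set.Icc (0 : ℝ) 1 ×ˢ Set.Icc (0 : ℝ) 1) = 1 := by
    rw [MeasureTheory.Measure.volume_eq_prod, MeasureTheory.measureReal_prod_prod]; simp
  rw [h2, mul_one] at h1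
  exact (le_abs_self _).trans h1

end SmoothDisk

end Disks

/-! ### Transport around disks -/

namespace HilbertGBundle.ParallelTransport

variable {d : ℕ} {X : Type*} [TopologicalSpace X] [ChartedSpace (EuclideanSpace ℝ (Fin d)) X]
  {Γ : Type*} [Group Γ] [MulAction Γ X]
  {B : Type*} [CStarAlgebra B] {F : Type*} [NormedAddCommGroup F] [NormedSpace ℂ F] [Module B F]
  [CStarModule B F] {E : HilbertGBundle Γ X B F} {Φ : E.ParallelTransport d}

theorem map_const {x : X} (p : PSPath d x x) (h : ∀ t, p t = x) (v : E.fiber x) :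
    Φ.map p v = v := by
  have : p = PSPath.refl x := PSPath.ext h
  rw [this, Φ.map_refl]

variable [RiemannianBundle (fun x : X => TangentSpace (𝓡 d) x)] {ε : ℝ}

/-- Closeness to the identity, for the four sides of a disk as separate paths. -/
theorem IsCloseToId.norm_square_le (hΦ : Φ.IsCloseToId ε) (D : SmoothDisk d X)
    {x₀₀ x₁₀ x₁₁ x₀₁ : X} (b : PSPath d x₀₀ x₁₀) (r : PSPath d x₁₀ x₁₁) (u : PSPath d x₁₁ x₀₁)
    (l : PSPath d x₀₁ x₀₀) (hb : ∀ t, b t = D.toFun (t, 0)) (hr : ∀ t, r t = D.toFun (1, t))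
    (hu : ∀ t, u t = D.toFun (1 - t, 1)) (hl : ∀ t, l t = D.toFun (0, 1 - t))
    (v : E.fiber x₀₀) :
    ‖Φ.map l (Φ.map u (Φ.map r (Φ.map b v))) - v‖ ≤ ε * D.area * ‖v‖ := by
  have h₀₀ : x₀₀ = D.toFun (0, 0) := by simpa [b.source] using hb 0
  have h₁₀ : x₁₀ = D.toFun (1, 0) := by simpa [r.source] using hr 0
  have h₁₁ : x₁₁ = D.toFun (1, 1) := by simpa [u.source] using hu 0
  have h₀₁ : x₀₁ = D.toFun (0, 1) := by simpa [l.source] using hl 0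
  subst h₀₀ h₁₀ h₁₁ h₀₁
  have := hΦ D
  have hD : D.boundary = ((b.trans r).trans u).trans l := by
    unfold SmoothDisk.boundary
    congr 2
    · congr 1
      · exact PSPath.ext fun t => (hb t).symm
      · exact PSPath.ext fun t => (hr t).symm
    · exact PSPath.ext fun t => (hu t).symm
    · exact PSPath.ext fun t => (hl t).symm
  rw [hD] at this
  have h2 := ContinuousLinearMap.le_of_opNorm_le _ this v
  simpa [Φ.map_trans] using h2

/-- The disk `(s, t) ↦ c s` has area zero, and its boundary runs along `c`, rests, runs back along
`c` and rests. Closeness to the identity makes the transport around it trivial. -/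
theorem IsCloseToId.map_reverse (hΦ : Φ.IsCloseToId ε) {c : ℝ → X}
    (hc : ContMDiff 𝓘(ℝ, ℝ) (𝓡 d) ∞ c) {x y : X} (p : PSPath d x y) (q : PSPath d y x)
    (hp : ∀ t, p t = c t) (hq : ∀ t, q t = c (1 - t)) (v : E.fiber y) :
    Φ.map q v = (Φ.map p).symm v := by
  let D : SmoothDisk d X := ⟨fun z => c z.1, hc.comp contDiff_fst.contMDiff⟩
  have hD : D.area = 0 := D.area_eq_zero fun z => by
    have h1 : ∀ v : ℝ × ℝ, mfderiv 𝓘(ℝ, ℝ × ℝ) (𝓡 d) D.toFun z v =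
        mfderiv 𝓘(ℝ, ℝ) (𝓡 d) c z.1 v.1 := fun v => by
      have h2 := mfderiv_comp z (hc.mdifferentiableAt (by simp) :
        MDifferentiableAt 𝓘(ℝ, ℝ) (𝓡 d) c z.1)
        (differentiableAt_fst : DifferentiableAt ℝ (Prod.fst : ℝ × ℝ → ℝ) z).mdifferentiableAt
      rw [mfderiv_eq_fderiv, fderiv_fst] at h2
      exact congrArg (fun L => L v) h2
    refine ⟨mfderiv 𝓘(ℝ, ℝ) (𝓡 d) c z.1 (1 : ℝ), 1, 0, ?_, ?_⟩
    · rw [h1, one_smul]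
    · rw [h1, zero_smul]
      exact map_zero (mfderiv 𝓘(ℝ, ℝ) (𝓡 d) c z.1)
  have hx : x = c 0 := by simpa [p.source] using hp 0
  have hy : y = c 1 := by simpa [p.target] using hp 1
  have h := hΦ.norm_square_le D p (PSPath.refl y) q (PSPath.refl x) hp (fun t => hy) hq
    (fun t => hx) ((Φ.map p).symm v)
  rw [hD, mul_zero, zero_mul, norm_le_zero_iff, sub_eq_zero, Φ.map_refl, Φ.map_refl,
    HilbertModuleIso.apply_symm_apply] at h
  exact h

end HilbertGBundle.ParallelTransport

/-! ### Radial trivializations -/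

namespace NormalChart

open HilbertGBundle Set Metric

variable {d : ℕ} {X : Type*} [MetricSpace X] [ChartedSpace (EuclideanSpace ℝ (Fin d)) X]
  [RiemannianBundle (fun x : X => TangentSpace (𝓡 d) x)] {a : X} (N : NormalChart d a)

theorem smooth_ψ_comp {w : ℝ → EuclideanSpace ℝ (Fin d)} (hw : ContDiff ℝ ∞ w) :
    ContMDiff 𝓘(ℝ, ℝ) (𝓡 d) ∞ (fun t => N.ψ (w t)) := N.smooth_ψ.comp hw.contMDiff

/-- The radial path from the centre of the chart to the point with coordinates `z`. -/
def radial {z : EuclideanSpace ℝ (Fin d)} {x : X} (h : N.ψ z = x) : PSPath d a x :=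
  PSPath.ofSmooth (fun t => N.ψ (t • z)) (N.smooth_ψ_comp (by fun_prop))
    (by rw [zero_smul, N.ψ_zero]) (by rw [one_smul, h])

theorem ψ_χ {x : X} (hx : x ∈ ball a N.ρ) : N.ψ (N.χ x) = x := by
  obtain ⟨z, -, rfl⟩ := N.ball_subset hx
  rw [N.χ_ψ]

theorem ball_subset_range : ball a N.ρ ⊆ range N.ψ :=
  N.ball_subset.trans (image_subset_range _ _)

theorem χ_mem {x : X} (hx : x ∈ ball a N.ρ) : N.χ x ∈ ball (0 : EuclideanSpace ℝ (Fin d)) N.r := by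
  obtain ⟨z, hz, rfl⟩ := N.ball_subset hx
  rwa [N.χ_ψ]

/-- The disk swept out by the radial paths to the points of a curve. -/
def cone {w : ℝ → EuclideanSpace ℝ (Fin d)} (hw : ContDiff ℝ ∞ w) : SmoothDisk d X :=
  ⟨fun z => N.ψ (z.1 • w z.2), N.smooth_ψ.comp (by
    have : ContDiff ℝ ∞ fun z : ℝ × ℝ => z.1 • w z.2 := by fun_prop
    exact this.contMDiff)⟩

theorem mfderiv_cone {w : ℝ → EuclideanSpace ℝ (Fin d)} (hw : ContDiff ℝ ∞ w) (z v : ℝ × ℝ) :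
    mfderiv 𝓘(ℝ, ℝ × ℝ) (𝓡 d) (N.cone hw).toFun z v =
      mfderiv 𝓘(ℝ, EuclideanSpace ℝ (Fin d)) (𝓡 d) N.ψ (z.1 • w z.2)
        (v.1 • w z.2 + (z.1 * v.2) • deriv w z.2) := by
  have hd : HasDerivAt w (deriv w z.2) z.2 := (hw.differentiable (by simp) z.2).hasDerivAt
  have h1 : HasFDerivAt (fun z : ℝ × ℝ => w z.2) _ z :=
    hd.hasFDerivAt.comp z (hasFDerivAt_snd (𝕜 := ℝ) (E := ℝ) (F := ℝ))
  have h2 := (hasFDerivAt_fst (𝕜 := ℝ) (E := ℝ) (F := ℝ) (p := z)).smul h1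
  have h3 := mfderiv_param_comp N.smooth_ψ h2.differentiableAt v
  refine h3.trans ?_
  rw [HasFDerivAt.fderiv h2]
  congr 1
  simp [smul_smul, add_comm]
  rfl

variable {Γ : Type*} [Group Γ] [MulAction Γ X]
  {B : Type*} [CStarAlgebra B] {F : Type*} [NormedAddCommGroup F] [NormedSpace ℂ F] [Module B F]
  [CStarModule B F] {E : HilbertGBundle Γ X B F} (Φ : E.ParallelTransport d)

/-- The trivialization over the chart by parallel transport along radial paths. -/
noncomputable def frame {z : EuclideanSpace ℝ (Fin d)} {x : X} (h : N.ψ z = x) :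
    HilbertModuleIso B (E.fiber x) F :=
  (Φ.map (N.radial h)).symm.trans (E.triv a a)

variable {Φ} {ε : ℝ} (hΦ : Φ.IsCloseToId ε)
include hΦ

/-- Transport along a curve, read in the radial trivialization, is close to the identity. -/
theorem norm_frame_map_sub_le_area {w : ℝ → EuclideanSpace ℝ (Fin d)} (hw : ContDiff ℝ ∞ w)
    {x y : X} (hx : N.ψ (w 0) = x) (hy : N.ψ (w 1) = y) (p : PSPath d x y)
    (hp : ∀ t : I, p t = N.ψ (w t)) (u : F) :
    ‖N.frame Φ hy (Φ.map p ((N.frame Φ hx).symm u)) - u‖ ≤ ε * (N.cone hw).area * ‖u‖ := by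
  let q : PSPath d y a := PSPath.ofSmooth (fun t => N.ψ ((1 - t) • w 1))
    (N.smooth_ψ_comp (by fun_prop)) (by simpa using hy) (by simp [N.ψ_zero])
  -- The four sides of the cone are the ray to `x`, the curve, the ray from `y` back to `a`, and the
  -- collapsed side at `a`.
  have h := hΦ.norm_square_le (N.cone hw) (N.radial hx) p q (PSPath.refl a)
    (fun t => rfl) (fun t => by rw [hp]; simp [cone]) (fun t => rfl)
    (fun t => by simp only [cone, zero_smul]; exact N.ψ_zero.symm) ((E.triv a a).symm u)
  have hq : ∀ v, Φ.map q v = (Φ.map (N.radial hy)).symm v :=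
    hΦ.map_reverse (c := fun t => N.ψ (t • w 1)) (N.smooth_ψ_comp (by fun_prop)) _ _
      (fun t => rfl) (fun t => rfl)
  rw [Φ.map_refl, hq, HilbertModuleIso.norm_map] at h
  refine le_of_eq_of_le ?_ h
  rw [← HilbertModuleIso.norm_map (E.triv a a), HilbertModuleIso.map_sub,
    HilbertModuleIso.apply_symm_apply]
  rfl

/-- Transport along a radial segment is the identity in the radial trivialization. -/
theorem frame_map_of_radial {α β : ℝ} {z : EuclideanSpace ℝ (Fin d)} {x y : X}
    (hx : N.ψ (α • z) = x) (hy : N.ψ ((α + β) • z) = y) (p : PSPath d x y)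
    (hp : ∀ t : I, p t = N.ψ ((α + t * β) • z)) (u : F) :
    N.frame Φ hy (Φ.map p ((N.frame Φ hx).symm u)) = u := by
  let w : ℝ → EuclideanSpace ℝ (Fin d) := fun t => (α + t * β) • z
  have hw : ContDiff ℝ ∞ w := by fun_prop
  have hx' : N.ψ (w 0) = x := by simpa [w] using hx
  have hy' : N.ψ (w 1) = y := by simpa [w] using hy
  have hd : ∀ t, deriv w t = β • z := fun t => by
    have : HasDerivAt w (β • z) t := by
      simpa using (((hasDerivAt_id t).mul_const β).const_add α).smul_const z
    exact this.deriv
  -- The cone over a radial segment is degenerate: both partial derivatives are multiples of the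
  -- image of `z`.
  have harea : (N.cone hw).area = 0 := SmoothDisk.area_eq_zero _ fun s => by
    refine ⟨mfderiv 𝓘(ℝ, EuclideanSpace ℝ (Fin d)) (𝓡 d) N.ψ (s.1 • w s.2) z, α + s.2 * β,
      s.1 * β, ?_, ?_⟩
    · refine (N.mfderiv_cone hw s (1, 0)).trans ?_
      simp only [hd, one_smul, mul_zero, zero_smul, add_zero]
      exact map_smul _ _ _
    · refine (N.mfderiv_cone hw s (0, 1)).trans ?_
      simp only [hd, mul_one, zero_smul, zero_add, smul_smul]
      exact map_smul _ _ _
  have h := N.norm_frame_map_sub_le_area hΦ hw hx' hy' p hp u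
  rw [harea, mul_zero, zero_mul, norm_le_zero_iff, sub_eq_zero] at h
  have e1 : ∀ (z₁ z₂ : EuclideanSpace ℝ (Fin d)) (h₁ : N.ψ z₁ = x) (h₂ : N.ψ z₂ = x),
      z₁ = z₂ → N.frame Φ h₁ = N.frame Φ h₂ := by rintro _ _ _ _ rfl; rfl
  have e2 : ∀ (z₁ z₂ : EuclideanSpace ℝ (Fin d)) (h₁ : N.ψ z₁ = y) (h₂ : N.ψ z₂ = y),
      z₁ = z₂ → N.frame Φ h₁ = N.frame Φ h₂ := by rintro _ _ _ _ rfl; rfl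
  rw [e1 _ _ hx hx' (by simp [w]), e2 _ _ hy hy' (by simp [w])]
  exact h

/-- The partial derivatives of the cone have norm at most `2`, since `r ≤ 1`, and at most `2 * ℓ`,
so its area is at most `4 * ℓ`. -/
theorem norm_frame_map_sub_le {w : ℝ → EuclideanSpace ℝ (Fin d)} (hw : ContDiff ℝ ∞ w) {ℓ : ℝ}
    (hball : ∀ t, w t ∈ ball (0 : EuclideanSpace ℝ (Fin d)) N.r) (hℓ : ∀ t, ‖deriv w t‖ ≤ ℓ)
    {x y : X} (hx : N.ψ (w 0) = x) (hy : N.ψ (w 1) = y) (p : PSPath d x y)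
    (hp : ∀ t : I, p t = N.ψ (w t)) (u : F) :
    ‖N.frame Φ hy (Φ.map p ((N.frame Φ hx).symm u)) - u‖ ≤ 4 * |ε| * ℓ * ‖u‖ := by
  have harea : (N.cone hw).area ≤ 2 * (2 * ℓ) := by
    refine SmoothDisk.area_le _ (by norm_num) fun z hz => ?_
    have hw1 : ‖w z.2‖ < N.r := by simpa using hball z.2
    have hmem : z.1 • w z.2 ∈ ball (0 : EuclideanSpace ℝ (Fin d)) N.r := by
      rw [mem_ball_zero_iff, norm_smul, Real.norm_of_nonneg hz.1.1]
      exact (mul_le_of_le_one_left (norm_nonneg _) hz.1.2).trans_lt hw1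
    constructor
    · have h1 := N.mfderiv_cone hw z (1, 0)
      simp only [one_smul, mul_zero, zero_smul, add_zero] at h1
      refine (congrArg norm h1).trans_le ((N.norm_mfderiv_le _ hmem _).trans ?_)
      linarith [N.r_le_one]
    · have h1 := N.mfderiv_cone hw z (0, 1)
      simp only [zero_smul, mul_one, zero_add] at h1
      refine (congrArg norm h1).trans_le ((N.norm_mfderiv_le _ hmem _).trans ?_)
      gcongr
      rw [norm_smul, Real.norm_of_nonneg hz.1.1]
      exact (mul_le_of_le_one_left (norm_nonneg _) hz.1.2).trans (hℓ _)
  refine (N.norm_frame_map_sub_le_area hΦ hw hx hy p hp u).trans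
    (mul_le_mul_of_nonneg_right ?_ (norm_nonneg u))
  calc ε * (N.cone hw).area ≤ |ε| * (N.cone hw).area := by
        gcongr
        · exact SmoothDisk.area_nonneg _
        · exact le_abs_self _
    _ ≤ |ε| * (2 * (2 * ℓ)) := by gcongr
    _ = _ := by ring

/-- Transport along an `L`-Lipschitz curve in the domain of the chart differs from the identity in
the radial trivialization by at most a universal multiple of `L`. -/
theorem norm_frame_map_sub_le_of_lipschitz {c : ℝ → X} (hc : ContMDiff 𝓘(ℝ, ℝ) (𝓡 d) ∞ c)
    (hball : ∀ t, c t ∈ ball a N.ρ) {L : ℝ} (hL0 : 0 ≤ L)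
    (hL : ∀ s t, dist (c s) (c t) ≤ L * |s - t|) {x y : X} (h0 : c 0 = x) (h1 : c 1 = y)
    (hx : N.ψ (N.χ x) = x) (hy : N.ψ (N.χ y) = y) (p : PSPath d x y) (hp : ∀ t : I, p t = c t)
    (u : F) :
    ‖N.frame Φ hy (Φ.map p ((N.frame Φ hx).symm u)) - u‖ ≤ 8 * |ε| * L * ‖u‖ := by
  subst h0 h1
  lift L to ℝ≥0 using hL0
  have hw : ContDiff ℝ ∞ fun t => N.χ (c t) :=
    (N.smooth_χ.comp_contMDiff hc fun t => N.ball_subset_range (hball t)).contDiff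
  have hlip : LipschitzWith (2 * L) fun t => N.χ (c t) :=
    LipschitzWith.of_dist_le_mul fun s t => by
      refine (N.dist_χ_le _ (hball s) _ (hball t)).trans ?_
      rw [Real.dist_eq, NNReal.coe_mul, NNReal.coe_ofNat, mul_assoc]
      gcongr
      exact hL s t
  have h := N.norm_frame_map_sub_le hΦ hw (fun t => N.χ_mem (hball t))
    (fun t => norm_deriv_le_of_lipschitz hlip) hx hy p
    (fun t => by rw [hp, N.ψ_χ (hball t)]) u
  refine h.trans_eq ?_
  rw [NNReal.coe_mul, NNReal.coe_ofNat]
  ring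

end NormalChart

/-! ### Uniform Lipschitz estimates for transitions and the action -/

namespace NormalChart

open HilbertGBundle Set Metric

variable {d : ℕ} {X : Type*} [MetricSpace X] [ChartedSpace (EuclideanSpace ℝ (Fin d)) X]
  [RiemannianBundle (fun x : X => TangentSpace (𝓡 d) x)]

section Connect

/-- Two points near the centre of a chart are joined by a smooth curve, defined on the whole real
line, which is Lipschitz with a constant proportional to their distance. -/
theorem exists_short_curve {a : X} (N : NormalChart d a) {x y : X} (hx : x ∈ ball a N.ρ)
    (hy : y ∈ ball a N.ρ) :
    ∃ c : ℝ → X, ContMDiff 𝓘(ℝ, ℝ) (𝓡 d) ∞ c ∧ c 0 = x ∧ c 1 = y ∧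
      (∀ s t, dist (c s) (c t) ≤ 8 * dist x y * |s - t|) ∧ ∀ t, dist (c t) x ≤ 4 * dist x y := by
  -- A smooth function on the whole line with values in `[0, 1]`, so the curve never leaves the
  -- coordinate segment even for parameters outside the unit interval. It is `2`-Lipschitz as `π / 2
  -- ≤ 2`.
  let f : ℝ → ℝ := fun t => (1 - Real.cos (Real.pi * t)) / 2
  have hf : ContDiff ℝ ∞ f := by fun_prop
  have hf01 : ∀ t, f t ∈ Icc (0 : ℝ) 1 := fun t =>
    ⟨by have := Real.cos_le_one (Real.pi * t); simp only [f]; linarith,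
      by have := Real.neg_one_le_cos (Real.pi * t); simp only [f]; linarith⟩
  have hflip : ∀ s t, |f s - f t| ≤ 2 * |s - t| := fun s t => by
    have h1 := Real.abs_cos_sub_cos_le (Real.pi * t) (Real.pi * s)
    rw [← mul_sub, abs_mul, abs_of_pos Real.pi_pos, abs_sub_comm t s] at h1
    have h2 : f s - f t = (Real.cos (Real.pi * t) - Real.cos (Real.pi * s)) / 2 := by
      simp only [f]; ring
    rw [h2, abs_div, abs_two]
    have h3 := Real.pi_le_four
    have := mul_le_mul_of_nonneg_right h3 (abs_nonneg (s - t))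
    linarith
  let w : ℝ → EuclideanSpace ℝ (Fin d) := fun t => N.χ x + f t • (N.χ y - N.χ x)
  have hw : ContDiff ℝ ∞ w := by fun_prop
  have hmem : ∀ t, w t ∈ ball (0 : EuclideanSpace ℝ (Fin d)) N.r := fun t =>
    (convex_ball _ _).add_smul_sub_mem (N.χ_mem hx) (N.χ_mem hy) (hf01 t)
  have hd : ‖N.χ y - N.χ x‖ ≤ 2 * dist x y := by
    rw [← dist_eq_norm, dist_comm x y]
    exact N.dist_χ_le _ hy _ hx
  have hdist : ∀ s t, dist (N.ψ (w s)) (N.ψ (w t)) ≤ 4 * dist x y * |f s - f t| := fun s t => by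
    refine (N.dist_ψ_le _ (hmem s) _ (hmem t)).trans ?_
    have : w s - w t = (f s - f t) • (N.χ y - N.χ x) := by simp only [w]; module
    rw [dist_eq_norm, this, norm_smul, Real.norm_eq_abs]
    have := mul_le_mul_of_nonneg_left hd (abs_nonneg (f s - f t))
    linarith
  have hf0 : f 0 = 0 := by simp [f]
  have hf1 : f 1 = 1 := by simp [f]
  have h0 : N.ψ (w 0) = x := by simp only [w, hf0, zero_smul, add_zero]; exact N.ψ_χ hx
  have h1 : N.ψ (w 1) = y := by
    simp only [w, hf1, one_smul, add_sub_cancel]; exact N.ψ_χ hy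
  refine ⟨fun t => N.ψ (w t), N.smooth_ψ_comp hw, h0, h1, fun s t => ?_, fun t => ?_⟩
  · refine (hdist s t).trans ?_
    have := mul_le_mul_of_nonneg_left (hflip s t) (by positivity : 0 ≤ 4 * dist x y)
    linarith
  · have := hdist t 0
    rw [h0, hf0, sub_zero, abs_of_nonneg (hf01 t).1] at this
    refine this.trans ?_
    exact mul_le_of_le_one_right (by positivity) (hf01 t).2

end Connect

section Chart

variable {Γ : Type*} [Group Γ] [MulAction Γ X]
  {B : Type*} [CStarAlgebra B] {F : Type*} [NormedAddCommGroup F] [NormedSpace ℂ F] [Module B F]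
  [CStarModule B F] {E : HilbertGBundle Γ X B F}
  {a b : X} (N : NormalChart d a) (M : NormalChart d b)

open Classical in
/-- The radial trivialization of a bundle over the domain of a chart. -/
noncomputable def chart (Φ : E.ParallelTransport d) (x : X) : HilbertModuleIso B (E.fiber x) F :=
  if h : N.ψ (N.χ x) = x then N.frame Φ h else E.triv a x

theorem chart_eq (Φ : E.ParallelTransport d) {x : X} (h : N.ψ (N.χ x) = x) :
    N.chart Φ x = N.frame Φ h := dif_pos h

variable {Φ : E.ParallelTransport d} {ε : ℝ} (hΦ : Φ.IsCloseToId ε)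
include hΦ

theorem norm_chart_map_sub_le {c : ℝ → X} (hc : ContMDiff 𝓘(ℝ, ℝ) (𝓡 d) ∞ c)
    (hball : ∀ t, c t ∈ ball a N.ρ) {L : ℝ} (hL0 : 0 ≤ L)
    (hL : ∀ s t, dist (c s) (c t) ≤ L * |s - t|) {x y : X} (h0 : c 0 = x) (h1 : c 1 = y)
    (p : PSPath d x y) (hp : ∀ t : I, p t = c t) (u : F) :
    ‖N.chart Φ y (Φ.map p ((N.chart Φ x).symm u)) - u‖ ≤ 8 * |ε| * L * ‖u‖ := by
  have hx := N.ψ_χ (h0 ▸ hball 0)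
  have hy := N.ψ_χ (h1 ▸ hball 1)
  rw [N.chart_eq Φ hx, N.chart_eq Φ hy]
  exact N.norm_frame_map_sub_le_of_lipschitz hΦ hc hball hL0 hL h0 h1 hx hy p hp u

/-- Unitary maps between the fibres which are intertwined by transport along two curves are close
to each other in the radial trivializations. -/
theorem norm_conj_sub_conj_le {c c' : ℝ → X} (hc : ContMDiff 𝓘(ℝ, ℝ) (𝓡 d) ∞ c)
    (hc' : ContMDiff 𝓘(ℝ, ℝ) (𝓡 d) ∞ c') (hball : ∀ t, c t ∈ ball a N.ρ)
    (hball' : ∀ t, c' t ∈ ball b M.ρ) {L : ℝ} (hL0 : 0 ≤ L)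
    (hL : ∀ s t, dist (c s) (c t) ≤ L * |s - t|) (hL' : ∀ s t, dist (c' s) (c' t) ≤ L * |s - t|)
    {x y x' y' : X} (h0 : c 0 = x) (h1 : c 1 = y) (h0' : c' 0 = x') (h1' : c' 1 = y')
    (S : HilbertModuleIso B (E.fiber x) (E.fiber x'))
    (T : HilbertModuleIso B (E.fiber y) (E.fiber y'))
    (h : ∀ (p : PSPath d x y) (q : PSPath d x' y'), (∀ t : I, p t = c t) → (∀ t : I, q t = c' t) →
      ∀ v, Φ.map q (S v) = T (Φ.map p v)) :
    ‖(M.chart Φ y').toCLM ∘L T.toCLM ∘L (N.chart Φ y).invCLM -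
      (M.chart Φ x').toCLM ∘L S.toCLM ∘L (N.chart Φ x).invCLM‖ ≤ 16 * |ε| * L := by
  refine ContinuousLinearMap.opNorm_le_bound _ (by positivity) fun u => ?_
  let p : PSPath d x y := PSPath.ofSmooth c hc h0 h1
  let q : PSPath d x' y' := PSPath.ofSmooth c' hc' h0' h1'
  have hp := N.norm_chart_map_sub_le hΦ hc hball hL0 hL h0 h1 p (fun _ => rfl) u
  have hq := M.norm_chart_map_sub_le hΦ hc' hball' hL0 hL' h0' h1' q (fun _ => rfl)
    (M.chart Φ x' (S ((N.chart Φ x).symm u)))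
  -- At `m`, which is within `8 |ε| L ‖u‖` of `u`, the intertwining relation replaces `T` by
  -- transport after `S`. Transport along the second curve contributes another error of this size.
  set m := N.chart Φ y (Φ.map p ((N.chart Φ x).symm u)) with hm
  have key : M.chart Φ y' (T ((N.chart Φ y).symm m)) =
      M.chart Φ y' (Φ.map q ((M.chart Φ x').symm (M.chart Φ x' (S ((N.chart Φ x).symm u))))) := by
    rw [hm, HilbertModuleIso.symm_apply_apply, HilbertModuleIso.symm_apply_apply,
      h p q (fun _ => rfl) (fun _ => rfl)]
  rw [← key] at hq
  simp only [HilbertModuleIso.norm_map] at hq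
  have h3 : ‖M.chart Φ y' (T ((N.chart Φ y).symm m)) - M.chart Φ y' (T ((N.chart Φ y).symm u))‖ ≤
      8 * |ε| * L * ‖u‖ := by
    rw [← HilbertModuleIso.map_sub, HilbertModuleIso.norm_map, ← HilbertModuleIso.map_sub,
      HilbertModuleIso.norm_map, ← HilbertModuleIso.map_sub, HilbertModuleIso.norm_map]
    exact hp
  calc _ = ‖M.chart Φ y' (T ((N.chart Φ y).symm u)) -
        M.chart Φ x' (S ((N.chart Φ x).symm u))‖ := rfl
    _ ≤ _ := norm_sub_le_norm_sub_add_norm_sub _ (M.chart Φ y' (T ((N.chart Φ y).symm m))) _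
    _ ≤ 8 * |ε| * L * ‖u‖ + 8 * |ε| * L * ‖u‖ := by
        rw [norm_sub_rev] at h3
        exact add_le_add h3 hq
    _ = _ := by ring

/-- Here both curves are one short curve from `x` to `y` and the intertwined maps are identities;
`128 = 16 * 8`. The curve stays within `4 * dist x y` of `x`, and the factor `20` keeps it inside
both charts: `4 / 10 + 1 / 20 < 1`. -/
theorem norm_transition_sub_le {x y : X} (hxa : x ∈ ball a (N.ρ / 20))
    (hya : y ∈ ball a (N.ρ / 20)) (hxb : x ∈ ball b (M.ρ / 20)) (hyb : y ∈ ball b (M.ρ / 20)) :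
    ‖(M.chart Φ y).toCLM ∘L (N.chart Φ y).invCLM - (M.chart Φ x).toCLM ∘L (N.chart Φ x).invCLM‖ ≤
      128 * |ε| * dist x y := by
  obtain ⟨c, hc, h0, h1, hL, hx⟩ := N.exists_short_curve
    (ball_subset_ball (by linarith [N.ρ_pos]) hxa) (ball_subset_ball (by linarith [N.ρ_pos]) hya)
  have hball : ∀ t, c t ∈ ball a N.ρ := fun t => by
    rw [mem_ball] at *
    linarith [N.ρ_pos, hx t, dist_triangle (c t) x a, dist_triangle_right x y a]
  have hball' : ∀ t, c t ∈ ball b M.ρ := fun t => by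
    rw [mem_ball] at *
    linarith [M.ρ_pos, hx t, dist_triangle (c t) x b, dist_triangle_right x y b]
  refine (norm_conj_sub_conj_le N M hΦ hc hc hball hball' (by positivity) hL hL h0 h1 h0 h1
    ⟨.refl ℂ _, fun _ _ => rfl, fun _ _ => rfl⟩ ⟨.refl ℂ _, fun _ _ => rfl, fun _ _ => rfl⟩
    fun p q hp hq v => ?_).trans_eq (by ring)
  have : p = q := PSPath.ext fun t => (hp t).trans (hq t).symm
  rw [this]
  rfl

variable [IsIsometricSMul Γ X] (hΓ : ∀ γ : Γ, ContMDiff (𝓡 d) (𝓡 d) ∞ (fun x : X => γ • x))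
  (hE : Φ.IsEquivariant)
include hΓ hE

/-- The translate by `γ` of a short curve from `x` to `y` has the same Lipschitz constant because
`γ` is an isometry, and equivariance says that the action intertwines transport along the two
curves. -/
theorem norm_act_sub_le (γ : Γ) {x y : X} (hxa : x ∈ ball a (N.ρ / 20))
    (hya : y ∈ ball a (N.ρ / 20)) (hxb : γ • x ∈ ball b (M.ρ / 20))
    (hyb : γ • y ∈ ball b (M.ρ / 20)) :
    ‖(M.chart Φ (γ • y)).toCLM ∘L (E.act γ (rfl : γ • y = γ • y)).toCLM ∘L (N.chart Φ y).invCLM -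
      (M.chart Φ (γ • x)).toCLM ∘L (E.act γ (rfl : γ • x = γ • x)).toCLM ∘L
        (N.chart Φ x).invCLM‖ ≤ 128 * |ε| * dist x y := by
  obtain ⟨c, hc, h0, h1, hL, hx⟩ := N.exists_short_curve
    (ball_subset_ball (by linarith [N.ρ_pos]) hxa) (ball_subset_ball (by linarith [N.ρ_pos]) hya)
  have hball : ∀ t, c t ∈ ball a N.ρ := fun t => by
    rw [mem_ball] at *
    linarith [N.ρ_pos, hx t, dist_triangle (c t) x a, dist_triangle_right x y a]
  have hball' : ∀ t, γ • c t ∈ ball b M.ρ := fun t => by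
    rw [mem_ball] at *
    have h2 := dist_triangle_right (γ • x) (γ • y) b
    have h3 := dist_triangle (γ • c t) (γ • x) b
    rw [dist_smul] at h2 h3
    linarith [M.ρ_pos, hx t]
  exact (norm_conj_sub_conj_le N M hΦ hc ((hΓ γ).comp hc) hball hball' (by positivity) hL
    (fun s t => by simpa using hL s t) h0 h1 (congrArg (γ • ·) h0) (congrArg (γ • ·) h1)
    (E.act γ rfl) (E.act γ rfl) fun p q hp hq v =>
      hE γ rfl rfl p q (fun t => by rw [hp, hq]; rfl) v).trans_eq (by ring)

end Chart

end NormalChart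

/-! ### The product bundle -/

namespace HilbertGBundle

open Set Metric

section

variable {d : ℕ} {X : Type*} [MetricSpace X] [ChartedSpace (EuclideanSpace ℝ (Fin d)) X]
  {Γ : Type*} [Group Γ] [MulAction Γ X]
  {B : Type*} [CStarAlgebra B] {F : Type*} [NormedAddCommGroup F] [NormedSpace ℂ F] [Module B F]
  [CStarModule B F] {E : HilbertGBundle Γ X B F}

theorem ParallelTransport.charts_congr (Φ : E.ParallelTransport d) {x y x' y' : X} (hx : x = x') (hy : y = y') (p : PSPath d x y)
    (q : PSPath d x' y') (h : ∀ t, p t = q t) (a b : X) :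
    (E.triv b y).toCLM ∘L (Φ.map p).toCLM ∘L (E.triv a x).invCLM =
      (E.triv b y').toCLM ∘L (Φ.map q).toCLM ∘L (E.triv a x').invCLM := by
  subst hx hy
  rw [PSPath.ext h]

variable [RiemannianBundle (fun x : X => TangentSpace (𝓡 d) x)]

/-- The transition from the radial trivialization to the charts of the bundle is continuous. -/
theorem continuousOn_triv_chart (Φ : E.ParallelTransport d) {a : X} (N : NormalChart d a) (b : X) :
    ContinuousOn (fun x => (E.triv b x).toCLM ∘L (N.chart Φ x).invCLM)
      (ball a N.ρ ∩ E.dom b) := by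
  have hh : ContMDiff 𝓘(ℝ, EuclideanSpace ℝ (Fin d) × ℝ) (𝓡 d) ∞
      (fun z : EuclideanSpace ℝ (Fin d) × ℝ => N.ψ (z.2 • z.1)) := by
    have : ContDiff ℝ ∞ fun z : EuclideanSpace ℝ (Fin d) × ℝ => z.2 • z.1 := by fun_prop
    exact N.smooth_ψ.comp this.contMDiff
  -- The rays form a smooth family of paths with the coordinates of the end point as parameters.
  have h := Φ.continuous d _ hh (fun u => N.smooth_ψ_comp (by fun_prop)) a b
  have hχ : ContinuousOn N.χ (ball a N.ρ ∩ E.dom b) :=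
    N.smooth_χ.continuousOn.mono (inter_subset_left.trans N.ball_subset_range)
  refine (h.comp hχ fun x hx => ?_).congr fun x hx => ?_
  · simp only [mem_ofPred_eq, zero_smul, N.ψ_zero, one_smul, N.ψ_χ hx.1]
    exact ⟨E.mem_dom a, hx.2⟩
  · rw [N.chart_eq Φ (N.ψ_χ hx.1)]
    exact Φ.charts_congr (x' := N.ψ ((0 : ℝ) • N.χ x)) (y' := N.ψ ((1 : ℝ) • N.χ x))
      (by rw [zero_smul, N.ψ_zero]) (by rw [one_smul, N.ψ_χ hx.1]) (N.radial (N.ψ_χ hx.1))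
      (PSPath.ofSmooth (fun t => N.ψ (t • N.χ x)) (N.smooth_ψ_comp (by fun_prop)) rfl rfl)
      (fun t => rfl) a b

end

section Product

variable {d : ℕ} {X : Type*} [MetricSpace X] [ChartedSpace (EuclideanSpace ℝ (Fin d)) X]
  [RiemannianBundle (fun x : X => TangentSpace (𝓡 d) x)]
  {Γ : Type*} [Group Γ] [MulAction Γ X]
  {B : ℕ → Type*} [∀ k, CStarAlgebra (B k)] [∀ k, Nontrivial (B k)]
  {F : ℕ → Type*} [∀ k, NormedAddCommGroup (F k)] [∀ k, NormedSpace ℂ (F k)]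
  [∀ k, Module (B k) (F k)] [∀ k, CStarModule (B k) (F k)]
  {E : ∀ k, HilbertGBundle Γ X (B k) (F k)}
  (hΓ : ∀ γ : Γ, ContMDiff (𝓡 d) (𝓡 d) ∞ (fun x : X => γ • x))
  {Φ : ∀ k, (E k).ParallelTransport d} (hΦ : ∀ k, (Φ k).IsEquivariant)
  {ε : ℝ} (hε : ∀ k, (Φ k).IsCloseToId ε) (N : ∀ a : X, NormalChart d a)

/-- The norm of a diagonal operator is controlled by the supremum over its components, so the common
`ε` is essential: all components obey the same Lipschitz bound. -/
theorem norm_productTransition_sub_le (hε : ∀ k, (Φ k).IsCloseToId ε) {a b x y : X}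
    (hx : x ∈ ball a ((N a).ρ / 20) ∩ ball b ((N b).ρ / 20))
    (hy : y ∈ ball a ((N a).ρ / 20) ∩ ball b ((N b).ρ / 20)) :
    ‖(HilbertModuleIso.diag fun k => (N b).chart (Φ k) x).toCLM ∘L
        (HilbertModuleIso.diag fun k => (N a).chart (Φ k) x).invCLM -
      (HilbertModuleIso.diag fun k => (N b).chart (Φ k) y).toCLM ∘L
        (HilbertModuleIso.diag fun k => (N a).chart (Φ k) y).invCLM‖ ≤
      128 * |ε| * dist x y := by
  rw [dist_comm]
  exact lp.opNorm_sub_le _ _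
    (fun k => ((N b).chart (Φ k) x).toCLM ∘L ((N a).chart (Φ k) x).invCLM)
    (fun k => ((N b).chart (Φ k) y).toCLM ∘L ((N a).chart (Φ k) y).invCLM)
    (fun _ _ => rfl) (fun _ _ => rfl) (by positivity)
    fun k => NormalChart.norm_transition_sub_le _ _ (hε k) hy.1 hx.1 hy.2 hx.2

variable [IsIsometricSMul Γ X]

include hΓ hΦ in
theorem norm_productAct_sub_le (hε : ∀ k, (Φ k).IsCloseToId ε) (γ : Γ) {a b x y : X}
    (hx : x ∈ ball a ((N a).ρ / 20) ∩ (fun x => γ • x) ⁻¹' ball b ((N b).ρ / 20))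
    (hy : y ∈ ball a ((N a).ρ / 20) ∩ (fun x => γ • x) ⁻¹' ball b ((N b).ρ / 20)) :
    ‖(HilbertModuleIso.diag fun k => (N b).chart (Φ k) (γ • x)).toCLM ∘L
        (HilbertModuleIso.diag fun k => (E k).act γ (rfl : γ • x = γ • x)).toCLM ∘L
        (HilbertModuleIso.diag fun k => (N a).chart (Φ k) x).invCLM -
      (HilbertModuleIso.diag fun k => (N b).chart (Φ k) (γ • y)).toCLM ∘L
        (HilbertModuleIso.diag fun k => (E k).act γ (rfl : γ • y = γ • y)).toCLM ∘L
        (HilbertModuleIso.diag fun k => (N a).chart (Φ k) y).invCLM‖ ≤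
      128 * |ε| * dist x y := by
  rw [dist_comm]
  exact lp.opNorm_sub_le _ _
    (fun k => ((N b).chart (Φ k) (γ • x)).toCLM ∘L ((E k).act γ (rfl : γ • x = γ • x)).toCLM ∘L
      ((N a).chart (Φ k) x).invCLM)
    (fun k => ((N b).chart (Φ k) (γ • y)).toCLM ∘L ((E k).act γ (rfl : γ • y = γ • y)).toCLM ∘L
      ((N a).chart (Φ k) y).invCLM)
    (fun _ _ => rfl) (fun _ _ => rfl) (by positivity)
    fun k => NormalChart.norm_act_sub_le _ _ (hε k) hΓ (hΦ k) γ hy.1 hx.1 hy.2 hx.2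

/-- The bundle whose fibres consist of the bounded sequences in the fibres of the bundles `Eₖ`,
trivialized by parallel transport along radial paths. -/
noncomputable def productBundle : HilbertGBundle Γ X (lp B ∞) (lp F ∞) where
  fiber x := lp (fun k => (E k).fiber x) ∞
  dom a := ball a ((N a).ρ / 20)
  isOpen_dom _ := isOpen_ball
  mem_dom a := mem_ball_self (div_pos (N a).ρ_pos (by norm_num))
  triv a x := HilbertModuleIso.diag fun k => (N a).chart (Φ k) x
  -- Norm continuity of the separate components would not suffice on bounded sequences; their common
  -- Lipschitz constant does.
  continuousOn_transition a b :=
    (LipschitzOnWith.of_dist_le_mul (K := (128 * |ε|).toNNReal) fun x hx y hy => by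
      rw [Real.coe_toNNReal _ (by positivity), dist_eq_norm]
      exact norm_productTransition_sub_le N hε hx hy).continuousOn
  act γ _ _ h := HilbertModuleIso.diag fun k => (E k).act γ h
  act_one x h v := by ext k; exact (E k).act_one x h (v k)
  act_mul γ δ _ _ _ h₁ h₂ h₃ v := by ext k; exact (E k).act_mul γ δ h₁ h₂ h₃ (v k)
  continuousOn_act γ a b :=
    (LipschitzOnWith.of_dist_le_mul (K := (128 * |ε|).toNNReal) fun x hx y hy => by
      rw [Real.coe_toNNReal _ (by positivity), dist_eq_norm]
      exact norm_productAct_sub_le hΓ hΦ N hε γ hx hy).continuousOn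

theorem productBundle_hasLipschitzTransitions :
    (productBundle hΓ hΦ hε N).HasLipschitzTransitions :=
  ⟨(128 * |ε|).toNNReal, fun a b => LipschitzOnWith.of_dist_le_mul fun x hx y hy => by
    rw [Real.coe_toNNReal _ (by positivity), dist_eq_norm]
    exact norm_productTransition_sub_le N hε hx hy⟩

theorem productBundle_hasDiagonalTransitions :
    (productBundle hΓ hΦ hε N).HasDiagonalTransitions := fun a b x _ =>
  ⟨fun k => ((N a).chart (Φ k) x).symm.trans ((N b).chart (Φ k) x), fun _ _ => rfl⟩

open Classical in
/-- The fibres of `Eₖ` are the components of the fibres of the product bundle. -/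
noncomputable def productBundleComponent (k : ℕ) :
    (productBundle hΓ hΦ hε N).ComponentIso k (E k) where
  proj x := LinearMap.mkContinuous
    { toFun := fun v : lp (fun k => (E k).fiber x) ∞ => v k
      map_add' := fun _ _ => rfl
      map_smul' := fun _ _ => rfl } 1 fun v => by
        rw [one_mul]; exact lp.norm_apply_le_norm (by simp) v k
  surjective x v := ⟨lp.single (E := fun k => (E k).fiber x) ∞ k v, by
    exact lp.single_apply_self (E := fun k => (E k).fiber x) ∞ k v⟩
  map_smul _ _ _ := rfl
  map_inner _ _ _ := rfl
  equivariant _ _ _ _ _ := rfl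
  continuousOn a b := by
    let p : lp F ∞ →L[ℂ] F k := LinearMap.mkContinuous
      { toFun := fun v : lp F ∞ => v k
        map_add' := fun _ _ => rfl
        map_smul' := fun _ _ => rfl } 1 fun v => by
          rw [one_mul]; exact lp.norm_apply_le_norm (by simp) v k
    have h := continuousOn_triv_chart (Φ k) (N a) b
    refine ((h.mono (inter_subset_inter_left _ (ball_subset_ball ?_))).clm_comp
      (continuousOn_const (c := p))).congr fun x _ => rfl
    linarith [(N a).ρ_pos]

end Product

end HilbertGBundle

/-! ### Dual bases of finitely generated Hilbert modules -/

section DualFrame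

/-- The lower bound makes the inverse of `T + t` have norm at most `c⁻¹`, so perturbations smaller
than `c` remain invertible. -/
theorem ContinuousLinearMap.isUnit_add_of_isUnit_add {G : Type*} [NormedAddCommGroup G]
    [NormedSpace ℂ G] [CompleteSpace G] {T : G →L[ℂ] G} {c : ℝ} (hc : 0 < c)
    (h : ∀ t : ℝ, 0 ≤ t → ∀ v, c * ‖v‖ ≤ ‖T v + t • v‖) {s t : ℝ} (ht : 0 ≤ t)
    (hst : |s - t| < c) (hu : IsUnit (T + t • (1 : G →L[ℂ] G))) :
    IsUnit (T + s • (1 : G →L[ℂ] G)) := by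
  nontriviality (G →L[ℂ] G)
  obtain ⟨x, hx⟩ := hu
  have h1 : ‖(↑x⁻¹ : G →L[ℂ] G)‖ ≤ c⁻¹ :=
    ContinuousLinearMap.opNorm_le_bound _ (by positivity) fun v => by
      have h2 := h t ht ((↑x⁻¹ : G →L[ℂ] G) v)
      have h3 : T ((↑x⁻¹ : G →L[ℂ] G) v) + t • (↑x⁻¹ : G →L[ℂ] G) v = v := by
        have h4 : (↑x : G →L[ℂ] G) * ↑x⁻¹ = 1 := x.mul_inv
        rw [hx] at h4
        exact congrArg (fun L : G →L[ℂ] G => L v) h4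
      rw [h3] at h2
      rwa [inv_mul_eq_div, le_div_iff₀ hc, mul_comm]
  refine ⟨x.ofNearby (T + s • 1) ?_, rfl⟩
  rw [hx]
  have h2 : T + s • (1 : G →L[ℂ] G) - (T + t • 1) = (s - t) • 1 := by module
  rw [h2]
  calc ‖(s - t) • (1 : G →L[ℂ] G)‖ ≤ ‖s - t‖ * ‖(1 : G →L[ℂ] G)‖ :=
        norm_smul_le (s - t) (1 : G →L[ℂ] G)
    _ ≤ |s - t| * 1 := by
        gcongr
        · exact le_rfl
        · exact ContinuousLinearMap.norm_id_le
    _ < c := by rwa [mul_one]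
    _ ≤ _ := (le_inv_comm₀ (Units.norm_pos _) hc).mp h1

/-- An operator `T` is invertible if the operators `T + t` with `t ≥ 0` are bounded below
uniformly. -/
theorem ContinuousLinearMap.isUnit_of_bounded_below {G : Type*} [NormedAddCommGroup G]
    [NormedSpace ℂ G] [CompleteSpace G] {T : G →L[ℂ] G} {c : ℝ} (hc : 0 < c)
    (h : ∀ t : ℝ, 0 ≤ t → ∀ v, c * ‖v‖ ≤ ‖T v + t • v‖) : IsUnit T := by
  -- Invertibility holds at `t = N * (c / 2) > ‖T‖` by the Neumann series and is carried down to `t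
  -- = 0` in `N` steps of length `c / 2`.
  obtain ⟨N, hN⟩ := exists_nat_gt (‖T‖ / (c / 2))
  have hN' : ‖T‖ < N * (c / 2) := (div_lt_iff₀ (by positivity)).mp hN
  have hpos : 0 < N * (c / 2) := (norm_nonneg T).trans_lt hN'
  have hbig : IsUnit (T + ((N : ℝ) * (c / 2)) • (1 : G →L[ℂ] G)) := by
    have h1 : T + ((N : ℝ) * (c / 2)) • (1 : G →L[ℂ] G) =
        ((N : ℝ) * (c / 2)) • (1 - (-((N : ℝ) * (c / 2))⁻¹ • T)) := by
      rw [smul_sub, smul_smul, mul_neg, mul_inv_cancel₀ hpos.ne', neg_smul, one_smul]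
      abel
    have h2 : ‖(-((N : ℝ) * (c / 2))⁻¹ • T)‖ < 1 := by
      refine (norm_smul_le (-((N : ℝ) * (c / 2))⁻¹) T).trans_lt ?_
      rw [norm_neg, norm_inv, Real.norm_of_nonneg hpos.le, inv_mul_eq_div, div_lt_one hpos]
      exact hN'
    rw [h1]
    exact (IsUnit.smul (Units.mk0 ((N : ℝ) * (c / 2)) hpos.ne') ⟨Units.oneSub _ h2, rfl⟩ :)
  have key : ∀ m ≤ N, IsUnit (T + ((m : ℝ) * (c / 2)) • (1 : G →L[ℂ] G)) := fun m hm =>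
    Nat.decreasingInduction (motive := fun m _ =>
      IsUnit (T + ((m : ℝ) * (c / 2)) • (1 : G →L[ℂ] G)))
      (fun k _ hk => ContinuousLinearMap.isUnit_add_of_isUnit_add hc h (by positivity) (by
        push_cast
        rw [← sub_mul, abs_mul, abs_of_pos (by positivity : 0 < c / 2)]
        simp
        linarith) hk) hbig hm
  simpa using key 0 (Nat.zero_le _)

namespace CStarModule

variable {A G : Type*} [CStarAlgebra A] [NormedAddCommGroup G] [NormedSpace ℂ G] [Module A G]
  [CStarModule A G]

theorem isBoundedSMul (A G : Type*) [CStarAlgebra A] [NormedAddCommGroup G] [NormedSpace ℂ G]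
    [Module A G] [CStarModule A G] : IsBoundedSMul A G :=
  IsBoundedSMul.of_norm_smul_le norm_alg_smul_le

theorem isScalarTower (A G : Type*) [CStarAlgebra A] [NormedAddCommGroup G] [NormedSpace ℂ G]
    [Module A G] [CStarModule A G] : IsScalarTower ℂ A G :=
  ⟨fun c a v => complex_smul_smul c a v⟩

variable (A G) in
/-- The action of `A` on a Hilbert `A`-module as a continuous bilinear map. -/
noncomputable def smulCLM : G →L[ℂ] A →L[ℂ] G :=
  haveI := isBoundedSMul A G
  haveI := isScalarTower A G
  (ContinuousLinearMap.lsmul ℂ A : A →L[ℂ] G →L[ℂ] G).flip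

@[simp] theorem smulCLM_apply (u : G) (a : A) : smulCLM A G u a = a • u := rfl

variable [CompleteSpace G]

/-- A finitely generated Hilbert module is projective, with a continuous dual basis. -/
theorem exists_dual_frame {n : ℕ} {e : Fin n → G}
    (he : ∀ v, ∃ b : Fin n → A, (∀ i, ‖b i‖ ≤ 2 * ‖v‖) ∧ v = ∑ i, b i • e i) :
    ∃ θ : Fin n → G →L[ℂ] A, ∀ v, v = ∑ i, θ i v • e i := by
  let R : G →L[ℂ] G := ∑ i, smulCLM A G (e i) ∘L innerSL (e i)
  have hR : ∀ v, R v = ∑ i, (inner A (e i) v : A) • e i := fun v => by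
    simp [R, innerSL_apply]
  let q : G → A := fun v => ∑ i, star (inner A v (e i)) * inner A v (e i)
  have hq : ∀ v, inner A v (R v) = q v := fun v => by
    simp only [hR, inner_sum_right, inner_op_smul_right, star_inner, q]
  have hq0 : ∀ v, 0 ≤ q v := fun v => Finset.sum_nonneg fun i _ => star_mul_self_nonneg _
  -- Expand one `v` in `⟨v, v⟩` by the bounded coefficients; each `⟨v, e i⟩` has norm at most `√‖q
  -- v‖`.
  have h1 : ∀ v, ‖v‖ ^ 2 ≤ (4 * n ^ 2) * ‖q v‖ := fun v => by
    obtain ⟨b, hb, hv⟩ := he v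
    have hx : ∀ i, ‖inner A v (e i)‖ ≤ √‖q v‖ := fun i => by
      refine Real.le_sqrt_of_sq_le ?_
      rw [sq, ← CStarRing.norm_star_mul_self]
      exact CStarAlgebra.norm_le_norm_of_nonneg_of_le (star_mul_self_nonneg _)
        (Finset.single_le_sum (f := fun i => star (inner A v (e i)) * inner A v (e i))
          (fun i _ => star_mul_self_nonneg _) (Finset.mem_univ i))
    have h2 : ‖v‖ ^ 2 ≤ n * (2 * ‖v‖ * √‖q v‖) := by
      rw [norm_sq_eq A]
      have h3 : inner A v v = ∑ i, b i * inner A v (e i) := by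
        conv_lhs => rw [hv, inner_sum_right, ← hv]
        exact Finset.sum_congr rfl fun i _ => inner_op_smul_right
      rw [h3]
      refine (norm_sum_le_of_le _ fun i _ => (norm_mul_le _ _).trans
        (mul_le_mul (hb i) (hx i) (norm_nonneg _) (by positivity))).trans_eq ?_
      simp
    rcases (norm_nonneg v).eq_or_lt with h0 | h0
    · rw [← h0, zero_pow two_ne_zero]
      positivity
    · have h4 : ‖v‖ ≤ n * (2 * √‖q v‖) := by
        refine le_of_mul_le_mul_right ?_ h0
        linarith
      calc ‖v‖ ^ 2 ≤ (n * (2 * √‖q v‖)) ^ 2 := by gcongr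
        _ = (4 * n ^ 2) * √‖q v‖ ^ 2 := by ring
        _ = _ := by rw [Real.sq_sqrt (norm_nonneg _)]
  -- For `t ≥ 0` one has `q v ≤ ⟨v, R v + t v⟩`, so Cauchy–Schwarz turns `h1` into a lower bound for
  -- `R + t`. The summand `1` in the constant covers `n = 0`.
  have hunit : IsUnit R := by
    refine ContinuousLinearMap.isUnit_of_bounded_below
      (inv_pos.mpr (by positivity : (0 : ℝ) < 4 * n ^ 2 + 1)) fun t ht v => ?_
    have h2 : ‖q v‖ ≤ ‖v‖ * ‖R v + t • v‖ := by
      refine le_trans ?_ (norm_inner_le (A := A) G)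
      refine CStarAlgebra.norm_le_norm_of_nonneg_of_le (hq0 v) ?_
      rw [inner_add_right, hq, inner_smul_right_real]
      exact le_add_of_nonneg_right (smul_nonneg ht inner_self_nonneg)
    rw [inv_mul_eq_div, div_le_iff₀ (by positivity)]
    rcases (norm_nonneg v).eq_or_lt with h0 | h0
    · rw [← h0]
      positivity
    · refine le_of_mul_le_mul_right ?_ h0
      have h3 : 0 ≤ ‖v‖ * ‖R v + t • v‖ := by positivity
      calc ‖v‖ * ‖v‖ = ‖v‖ ^ 2 := (sq _).symm
        _ ≤ (4 * n ^ 2) * ‖q v‖ := h1 v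
        _ ≤ (4 * n ^ 2) * (‖v‖ * ‖R v + t • v‖) := by gcongr
        _ ≤ _ := by linarith
  obtain ⟨U, hU⟩ := hunit
  refine ⟨fun i => innerSL (e i) ∘L (↑U⁻¹ : G →L[ℂ] G), fun v => ?_⟩
  have h2 : (↑U : G →L[ℂ] G) * ↑U⁻¹ = 1 := U.mul_inv
  rw [hU] at h2
  exact (congrArg (fun L : G →L[ℂ] G => L v) h2).symm.trans (hR _)

end CStarModule

end DualFrame

/-! ### Smooth families of continuous paths -/

section ParameterDependence

open Set Metric

namespace ContinuousMap

variable {K : Type*} [TopologicalSpace K] [CompactSpace K]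
  {𝔼 Y Z : Type*} [NormedAddCommGroup 𝔼] [NormedSpace ℝ 𝔼]
  [NormedAddCommGroup Y] [NormedSpace ℝ Y] [NormedAddCommGroup Z] [NormedSpace ℝ Z]

variable (K) in
/-- Pointwise evaluation of a path of operators, parametrized by `Z`, at a vector. -/
noncomputable def evalOperator (L : Z →L[ℝ] 𝔼 →L[ℝ] Y) : C(K, Z) →L[ℝ] 𝔼 →L[ℝ] C(K, Y) :=
  LinearMap.mkContinuous₂
    ({ toFun := fun T =>
        { toFun := fun v => ⟨fun t => L (T t) v, by fun_prop⟩
          map_add' := fun v w => by ext t; exact map_add (L (T t)) v w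
          map_smul' := fun c v => by ext t; exact map_smul (L (T t)) c v }
       map_add' := fun S T => by ext v t; exact congrArg (fun M => M v) (map_add L (S t) (T t))
       map_smul' := fun c T => by ext v t; exact congrArg (fun M => M v) (map_smul L c (T t)) } :
      C(K, Z) →ₗ[ℝ] 𝔼 →ₗ[ℝ] C(K, Y)) ‖L‖ fun T v => by
    refine (ContinuousMap.norm_le _ (by positivity)).mpr fun t => ?_
    exact (L.le_opNorm₂ (T t) v).trans (by gcongr; exact T.norm_coe_le_norm t)

/-- Continuity of `f'.curry` in the supremum norm controls the variation of the derivative uniformly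
in `t`; the mean value inequality on a ball then gives a uniform remainder. -/
theorem hasFDerivAt_curry {f : C(𝔼 × K, Y)} (L : Z →L[ℝ] 𝔼 →L[ℝ] Y) {f' : C(𝔼 × K, Z)}
    (h : ∀ u t, HasFDerivAt (fun u => f (u, t)) (L (f' (u, t))) u) (u : 𝔼) :
    HasFDerivAt (fun u => f.curry u) (evalOperator K L (f'.curry u)) u := by
  rw [hasFDerivAt_iff_isLittleO, Asymptotics.isLittleO_iff]
  intro ε hε
  have hc : ContinuousAt (fun u => f'.curry u) u := f'.curry.continuous.continuousAt
  obtain ⟨δ, hδ, hball⟩ := Metric.continuousAt_iff.mp hc (ε / (‖L‖ + 1)) (by positivity)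
  filter_upwards [ball_mem_nhds u hδ] with w hw
  refine (ContinuousMap.norm_le _ (by positivity)).mpr fun t => ?_
  refine (convex_ball u δ).norm_image_sub_le_of_norm_hasFDerivWithin_le'
    (f := fun u => f (u, t)) (f' := fun u => L (f' (u, t))) (φ := L (f' (u, t))) (C := ε)
    (fun x _ => (h x t).hasFDerivWithinAt) (fun x hx => ?_) (mem_ball_self hδ) hw
  have h1 := (ContinuousMap.dist_apply_le_dist (f := f'.curry x) (g := f'.curry u) t).trans
    (hball hx).le
  rw [dist_eq_norm, le_div_iff₀ (by positivity)] at h1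
  rw [← map_sub]
  refine (L.le_opNorm _).trans ?_
  change ‖f' (x, t) - f' (u, t)‖ * _ ≤ _ at h1
  nlinarith [norm_nonneg (f' (x, t) - f' (u, t)), norm_nonneg L]

theorem contDiff_succ_curry {n : ℕ} {f : C(𝔼 × K, Y)} (L : Z →L[ℝ] 𝔼 →L[ℝ] Y) {f' : C(𝔼 × K, Z)}
    (h : ∀ u t, HasFDerivAt (fun u => f (u, t)) (L (f' (u, t))) u)
    (hf' : ContDiff ℝ n fun u => f'.curry u) :
    ContDiff ℝ ((n + 1 : ℕ) : ℕ∞) (fun u => f.curry u) := by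
  have := contDiff_succ_iff_hasFDerivAt.mpr ⟨fun u => evalOperator K L (f'.curry u),
    (evalOperator K L).contDiff.comp hf', hasFDerivAt_curry L h⟩
  exact_mod_cast this

end ContinuousMap

/-- A smooth function of two variables, the second one in the unit interval, is a smooth function
of the first variable with values in the space of continuous functions of the second one. -/
theorem ContDiff.curry_unitInterval {𝔼 : Type} [NormedAddCommGroup 𝔼] [NormedSpace ℝ 𝔼]
    {Y : Type*} [NormedAddCommGroup Y] [NormedSpace ℝ Y]
    {g : 𝔼 × ℝ → Y} (hg : ContDiff ℝ ∞ g) (f : C(𝔼 × I, Y)) 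
    (h : ∀ u (t : I), f (u, t) = g (u, t)) :
    ContDiff ℝ ∞ (fun u => f.curry u) := by
  refine contDiff_infty.mpr fun n => ?_
  -- The derivative takes values in `𝔼 →L[ℝ] Y`; with `𝔼` in `Type` this lies in the universe of
  -- `Y`, so the induction hypothesis applies to it.
  induction n generalizing Y with
  | zero => exact contDiff_zero.mpr f.curry.continuous
  | succ n ih =>
    let g' : 𝔼 × ℝ → 𝔼 →L[ℝ] Y := fun z => fderiv ℝ g z ∘L ContinuousLinearMap.inl ℝ 𝔼 ℝ
    have hg' : ContDiff ℝ ∞ g' := (hg.fderiv_right (m := ∞) le_rfl).clm_comp contDiff_const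
    have hc : Continuous fun z : 𝔼 × I => g' (z.1, z.2) := hg'.continuous.comp (by fun_prop)
    refine ContinuousMap.contDiff_succ_curry (ContinuousLinearMap.id ℝ (𝔼 →L[ℝ] Y)) (f' := ⟨_, hc⟩)
      (fun u t => ?_) (ih hg' ⟨_, hc⟩ fun u t => rfl)
    simp only [h]
    have h1 := (hg.differentiable (by simp) (u, (t : ℝ))).hasFDerivAt
    exact h1.comp u (hasFDerivAt_prodMk_left u (t : ℝ))

end ParameterDependence

/-! ### Linear Volterra equations with parameters -/

section Volterra

open Set Metric

variable {𝔸 : Type*} [NormedRing 𝔸] [NormedAlgebra ℝ 𝔸] [CompleteSpace 𝔸]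

omit [NormedAlgebra ℝ 𝔸] [CompleteSpace 𝔸] in
theorem ContinuousMap.continuous_projIcc (f : C(I, 𝔸)) :
    Continuous fun s : ℝ => f (projIcc 0 1 zero_le_one s) :=
  f.continuous.comp _root_.continuous_projIcc

/-- Integration from `0` as an operator on continuous functions on the unit interval. -/
noncomputable def primitiveCLM (𝔸 : Type*) [NormedRing 𝔸] [NormedAlgebra ℝ 𝔸] [CompleteSpace 𝔸] :
    C(I, 𝔸) →L[ℝ] C(I, 𝔸) :=
  LinearMap.mkContinuous
    { toFun := fun f => ⟨fun t => ∫ s in (0 : ℝ)..t, f (projIcc 0 1 zero_le_one s),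
        (intervalIntegral.continuous_primitive
          (fun _ _ => f.continuous_projIcc.intervalIntegrable _ _) 0).comp continuous_subtype_val⟩
      map_add' := fun f g => by
        ext t
        exact intervalIntegral.integral_add (f.continuous_projIcc.intervalIntegrable _ _)
          (g.continuous_projIcc.intervalIntegrable _ _)
      map_smul' := fun c f => by
        ext t
        exact intervalIntegral.integral_smul c _ } 1 fun f => by
    refine (ContinuousMap.norm_le _ (by positivity)).mpr fun t => ?_
    have := intervalIntegral.norm_integral_le_of_norm_le_const (a := (0 : ℝ)) (b := t)
      (f := fun s => f (projIcc 0 1 zero_le_one s)) (C := ‖f‖)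
      fun s _ => f.norm_coe_le_norm _
    refine this.trans ?_
    rw [sub_zero, abs_of_nonneg t.2.1, one_mul]
    exact mul_le_of_le_one_right (norm_nonneg _) t.2.2

/-- The Volterra operator `h ↦ ∫ h a`, depending linearly on `a`. -/
noncomputable def volterraCLM (𝔸 : Type*) [NormedRing 𝔸] [NormedAlgebra ℝ 𝔸] [CompleteSpace 𝔸] :
    C(I, 𝔸) →L[ℝ] C(I, 𝔸) →L[ℝ] C(I, 𝔸) :=
  (ContinuousLinearMap.compL ℝ C(I, 𝔸) C(I, 𝔸) C(I, 𝔸) (primitiveCLM 𝔸)) ∘L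
    (ContinuousLinearMap.mul ℝ C(I, 𝔸)).flip

theorem norm_volterraCLM_apply_le (a : C(I, 𝔸)) : ‖volterraCLM 𝔸 a‖ ≤ ‖a‖ :=
  ContinuousLinearMap.opNorm_le_bound _ (norm_nonneg _) fun h => by
    refine (LinearMap.mkContinuous_norm_le _ zero_le_one _ |>.trans_eq rfl |> fun h1 =>
      (primitiveCLM 𝔸).le_of_opNorm_le h1 (h * a)).trans ?_
    rw [one_mul, mul_comm ‖a‖]
    exact norm_mul_le _ _

/-- Smooth dependence on parameters of the solution of a linear equation with small
coefficients. -/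
theorem contDiffAt_of_eq_add {𝔼 C D : Type*} [NormedAddCommGroup 𝔼] [NormedSpace ℝ 𝔼]
    [NormedAddCommGroup C] [NormedSpace ℝ C] [CompleteSpace C] [NormedAddCommGroup D]
    [NormedSpace ℝ D] (K : D →L[ℝ] C →L[ℝ] C) {a : 𝔼 → D} {h h₀ : 𝔼 → C} {u₀ : 𝔼}
    (ha : ContDiffAt ℝ ∞ a u₀) (hh₀ : ContDiffAt ℝ ∞ h₀ u₀) (hsmall : ‖K (a u₀)‖ < 1)
    (heq : ∀ᶠ u in 𝓝 u₀, h u = h₀ u + K (a u) (h u)) : ContDiffAt ℝ ∞ h u₀ := by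
  have hKa : ContDiffAt ℝ ∞ (fun u => K (a u)) u₀ := K.contDiff.contDiffAt.comp u₀ ha
  -- The solution is `(1 - K (a u))⁻¹ (h₀ u)`, and inversion is smooth on the units.
  have hinv : ContDiffAt ℝ ∞ (fun u => Ring.inverse ((1 : C →L[ℝ] C) - K (a u))) u₀ :=
    ContDiffAt.comp (g := Ring.inverse) u₀
      (contDiffAt_ringInverse ℝ (Units.oneSub _ hsmall)) (contDiffAt_const.sub hKa)
  refine (hinv.clm_apply hh₀).congr_of_eventuallyEq ?_
  filter_upwards [heq, hKa.continuousAt.norm.eventually_lt_const hsmall] with u hu hau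
  have h1 : ((1 : C →L[ℝ] C) - K (a u)) (h u) = h₀ u :=
    sub_eq_iff_eq_add.mpr hu
  rw [← h1]
  have h2 := Ring.inverse_mul_cancel _ (Units.oneSub _ hau).isUnit
  exact (congrArg (fun L : C →L[ℝ] C => L (h u)) h2).symm

/-- Smooth dependence on parameters of the solution of a linear integral equation with small
coefficients. -/
theorem contDiffAt_of_volterra {𝔼 : Type*} [NormedAddCommGroup 𝔼] [NormedSpace ℝ 𝔼]
    {a h : 𝔼 → C(I, 𝔸)} {h₀ : 𝔼 → 𝔸} {u₀ : 𝔼} (ha : ContDiffAt ℝ ∞ a u₀)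
    (hh₀ : ContDiffAt ℝ ∞ h₀ u₀) (hsmall : ‖a u₀‖ < 1)
    (heq : ∀ᶠ u in 𝓝 u₀, ∀ t : I, h u t =
      h₀ u + ∫ s in (0 : ℝ)..t, (h u * a u) (projIcc 0 1 zero_le_one s)) :
    ContDiffAt ℝ ∞ (fun u => h u 1) u₀ := by
  let c : 𝔸 →L[ℝ] C(I, 𝔸) := LinearMap.mkContinuous
    { toFun := fun x => ContinuousMap.const I x
      map_add' := fun _ _ => rfl
      map_smul' := fun _ _ => rfl } 1 fun x => by
    refine (ContinuousMap.norm_le _ (by positivity)).mpr fun t => ?_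
    rw [one_mul]
    exact le_rfl
  have hsol : ContDiffAt ℝ ∞ h u₀ :=
    contDiffAt_of_eq_add (volterraCLM 𝔸) ha (c.contDiff.contDiffAt.comp u₀ hh₀)
      ((norm_volterraCLM_apply_le _).trans_lt hsmall)
      (heq.mono fun u hu => by ext t; exact hu t)
  let e : C(I, 𝔸) →L[ℝ] 𝔸 := LinearMap.mkContinuous
    { toFun := fun f => f 1
      map_add' := fun _ _ => rfl
      map_smul' := fun _ _ => rfl } 1 fun f => by
    rw [one_mul]
    exact f.norm_coe_le_norm 1
  exact e.contDiff.contDiffAt.comp u₀ hsol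

/-- A strong solution of a linear differential equation is a norm solution of the corresponding
integral equation if it is norm continuous. -/
theorem eq_add_integral_of_strong {F : Type*} [NormedAddCommGroup F] [NormedSpace ℂ F]
    [CompleteSpace F] {h a : ℝ → F →L[ℂ] F} (hh : ContinuousOn h (Icc 0 1))
    (ha : ContinuousOn a (Icc 0 1))
    (hd : ∀ t ∈ Ioo (0 : ℝ) 1, ∀ w, HasDerivAt (fun t => h t w) (h t (a t w)) t) {t : ℝ}
    (ht : t ∈ Icc (0 : ℝ) 1) : h t = h 0 + ∫ s in (0 : ℝ)..t, h s * a s := by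
  have hc : ContinuousOn (fun s => h s * a s) (Icc 0 t) :=
    (hh.mul ha).mono (Icc_subset_Icc_right ht.2)
  -- The fundamental theorem of calculus is applied to each vector separately; norm continuity is
  -- needed only for the operator valued integral to exist.
  ext w
  rw [add_apply, ContinuousLinearMap.intervalIntegral_apply
    (hc.intervalIntegrable_of_Icc ht.1)]
  have := intervalIntegral.integral_eq_sub_of_hasDerivAt_of_le ht.1
    (f := fun s => h s w) (f' := fun s => h s (a s w))
    ((hh.mono (Icc_subset_Icc_right ht.2)).clm_apply continuousOn_const)
    (fun s hs => hd s ⟨hs.1, hs.2.trans_le ht.2⟩ w)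
    ((hc.clm_apply continuousOn_const).intervalIntegrable_of_Icc ht.1)
  rw [eq_comm, add_comm, ← eq_sub_iff_add_eq]
  exact this

/-- Smoothness of a solution of a differential equation along rays propagates along the rays. -/
theorem contDiffAt_of_ray {𝔼 : Type} [NormedAddCommGroup 𝔼] [NormedSpace ℝ 𝔼]
    {F : Type*} [NormedAddCommGroup F] [NormedSpace ℂ F] [CompleteSpace F] {H : 𝔼 → F →L[ℂ] F}
    {η : 𝔼 × 𝔼 → F →L[ℂ] F} (hη : ContDiff ℝ ∞ η) {p : 𝔼} {ρ C : ℝ} (hC : 0 ≤ C)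
    (hρC : 2 * ρ * C < 1) (hH : ContinuousOn H (ball p ρ))
    (hd : ∀ (z : 𝔼) (t : ℝ), t • z ∈ ball p ρ → ∀ w,
      HasDerivAt (fun t : ℝ => H (t • z) w) (H (t • z) (η (t • z, z) w)) t)
    (hηC : ∀ y ∈ ball p ρ, ∀ v, ‖η (y, v)‖ ≤ C * ‖v‖) {l : ℝ} {z : 𝔼}
    (hz : z ∈ ball p ρ) (hlz : l • z ∈ ball p ρ) (hsm : ContDiffAt ℝ ∞ (fun u => H (l • u)) z) :
    ContDiffAt ℝ ∞ H z := by
  -- The radial segment from `l • u` to `u`; its speed factor `1 - l` enters the coefficient `g` of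
  -- the equation in `t`.
  let γ : 𝔼 → ℝ → 𝔼 := fun u t => (l + t * (1 - l)) • u
  let g : 𝔼 × ℝ → F →L[ℂ] F := fun z => (1 - l) • η (γ z.1 z.2, z.1)
  have hg : ContDiff ℝ ∞ g := by
    have h1 : ContDiff ℝ ∞ fun z : 𝔼 × ℝ => (γ z.1 z.2, z.1) := by fun_prop
    exact (hη.comp h1).const_smul (1 - l)
  let A : C(𝔼 × I, F →L[ℂ] F) := ⟨fun z => g (z.1, z.2), hg.continuous.comp (by fun_prop)⟩
  have hγ : ∀ u, u ∈ ball p ρ → l • u ∈ ball p ρ → ∀ t ∈ Icc (0 : ℝ) 1, γ u t ∈ ball p ρ :=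
    fun u hu hlu t ht => by
      have := (convex_ball p ρ).add_smul_sub_mem hlu hu ht
      convert this using 1
      simp only [γ]
      module
  have hcont : ∀ u, u ∈ ball p ρ → l • u ∈ ball p ρ →
      ContinuousOn (fun t : ℝ => H (γ u t)) (Icc 0 1) := fun u hu hlu =>
    hH.comp (by fun_prop) (hγ u hu hlu)
  have hcontI : ∀ u, u ∈ ball p ρ → l • u ∈ ball p ρ → Continuous fun t : I => H (γ u t) :=
    fun u hu hlu => (hcont u hu hlu).comp_continuous continuous_subtype_val fun t => t.2
  -- The default value `0` occurs only where the path is not continuous, hence never for `u` near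
  -- `z`.
  let h : 𝔼 → C(I, F →L[ℂ] F) := fun u => ContinuousMap.mkD (fun t : I => H (γ u t)) 0
  have hev : ∀ᶠ u in 𝓝 z, u ∈ ball p ρ ∧ l • u ∈ ball p ρ :=
    Filter.Eventually.and (isOpen_ball.mem_nhds hz)
      ((continuous_const_smul l).continuousAt.eventually (isOpen_ball.mem_nhds hlz))
  have hρ : 0 ≤ ρ := dist_nonneg.trans (mem_ball.mp hz).le
  have hh : ∀ u, u ∈ ball p ρ → l • u ∈ ball p ρ → ∀ t : I, h u t = H (γ u t) :=
    fun u hu hlu t => ContinuousMap.mkD_apply_of_continuous (hcontI u hu hlu)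
  have key := contDiffAt_of_volterra (a := fun u => A.curry u) (h := h)
    (hg.curry_unitInterval A fun u t => rfl).contDiffAt hsm ?_ ?_
  · refine key.congr_of_eventuallyEq ?_
    filter_upwards [hev] with u hu
    rw [hh u hu.1 hu.2]
    simp [γ]
  -- The coefficient has norm at most `C ‖z - l z‖ ≤ 2 ρ C < 1`, because both end points lie in the
  -- ball.
  · refine lt_of_le_of_lt ((ContinuousMap.norm_le _ (by positivity)).mpr fun t => ?_)
      (?_ : C * (2 * ρ) < 1)
    · have h1 : ‖g (z, t)‖ ≤ C * ‖(1 - l) • z‖ := by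
        refine (norm_smul_le (1 - l) (η (γ z t, z))).trans ?_
        rw [norm_smul, mul_left_comm]
        gcongr
        exact hηC _ (hγ z hz hlz t t.2) z
      refine h1.trans ?_
      gcongr
      rw [sub_smul, one_smul, ← dist_eq_norm]
      rw [mem_ball] at hz hlz
      linarith [dist_triangle_right z (l • z) p]
    · linarith
  · filter_upwards [hev] with u hu t
    have h1 := eq_add_integral_of_strong (h := fun t => H (γ u t)) (a := fun t => g (u, t))
      (hcont u hu.1 hu.2) ((hg.continuous.comp (by fun_prop)).continuousOn) (fun s hs w => ?_) t.2
    · rw [hh u hu.1 hu.2, h1]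
      congr 1
      · simp [γ]
      · refine intervalIntegral.integral_congr fun s hs => ?_
        rw [uIcc_of_le t.2.1] at hs
        have hs' : s ∈ Icc (0 : ℝ) 1 := ⟨hs.1, hs.2.trans t.2.2⟩
        rw [projIcc_of_mem _ hs']
        exact congrArg (· * g (u, s)) (hh u hu.1 hu.2 ⟨s, hs'⟩).symm
    · have h2 := hd u (l + s * (1 - l)) (hγ u hu.1 hu.2 s ⟨hs.1.le, hs.2.le⟩) w
      have h3 : HasDerivAt (fun s : ℝ => l + s * (1 - l)) (1 - l) s := by
        simpa using ((hasDerivAt_id s).mul_const (1 - l)).const_add l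
      refine (h2.scomp s h3).congr_deriv ?_
      change _ = H (γ u s) ((1 - l) • η (γ u s, u) w)
      rw [← Complex.coe_smul, ← Complex.coe_smul, map_smul]

end Volterra

/-! ### The connection form in the operator norm -/

section ConnectionForm

open Set Metric HilbertGBundle Filter

theorem contMDiff_constVector {G : Type*} [NormedAddCommGroup G] [NormedSpace ℝ G] (v : G) :
    ContMDiff 𝓘(ℝ, G) 𝓘(ℝ, G).tangent ∞ (fun z => (⟨z, v⟩ : TangentBundle 𝓘(ℝ, G) G)) :=
  contMDiff_vectorSpace_iff_contDiff (V := fun _ : G => (v : G)) |>.mpr contDiff_const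

/-- The smoothness axiom of a connection concerns vector fields on all of `X`; the cutoff makes a
coordinate field global. -/
theorem NormalChart.contMDiff_pushforward {d : ℕ} {X : Type*} [MetricSpace X]
    [ChartedSpace (EuclideanSpace ℝ (Fin d)) X] [IsManifold (𝓡 d) ∞ X]
    [RiemannianBundle (fun x : X => TangentSpace (𝓡 d) x)] {a : X} (N : NormalChart d a)
    {β : X → ℝ} (hβ : ContMDiff (𝓡 d) 𝓘(ℝ, ℝ) ∞ β) (hs : tsupport β ⊆ range N.ψ)
    (v : EuclideanSpace ℝ (Fin d)) :
    ContMDiff (𝓡 d) ((𝓡 d).prod (𝓡 d)) ∞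
      (fun x => (⟨x, β x • (mfderiv 𝓘(ℝ, EuclideanSpace ℝ (Fin d)) (𝓡 d) N.ψ (N.χ x) v :
        EuclideanSpace ℝ (Fin d))⟩ : TangentBundle (𝓡 d) X)) := by
  refine ContMDiffOn.smul_section_of_tsupport (V := fun x : X => TangentSpace (𝓡 d) x)
    (F := EuclideanSpace ℝ (Fin d)) (ψ := β) (s := fun x =>
      (mfderiv 𝓘(ℝ, EuclideanSpace ℝ (Fin d)) (𝓡 d) N.ψ (N.χ x) v : EuclideanSpace ℝ (Fin d)))
    hβ.contMDiffOn N.isOpen_range hs ?_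
  have h1 := contMDiff_constVector v
  have h2 := (N.smooth_ψ.contMDiff_tangentMap (m := ∞) le_rfl).comp h1
  refine (h2.comp_contMDiffOn N.smooth_χ).congr ?_
  rintro _ ⟨z, rfl⟩
  have h3 : ∀ z', z' = z → (⟨N.ψ z, (mfderiv 𝓘(ℝ, EuclideanSpace ℝ (Fin d)) (𝓡 d) N.ψ z' v :
      EuclideanSpace ℝ (Fin d))⟩ : TangentBundle (𝓡 d) X) =
      tangentMap 𝓘(ℝ, EuclideanSpace ℝ (Fin d)) (𝓡 d) N.ψ ⟨z', v⟩ := by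
    rintro _ rfl
    rfl
  exact h3 _ (N.χ_ψ z)

section Sections

variable {d : ℕ} {X : Type*} [MetricSpace X] [ChartedSpace (EuclideanSpace ℝ (Fin d)) X]
  {Γ : Type*} [Group Γ] [MulAction Γ X]
  {B : Type*} [CStarAlgebra B] {F : Type*} [NormedAddCommGroup F] [NormedSpace ℂ F] [Module B F]
  [CStarModule B F] {E : HilbertGBundle Γ X B F}

/-- The section which is constant in the chart `b`, cut off by `β`. -/
noncomputable def HilbertGBundle.cutoffSection (E : HilbertGBundle Γ X B F) (β : X → ℝ) (b : X)
    (w : F) (x : X) : E.fiber x :=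
  β x • (E.triv b x).symm w

theorem HilbertGBundle.isSmoothSection_cutoffSection (hE : E.IsSmooth d) {β : X → ℝ}
    (hβ : ContMDiff (𝓡 d) 𝓘(ℝ, ℝ) ∞ β) {b : X} (hs : tsupport β ⊆ E.dom b) (w : F) :
    E.IsSmoothSection d (E.cutoffSection β b w) := by
  intro a x hx
  refine ContMDiffAt.contMDiffWithinAt ?_
  have heq : (fun x => E.triv a x (E.cutoffSection β b w x)) =
      fun x => β x • E.transition b a x w :=
    funext fun x => (E.triv a x).map_real_smul _ _
  rw [heq]
  by_cases hxs : x ∈ tsupport β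
  · have h1 : ContMDiffAt (𝓡 d) 𝓘(ℝ, F →L[ℂ] F) ∞ (E.transition b a) x :=
      (hE.1 b a).contMDiffAt
        (((E.isOpen_dom b).inter (E.isOpen_dom a)).mem_nhds ⟨hs hxs, hx⟩)
    let ev : (F →L[ℂ] F) →L[ℝ] F := (ContinuousLinearMap.apply ℂ F w).restrictScalars ℝ
    have h2 : ContMDiffAt (𝓡 d) 𝓘(ℝ, F) ∞ (fun x => E.transition b a x w) x :=
      (ev.contMDiff.contMDiffAt).comp x h1
    exact (hβ x).smul h2
  · refine (contMDiffAt_const (c := (0 : F))).congr_of_eventuallyEq ?_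
    filter_upwards [notMem_tsupport_iff_eventuallyEq.mp hxs] with y hy
    rw [hy, Pi.zero_apply, zero_smul]

end Sections

end ConnectionForm

section ConnectionForm

open Set Metric HilbertGBundle Filter

/-- The rank one operator `v ↦ θ v • u`, depending linearly on `u`. -/
noncomputable def CStarModule.rankOneCLM {A G : Type*} [CStarAlgebra A] [NormedAddCommGroup G]
    [NormedSpace ℂ G] [Module A G] [CStarModule A G] (θ : G →L[ℂ] A) : G →L[ℝ] G →L[ℂ] G :=
  ((ContinuousLinearMap.compL ℂ G A G).flip θ ∘L smulCLM A G).restrictScalars ℝ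

theorem CStarModule.rankOneCLM_apply {A G : Type*} [CStarAlgebra A] [NormedAddCommGroup G]
    [NormedSpace ℂ G] [Module A G] [CStarModule A G] (θ : G →L[ℂ] A) (u v : G) :
    rankOneCLM θ u v = θ v • u := rfl

variable {d : ℕ} {X : Type*} [MetricSpace X] [ChartedSpace (EuclideanSpace ℝ (Fin d)) X]
  [IsManifold (𝓡 d) ∞ X]
  [RiemannianBundle (fun x : X => TangentSpace (𝓡 d) x)] {a : X} (N : NormalChart d a)
  {Γ : Type*} [Group Γ] [MulAction Γ X]
  {B : Type*} [CStarAlgebra B] {F : Type*} [NormedAddCommGroup F] [NormedSpace ℂ F] [Module B F]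
  [CStarModule B F] {E : HilbertGBundle Γ X B F}

namespace HilbertGBundle.InvariantConnection

variable (C : E.InvariantConnection d)

/-- The covariant derivative of the section `w`, constant in the chart `b` and cut off by `β`, read
in the chart `b` and in the coordinates given by `N`. -/
noncomputable def form (β : X → ℝ) (b : X) (y v : EuclideanSpace ℝ (Fin d)) (w : F) : F :=
  E.triv b (N.ψ y) (C.nabla (E.cutoffSection β b w) (N.ψ y)
    (mfderiv 𝓘(ℝ, EuclideanSpace ℝ (Fin d)) (𝓡 d) N.ψ y v))

theorem form_eq_sum_basis (β : X → ℝ) (b : X) (y v : EuclideanSpace ℝ (Fin d)) (w : F) :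
    C.form N β b y v w = ∑ j, v j • C.form N β b y (EuclideanSpace.basisFun (Fin d) ℝ j) w := by
  let D : EuclideanSpace ℝ (Fin d) →L[ℝ] F := (E.triv b (N.ψ y)).toCLM.restrictScalars ℝ ∘L
    (C.nabla (E.cutoffSection β b w) (N.ψ y) : EuclideanSpace ℝ (Fin d) →L[ℝ] E.fiber (N.ψ y)) ∘L
    (mfderiv 𝓘(ℝ, EuclideanSpace ℝ (Fin d)) (𝓡 d) N.ψ y :
      EuclideanSpace ℝ (Fin d) →L[ℝ] EuclideanSpace ℝ (Fin d))
  change D v = ∑ j, v j • D (EuclideanSpace.basisFun (Fin d) ℝ j)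
  conv_lhs => rw [← (EuclideanSpace.basisFun (Fin d) ℝ).sum_repr v]
  rw [map_sum]
  exact Finset.sum_congr rfl fun j _ => map_smul _ _ _

variable (hE : E.IsSmooth d) {β : X → ℝ} (hβ : ContMDiff (𝓡 d) 𝓘(ℝ, ℝ) ∞ β) {b : X}
  (hs : tsupport β ⊆ E.dom b)
include hE hβ hs

theorem form_add (y v : EuclideanSpace ℝ (Fin d)) (w w' : F) :
    C.form N β b y v (w + w') = C.form N β b y v w + C.form N β b y v w' := by
  have h : E.cutoffSection β b (w + w') =
      fun x => E.cutoffSection β b w x + E.cutoffSection β b w' x := by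
    funext x
    simp only [cutoffSection, HilbertModuleIso.map_add, smul_add]
  rw [form, h, C.add _ _ (E.isSmoothSection_cutoffSection hE hβ hs w)
    (E.isSmoothSection_cutoffSection hE hβ hs w'), HilbertModuleIso.map_add]
  rfl

theorem form_smul (y v : EuclideanSpace ℝ (Fin d)) (c : B) (w : F) :
    C.form N β b y v (c • w) = c • C.form N β b y v w := by
  have h : E.cutoffSection β b (c • w) = fun x => c • E.cutoffSection β b w x := by
    funext x
    simp only [cutoffSection, HilbertModuleIso.map_alg_smul, CStarModule.smul_real_smul]
  rw [form, h, C.smul_alg _ _ (E.isSmoothSection_cutoffSection hE hβ hs w),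
    HilbertModuleIso.map_alg_smul]
  rfl

/-- By `B`-linearity in `w`, the form is determined by its finitely many values on the `e i`. This
reduces norm smoothness of the operator to smoothness of finitely many vector valued functions. -/
theorem form_eq_sum_frame {n : ℕ} {e : Fin n → F} {θ : Fin n → F →L[ℂ] B}
    (hθ : ∀ w, w = ∑ i, θ i w • e i) (y v : EuclideanSpace ℝ (Fin d)) (w : F) :
    C.form N β b y v w = ∑ i, θ i w • C.form N β b y v (e i) := by
  let T : F →ₗ[B] F :=
    { toFun := C.form N β b y v
      map_add' := C.form_add N hE hβ hs y v
      map_smul' := C.form_smul N hE hβ hs y v }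
  change T w = ∑ i, θ i w • T (e i)
  conv_lhs => rw [hθ w]
  simp only [map_sum, map_smul]

/-- Near `y` the cutoff is one, so the form is the covariant derivative of a global smooth section
along a global smooth vector field. -/
theorem contDiffAt_form (hs' : tsupport β ⊆ range N.ψ) {y : EuclideanSpace ℝ (Fin d)}
    (hy : N.ψ y ∈ E.dom b) (hy' : (fun z => β (N.ψ z)) =ᶠ[𝓝 y] 1) (v : EuclideanSpace ℝ (Fin d))
    (w : F) : ContDiffAt ℝ ∞ (fun y => C.form N β b y v w) y := by
  have h1 := C.smooth _ _ (E.isSmoothSection_cutoffSection hE hβ hs w)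
    (N.contMDiff_pushforward hβ hs' v) b
  have h2 := (h1.contMDiffAt ((E.isOpen_dom b).mem_nhds hy)).comp y (N.smooth_ψ y)
  refine h2.contDiffAt.congr_of_eventuallyEq ?_
  filter_upwards [hy'] with z hz
  simp only [Function.comp, form]
  congr 2
  change _ = β (N.ψ z) • (mfderiv 𝓘(ℝ, EuclideanSpace ℝ (Fin d)) (𝓡 d) N.ψ (N.χ (N.ψ z)) v :
        EuclideanSpace ℝ (Fin d))
  rw [hz, N.χ_ψ, Pi.one_apply, one_smul]

omit hE hβ hs in
/-- Near a point, the covariant derivative of the sections which are constant in a chart is given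
by a smooth operator valued one-form. -/
theorem exists_connectionForm (hE : E.IsSmooth d) {n : ℕ} {e : Fin n → F} {θ : Fin n → F →L[ℂ] B}
    (hθ : ∀ w, w = ∑ i, θ i w • e i) {b : X} {p : EuclideanSpace ℝ (Fin d)}
    (hp : N.ψ p ∈ E.dom b) :
    ∃ (s : F → ∀ x, E.fiber x)
      (η : EuclideanSpace ℝ (Fin d) × EuclideanSpace ℝ (Fin d) → F →L[ℂ] F) (r M : ℝ),
      0 < r ∧ 0 ≤ M ∧ (∀ y ∈ ball p r, N.ψ y ∈ E.dom b) ∧ (∀ w, E.IsSmoothSection d (s w)) ∧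
      (∀ w, ∀ y ∈ ball p r, s w (N.ψ y) = (E.triv b (N.ψ y)).symm w) ∧ ContDiff ℝ ∞ η ∧
      (∀ y ∈ ball p r, ∀ v, ‖η (y, v)‖ ≤ M * ‖v‖) ∧
      ∀ y ∈ ball p r, ∀ (v : EuclideanSpace ℝ (Fin d)) (w : F), E.triv b (N.ψ y) (C.nabla (s w) (N.ψ y)
        (mfderiv 𝓘(ℝ, EuclideanSpace ℝ (Fin d)) (𝓡 d) N.ψ y v)) = η (y, v) w := by
  have hbasis : (𝓝 (N.ψ p)).HasBasis (fun _ : SmoothBumpFunction (𝓡 d) (N.ψ p) => True)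
      fun f => tsupport f := SmoothBumpFunction.nhds_basis_tsupport (N.ψ p)
  obtain ⟨β, -, hβs⟩ := hbasis.mem_iff.mp
    (((E.isOpen_dom b).inter N.isOpen_range).mem_nhds ⟨hp, mem_range_self p⟩)
  have hβ : ContMDiff (𝓡 d) 𝓘(ℝ, ℝ) ∞ β := β.contMDiff
  have hs : tsupport β ⊆ E.dom b := hβs.trans inter_subset_left
  have hs' : tsupport β ⊆ range N.ψ := hβs.trans inter_subset_right
  have hcont : ContinuousAt N.ψ p := N.smooth_ψ.continuous.continuousAt
  have hev : ∀ᶠ y in 𝓝 p, N.ψ y ∈ E.dom b ∧ (fun z => β (N.ψ z)) =ᶠ[𝓝 y] 1 :=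
    (hcont.eventually ((E.isOpen_dom b).mem_nhds hp)).and
      (hcont.eventually β.eventuallyEq_one).eventually_nhds
  obtain ⟨r₀, hr₀, hball⟩ := Metric.eventually_nhds_iff_ball.mp hev
  -- A second cutoff, in coordinates: it makes `η` smooth on the whole space, as `contDiffAt_of_ray`
  -- asks, without changing the form on the ball of radius `r₀ / 4`.
  let g : ContDiffBump p := ⟨r₀ / 4, r₀ / 2, by positivity, by linarith⟩
  let u : Fin n → Fin d → EuclideanSpace ℝ (Fin d) → F := fun i j y =>
    g y • C.form N β b y (EuclideanSpace.basisFun (Fin d) ℝ j) (e i)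
  have hu : ∀ i j, ContDiff ℝ ∞ (u i j) := fun i j => by
    rw [contDiff_iff_contDiffAt]
    intro y
    by_cases hy : y ∈ tsupport g
    · have hy' : y ∈ ball p r₀ := by
        rw [g.tsupport_eq] at hy
        exact closedBall_subset_ball (by change r₀ / 2 < r₀; linarith) hy
      exact g.contDiff.contDiffAt.smul
        (C.contDiffAt_form N hE hβ hs hs' (hball y hy').1 (hball y hy').2 _ _)
    · refine (contDiffAt_const (c := (0 : F))).congr_of_eventuallyEq ?_
      filter_upwards [notMem_tsupport_iff_eventuallyEq.mp hy] with z hz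
      simp only [u, hz, Pi.zero_apply, zero_smul]
  let η : EuclideanSpace ℝ (Fin d) × EuclideanSpace ℝ (Fin d) → F →L[ℂ] F := fun z =>
    ∑ i, ∑ j, CStarModule.rankOneCLM (θ i) (z.2 j • u i j z.1)
  have hη : ContDiff ℝ ∞ η := by
    refine ContDiff.sum fun i _ => ContDiff.sum fun j _ =>
      (CStarModule.rankOneCLM (θ i)).contDiff.comp ?_
    have hj : ContDiff ℝ ∞ fun z : EuclideanSpace ℝ (Fin d) × EuclideanSpace ℝ (Fin d) => z.2 j :=
      (EuclideanSpace.proj j : EuclideanSpace ℝ (Fin d) →L[ℝ] ℝ).contDiff.comp contDiff_snd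
    exact hj.smul ((hu i j).comp contDiff_fst)
  have hbd : ∀ᶠ y in 𝓝 p, ∀ i j, ‖u i j y‖ < ‖u i j p‖ + 1 := by
    simp only [eventually_all]
    exact fun i j => (hu i j).continuous.norm.continuousAt.eventually_lt_const (by simp)
  obtain ⟨r₁, hr₁, hball₁⟩ := Metric.eventually_nhds_iff_ball.mp hbd
  refine ⟨E.cutoffSection β b, η, min (r₀ / 4) r₁,
    ∑ i, ∑ j, ‖CStarModule.rankOneCLM (θ i)‖ * (‖u i j p‖ + 1), by positivity, by positivity,
    fun y hy => (hball y (ball_subset_ball ((min_le_left _ _).trans (by linarith)) hy)).1,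
    E.isSmoothSection_cutoffSection hE hβ hs, fun w y hy => ?_, hη, fun y hy v => ?_,
    fun y hy v w => ?_⟩
  · have h1 := (hball y (ball_subset_ball ((min_le_left _ _).trans (by linarith)) hy)).2.eq_of_nhds
    simp only [Pi.one_apply] at h1
    rw [cutoffSection, h1, one_smul]
  · rw [Finset.sum_mul]
    refine norm_sum_le_of_le _ fun i _ => ?_
    rw [Finset.sum_mul]
    refine norm_sum_le_of_le _ fun j _ => ?_
    refine ((CStarModule.rankOneCLM (θ i)).le_opNorm _).trans ?_
    rw [mul_assoc, norm_smul, mul_comm (‖u i j p‖ + 1)]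
    have := (hball₁ y (ball_subset_ball (min_le_right _ _) hy) i j).le
    gcongr
    exact PiLp.norm_apply_le v j
  · have h1 : g y = 1 := g.one_of_mem_closedBall
      (ball_subset_closedBall (ball_subset_ball (min_le_left _ _) hy))
    change C.form N β b y v w = _
    rw [C.form_eq_sum_frame N hE hβ hs hθ]
    simp only [η, sum_apply, CStarModule.rankOneCLM_apply, u, h1, one_smul]
    refine Finset.sum_congr rfl fun i _ => ?_
    rw [C.form_eq_sum_basis N β b y v (e i), Finset.smul_sum]

end HilbertGBundle.InvariantConnection

end ConnectionForm

/-! ### Smoothness of the radial trivialization -/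

section Smoothness

open Set Metric HilbertGBundle Filter

/-- The identity `S⁻¹ - T⁻¹ = S⁻¹ (T - S) T⁻¹` with unitary `S` and `T`. -/
theorem HilbertModuleIso.norm_invCLM_sub_le {B : Type*} [CStarAlgebra B] {E F : Type*}
    [NormedAddCommGroup E] [NormedSpace ℂ E] [Module B E] [CStarModule B E]
    [NormedAddCommGroup F] [NormedSpace ℂ F] [Module B F] [CStarModule B F]
    (S T : HilbertModuleIso B E F) : ‖S.invCLM - T.invCLM‖ ≤ ‖S.toCLM - T.toCLM‖ := by
  refine ContinuousLinearMap.opNorm_le_bound _ (norm_nonneg _) fun u => ?_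
  have h1 : (S.invCLM - T.invCLM) u = S.symm (T (T.symm u) - S (T.symm u)) := by
    rw [map_sub, symm_apply_apply, apply_symm_apply]
    rfl
  rw [h1, norm_map, norm_sub_rev]
  have h2 := (S.toCLM - T.toCLM).le_opNorm (T.symm u)
  rwa [norm_map] at h2

variable {d : ℕ} {X : Type*} [MetricSpace X] [ChartedSpace (EuclideanSpace ℝ (Fin d)) X]
  [RiemannianBundle (fun x : X => TangentSpace (𝓡 d) x)] {a : X} (N : NormalChart d a)
  {Γ : Type*} [Group Γ] [MulAction Γ X]
  {B : Type*} [CStarAlgebra B] {F : Type*} [NormedAddCommGroup F] [NormedSpace ℂ F] [Module B F]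
  [CStarModule B F] {E : HilbertGBundle Γ X B F} (Φ : E.ParallelTransport d)

namespace NormalChart

/-- The transition from the radial trivialization to the chart `b` of the bundle, as a unitary
operator depending on the coordinates of a point. -/
noncomputable def comparison (b : X) (z : EuclideanSpace ℝ (Fin d)) : HilbertModuleIso B F F :=
  (N.frame Φ (rfl : N.ψ z = N.ψ z)).symm.trans (E.triv b (N.ψ z))

theorem comparison_eq (b : X) {z : EuclideanSpace ℝ (Fin d)} {x : X} (h : N.ψ z = x) :
    (N.comparison Φ b z).toCLM = (E.triv b x).toCLM ∘L (N.frame Φ h).invCLM := by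
  subst h
  rfl

theorem continuousOn_comparison (b : X) :
    ContinuousOn (fun z => (N.comparison Φ b z).invCLM) (N.ψ ⁻¹' E.dom b) := by
  have hh : ContMDiff 𝓘(ℝ, EuclideanSpace ℝ (Fin d) × ℝ) (𝓡 d) ∞
      (fun z : EuclideanSpace ℝ (Fin d) × ℝ => N.ψ (z.2 • z.1)) := by
    have : ContDiff ℝ ∞ fun z : EuclideanSpace ℝ (Fin d) × ℝ => z.2 • z.1 := by fun_prop
    exact N.smooth_ψ.comp this.contMDiff
  have h := Φ.continuous d _ hh (fun u => N.smooth_ψ_comp (by fun_prop)) a b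
  have h1 : ContinuousOn (fun z => (N.comparison Φ b z).toCLM) (N.ψ ⁻¹' E.dom b) := by
    refine (h.mono fun z hz => ?_).congr fun z _ => ?_
    · simp only [mem_ofPred_eq, zero_smul, N.ψ_zero, one_smul]
      exact ⟨E.mem_dom a, hz⟩
    · exact Φ.charts_congr (x' := N.ψ ((0 : ℝ) • z)) (y' := N.ψ ((1 : ℝ) • z))
        (by rw [zero_smul, N.ψ_zero]) (by rw [one_smul]) (N.radial rfl)
        (PSPath.ofSmooth (fun t => N.ψ (t • z)) (N.smooth_ψ_comp (by fun_prop)) rfl rfl)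
        (fun t => rfl) a b
  intro z hz
  have h2 := tendsto_iff_norm_sub_tendsto_zero.mp (h1 z hz)
  exact tendsto_iff_norm_sub_tendsto_zero.mpr
    (squeeze_zero (fun _ => norm_nonneg _)
      (fun y => HilbertModuleIso.norm_invCLM_sub_le _ _) h2)

variable [IsManifold (𝓡 d) ∞ X] {Φ} {ε : ℝ} (hΦ : Φ.IsCloseToId ε)
  {C : E.InvariantConnection d} (hC : Φ.ComesFrom C)
include hΦ hC

/-- The differential equation along rays for the transition to the radial trivialization. -/
theorem hasDerivAt_comparison {b : X} {w : F} {s : ∀ x, E.fiber x} (hs : E.IsSmoothSection d s)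
    {O : Set (EuclideanSpace ℝ (Fin d))} (hO : IsOpen O)
    (hsO : ∀ y ∈ O, s (N.ψ y) = (E.triv b (N.ψ y)).symm w) {z : EuclideanSpace ℝ (Fin d)} {t : ℝ}
    (ht : t • z ∈ O) :
    HasDerivAt (fun t : ℝ => (N.comparison Φ b (t • z)).symm w)
      ((N.comparison Φ b (t • z)).symm (E.triv b (N.ψ (t • z)) (C.nabla s (N.ψ (t • z))
        (mfderiv 𝓘(ℝ, EuclideanSpace ℝ (Fin d)) (𝓡 d) N.ψ (t • z) z)))) t := by
  let c : ℝ → X := fun r => N.ψ ((t + r) • z)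
  have hc : ContMDiff 𝓘(ℝ, ℝ) (𝓡 d) ∞ c := N.smooth_ψ_comp (by fun_prop)
  have h1 := hC c hc (fun r => N.smooth_ψ_comp (by fun_prop)) s hs
  have hc0 : mfderiv 𝓘(ℝ, ℝ) (𝓡 d) c 0 (1 : ℝ) =
      mfderiv 𝓘(ℝ, EuclideanSpace ℝ (Fin d)) (𝓡 d) N.ψ ((t + 0) • z) z := by
    have hder : HasDerivAt (fun r : ℝ => (t + r) • z) z 0 := by
      simpa using ((hasDerivAt_id (0 : ℝ)).const_add t).smul_const z
    refine (mfderiv_param_comp N.smooth_ψ hder.differentiableAt 1).trans ?_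
    rw [fderiv_apply_one_eq_deriv, hder.deriv]
  rw [hc0] at h1
  let fr : E.fiber (c 0) →L[ℝ] F :=
    (N.frame Φ (rfl : N.ψ ((t + 0) • z) = c 0)).toCLM.restrictScalars ℝ
  have h2 := fr.hasFDerivAt.comp_hasDerivAt (0 : ℝ) h1
  have h3 : HasDerivAt (fun r : ℝ => (N.comparison Φ b ((t + r) • z)).symm w)
      (N.frame Φ (rfl : N.ψ ((t + 0) • z) = c 0) (C.nabla s (N.ψ ((t + 0) • z))
        (mfderiv 𝓘(ℝ, EuclideanSpace ℝ (Fin d)) (𝓡 d) N.ψ ((t + 0) • z) z))) 0 := by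
    refine h2.congr_of_eventuallyEq ?_
    have hcont : ContinuousAt (fun r : ℝ => (t + r) • z) 0 := by fun_prop
    have hmem : ∀ᶠ r : ℝ in 𝓝 0, (t + r) • z ∈ O :=
      hcont.eventually (hO.mem_nhds (by simpa using ht))
    filter_upwards [hmem] with r hr
    change N.frame Φ rfl ((E.triv b (N.ψ ((t + r) • z))).symm w) =
      N.frame Φ (rfl : N.ψ ((t + 0) • z) = c 0) ((Φ.map _).symm (s (N.ψ ((t + r) • z))))
    rw [hsO _ hr]
    set v := (E.triv b (N.ψ ((t + r) • z))).symm w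
    set p : PSPath d (c 0) (c r) := PSPath.ofSmooth (fun q : ℝ => c (q * r)) _ _ _ with hp
    -- The radial frame is parallel along the ray, so reading `v` in the frame at `c r` agrees with
    -- transporting it back to `c 0` and reading it there. This identifies the function with the one
    -- that `ComesFrom` differentiates.
    have h4 := N.frame_map_of_radial hΦ (α := t + 0) (β := r) (z := z) (x := c 0) (y := c r) rfl
      (by simp only [c, add_zero]) p (fun q => by simp only [add_zero]; rfl)
      (N.frame Φ (rfl : N.ψ ((t + 0) • z) = c 0) ((Φ.map p).symm v))
    rw [HilbertModuleIso.symm_apply_apply, HilbertModuleIso.apply_symm_apply] at h4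
    refine Eq.trans ?_ h4
    have e1 : ∀ (z₁ z₂ : EuclideanSpace ℝ (Fin d)) (h₁ : N.ψ z₁ = c r) (h₂ : N.ψ z₂ = c r),
        z₁ = z₂ → N.frame Φ h₁ = N.frame Φ h₂ := by rintro _ _ _ _ rfl; rfl
    rw [e1 ((t + 0 + r) • z) ((t + r) • z) _ rfl (by rw [add_zero])]
  have h5 : ∀ y, N.frame Φ (rfl : N.ψ y = N.ψ y) (C.nabla s (N.ψ y)
      (mfderiv 𝓘(ℝ, EuclideanSpace ℝ (Fin d)) (𝓡 d) N.ψ y z)) =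
      (N.comparison Φ b y).symm (E.triv b (N.ψ y) (C.nabla s (N.ψ y)
        (mfderiv 𝓘(ℝ, EuclideanSpace ℝ (Fin d)) (𝓡 d) N.ψ y z))) := fun y =>
    congrArg (N.frame Φ rfl) (HilbertModuleIso.symm_apply_apply _ _).symm
  have h6 := h3.congr_deriv (h5 _)
  rw [add_zero] at h6
  have h7 := HasDerivAt.comp_sub_const (x := t) (a := t)
    (f := fun r : ℝ => (N.comparison Φ b ((t + r) • z)).symm w) (by rwa [sub_self])
  simpa using h7

end NormalChart

end Smoothness

section Smoothness

open Set Metric HilbertGBundle Filter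

variable {d : ℕ} {X : Type*} [MetricSpace X] [ChartedSpace (EuclideanSpace ℝ (Fin d)) X]
  [RiemannianBundle (fun x : X => TangentSpace (𝓡 d) x)] {a : X} (N : NormalChart d a)
  {Γ : Type*} [Group Γ] [MulAction Γ X]
  {B : Type*} [CStarAlgebra B] {F : Type*} [NormedAddCommGroup F] [NormedSpace ℂ F] [Module B F]
  [CStarModule B F] {E : HilbertGBundle Γ X B F} (Φ : E.ParallelTransport d)

namespace NormalChart

theorem contDiffAt_comparison_congr (hE : E.IsSmooth d) {b b' : X} {z : EuclideanSpace ℝ (Fin d)}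
    (hb : N.ψ z ∈ E.dom b) (hb' : N.ψ z ∈ E.dom b')
    (h : ContDiffAt ℝ ∞ (fun z => (N.comparison Φ b z).invCLM) z) :
    ContDiffAt ℝ ∞ (fun z => (N.comparison Φ b' z).invCLM) z := by
  have h1 : ContMDiffAt (𝓡 d) 𝓘(ℝ, F →L[ℂ] F) ∞ (E.transition b' b) (N.ψ z) :=
    (hE.1 b' b).contMDiffAt
      (((E.isOpen_dom b').inter (E.isOpen_dom b)).mem_nhds ⟨hb', hb⟩)
  have h2 : ContDiffAt ℝ ∞ (fun z => E.transition b' b (N.ψ z)) z :=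
    (h1.comp z (N.smooth_ψ z)).contDiffAt
  have h3 := h.mul h2
  refine h3.congr_of_eventuallyEq (Eventually.of_forall fun y => ?_)
  ext w
  change N.frame Φ rfl ((E.triv b' (N.ψ y)).symm w) =
    N.frame Φ rfl ((E.triv b (N.ψ y)).symm (E.triv b (N.ψ y) ((E.triv b' (N.ψ y)).symm w)))
  rw [HilbertModuleIso.symm_apply_apply]

variable [IsManifold (𝓡 d) ∞ X] [CompleteSpace F] {Φ} {ε : ℝ} (hΦ : Φ.IsCloseToId ε)
  {C : E.InvariantConnection d} (hC : Φ.ComesFrom C) (hE : E.IsSmooth d)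
  {n : ℕ} {e : Fin n → F} {θ : Fin n → F →L[ℂ] B} (hθ : ∀ w, w = ∑ i, θ i w • e i)
include hΦ hC hE hθ

/-- The comparison solves the radial equation with the local connection form. The radius is at most
`1 / (2 M + 1) / 2`, so that the smallness condition `2 ρ M < 1` of `contDiffAt_of_ray` holds. -/
theorem exists_ball_contDiffAt_comparison {b : X} {p : EuclideanSpace ℝ (Fin d)}
    (hp : N.ψ p ∈ E.dom b) : ∃ ρ : ℝ, 0 < ρ ∧ (∀ y ∈ ball p ρ, N.ψ y ∈ E.dom b) ∧
      ∀ (z : EuclideanSpace ℝ (Fin d)) (l : ℝ), z ∈ ball p ρ → l • z ∈ ball p ρ →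
        ContDiffAt ℝ ∞ (fun u => (N.comparison Φ b (l • u)).invCLM) z →
        ContDiffAt ℝ ∞ (fun u => (N.comparison Φ b u).invCLM) z := by
  obtain ⟨s, η, r, M, hr, hM, hdom, hs, hs', hη, hηM, heq⟩ :=
    C.exists_connectionForm N hE hθ hp
  have hρr : min r (1 / (2 * M + 1) / 2) ≤ r := min_le_left _ _
  have hsub := ball_subset_ball (x := p) hρr
  refine ⟨min r (1 / (2 * M + 1) / 2), by positivity, fun y hy => hdom y (hsub hy),
    fun z l hz hlz h => ?_⟩
  refine contDiffAt_of_ray hη hM ?_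
    ((N.continuousOn_comparison Φ b).mono fun y hy => hdom y (hsub hy)) (fun z t ht w => ?_)
    (fun y hy v => hηM y (hsub hy) v) hz hlz h
  · have h1 : min r (1 / (2 * M + 1) / 2) ≤ 1 / (2 * M + 1) / 2 := min_le_right _ _
    have h2 : 1 / (2 * M + 1) * (2 * M + 1) = 1 := by field_simp
    have h3 : 0 < 1 / (2 * M + 1) := by positivity
    nlinarith
  · have h1 := N.hasDerivAt_comparison hΦ hC (hs w) isOpen_ball (hs' w) (hsub ht)
    rw [heq _ (hsub ht)] at h1
    exact h1

/-- The ray from `0` to `z` is subdivided so that each piece lies in a ball of the preceding lemma.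
Smoothness passes from one end of a piece to the other, with a change of bundle chart between
pieces. -/
theorem contDiffAt_comparison_symm {b : X} {z : EuclideanSpace ℝ (Fin d)}
    (hz : N.ψ z ∈ E.dom b) : ContDiffAt ℝ ∞ (fun u => (N.comparison Φ b u).invCLM) z := by
  choose ρ hρ hdom hstep using fun p => N.exists_ball_contDiffAt_comparison hΦ hC hE hθ
    (E.mem_dom (N.ψ p))
  have key : ∃ b, N.ψ (((1 : I) : ℝ) • z) ∈ E.dom b ∧
      ContDiffAt ℝ ∞ (fun u => (N.comparison Φ b u).invCLM) (((1 : I) : ℝ) • z) := by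
    have hcont : Continuous fun t : I => (t : ℝ) • z := by fun_prop
    obtain ⟨t, ht0, hmono, ⟨m, hm⟩, hcov⟩ := exists_monotone_Icc_subset_open_cover_unitInterval
      (c := fun τ : EuclideanSpace ℝ (Fin d) => (fun t : I => (t : ℝ) • z) ⁻¹' ball τ (ρ τ))
      (fun τ => isOpen_ball.preimage hcont)
      (fun t _ => mem_iUnion.mpr ⟨(t : ℝ) • z, mem_ball_self (hρ _)⟩)
    have hstep' : ∀ (τ : EuclideanSpace ℝ (Fin d)) (s t : I), s ≤ t → (s : ℝ) • z ∈ ball τ (ρ τ) →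
        (t : ℝ) • z ∈ ball τ (ρ τ) →
        (∃ b, N.ψ ((s : ℝ) • z) ∈ E.dom b ∧
          ContDiffAt ℝ ∞ (fun u => (N.comparison Φ b u).invCLM) ((s : ℝ) • z)) →
        ∃ b, N.ψ ((t : ℝ) • z) ∈ E.dom b ∧
          ContDiffAt ℝ ∞ (fun u => (N.comparison Φ b u).invCLM) ((t : ℝ) • z) := by
      rintro τ s t hst hs ht ⟨b, hb, h⟩
      -- If `t = 0` then `s = t`; otherwise the step inwards is scaling by `l = s / t`.
      rcases t.2.1.eq_or_lt with h0 | h0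
      · have : s = t := le_antisymm hst (by rw [← Subtype.coe_le_coe, ← h0]; exact s.2.1)
        rw [← this]
        exact ⟨b, hb, h⟩
      · have h1 : ((s : ℝ) / t) • ((t : ℝ) • z) = (s : ℝ) • z := by
          rw [smul_smul, div_mul_cancel₀ _ h0.ne']
        refine ⟨N.ψ τ, hdom τ _ ht, hstep τ _ (s / t) ht (by rwa [h1]) ?_⟩
        have h2 := N.contDiffAt_comparison_congr Φ hE hb (hdom τ _ hs) h
        rw [← h1] at h2
        exact h2.comp _ (contDiff_const_smul _).contDiffAt
    have hall : ∀ k, ∃ b, N.ψ ((t k : ℝ) • z) ∈ E.dom b ∧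
        ContDiffAt ℝ ∞ (fun u => (N.comparison Φ b u).invCLM) ((t k : ℝ) • z) := by
      intro k
      induction k with
      | zero =>
        rw [ht0, Set.Icc.coe_zero, zero_smul]
        refine ⟨N.ψ 0, E.mem_dom _, hstep 0 0 0 (mem_ball_self (hρ 0))
          (by rw [zero_smul]; exact mem_ball_self (hρ 0)) ?_⟩
        -- At the centre `l = 0` is allowed: the function to be known smooth is then `u ↦ H (0 •
        -- u)`, a constant.
        simp only [zero_smul]
        exact contDiffAt_const
      | succ k ih =>
        obtain ⟨τ, hτ⟩ := hcov k
        have hk := hmono (Nat.le_succ k)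
        exact hstep' τ _ _ hk (hτ ⟨le_rfl, hk⟩) (hτ ⟨hk, le_rfl⟩) ih
    rw [← hm m le_rfl]
    exact hall m
  obtain ⟨b', hb', h⟩ := key
  rw [Set.Icc.coe_one, one_smul] at hb' h
  exact N.contDiffAt_comparison_congr Φ hE hb' hz h

/-- The transition from the radial trivialization to the charts of the bundle is smooth if the
parallel transport comes from a connection. -/
theorem contDiffAt_comparison {b : X} {z : EuclideanSpace ℝ (Fin d)}
    (hz : N.ψ z ∈ E.dom b) : ContDiffAt ℝ ∞ (fun u => (N.comparison Φ b u).toCLM) z := by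
  have h1 := N.contDiffAt_comparison_symm hΦ hC hE hθ hz
  let U : EuclideanSpace ℝ (Fin d) → (F →L[ℂ] F)ˣ := fun u =>
    ⟨(N.comparison Φ b u).invCLM, (N.comparison Φ b u).toCLM,
      by ext w; exact (N.comparison Φ b u).symm_apply_apply w,
      by ext w; exact (N.comparison Φ b u).apply_symm_apply w⟩
  have h2 := ContDiffAt.comp (g := Ring.inverse) z (contDiffAt_ringInverse ℝ (U z)) h1
  refine h2.congr_of_eventuallyEq (Eventually.of_forall fun u => ?_)
  exact (Ring.inverse_unit (U u)).symm

end NormalChart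

end Smoothness

/-! ### Smoothness of the component isomorphisms -/

namespace HilbertGBundle

open Set Metric

section Product

variable {d : ℕ} {X : Type*} [MetricSpace X] [ChartedSpace (EuclideanSpace ℝ (Fin d)) X]
  [RiemannianBundle (fun x : X => TangentSpace (𝓡 d) x)] [IsManifold (𝓡 d) ∞ X]
  {Γ : Type*} [Group Γ] [MulAction Γ X] [IsIsometricSMul Γ X]
  {B : ℕ → Type*} [∀ k, CStarAlgebra (B k)] [∀ k, Nontrivial (B k)]
  {F : ℕ → Type*} [∀ k, NormedAddCommGroup (F k)] [∀ k, NormedSpace ℂ (F k)]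
  [∀ k, Module (B k) (F k)] [∀ k, CStarModule (B k) (F k)] [∀ k, CompleteSpace (F k)]
  {E : ∀ k, HilbertGBundle Γ X (B k) (F k)}
  (hΓ : ∀ γ : Γ, ContMDiff (𝓡 d) (𝓡 d) ∞ (fun x : X => γ • x))
  {Φ : ∀ k, (E k).ParallelTransport d} (hΦ : ∀ k, (Φ k).IsEquivariant)
  {ε : ℝ} (hε : ∀ k, (Φ k).IsCloseToId ε) (N : ∀ a : X, NormalChart d a)

/-- In the charts the isomorphism is the coordinate projection followed by the comparison operator
at `χ x`; the generators serve to supply the dual basis. -/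
theorem productBundleComponent_isSmooth {k n : ℕ} {g : Fin n → F k}
    (hg : Submodule.span (B k) (Set.range g) = ⊤) (hE : (E k).IsSmooth d)
    {C : (E k).InvariantConnection d} (hC : (Φ k).ComesFrom C) :
    (productBundleComponent hΓ hΦ hε N k).IsSmooth d := by
  obtain ⟨e, -, he⟩ := CStarModule.exists_bounded_generators hg
  obtain ⟨θ, hθ⟩ := CStarModule.exists_dual_frame he
  intro a b x hx
  refine ContMDiffAt.contMDiffWithinAt ?_
  have hball : ball a ((N a).ρ / 20) ⊆ ball a (N a).ρ :=
    ball_subset_ball (by linarith [(N a).ρ_pos])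
  have hψχ := (N a).ψ_χ (hball hx.1)
  have h1 := (N a).contDiffAt_comparison (hε k) hC hE hθ (b := b) (z := (N a).χ x)
    (by rw [hψχ]; exact hx.2)
  have hχ : ContMDiffAt (𝓡 d) 𝓘(ℝ, EuclideanSpace ℝ (Fin d)) ∞ (N a).χ x :=
    (N a).smooth_χ.contMDiffAt
      ((N a).isOpen_range.mem_nhds ((N a).ball_subset_range (hball hx.1)))
  let p : lp F ∞ →L[ℂ] F k := LinearMap.mkContinuous
    { toFun := fun v : lp F ∞ => v k
      map_add' := fun _ _ => rfl
      map_smul' := fun _ _ => rfl } 1 fun v => by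
        rw [one_mul]; exact lp.norm_apply_le_norm (by simp) v k
  let R : (F k →L[ℂ] F k) →L[ℝ] (lp F ∞ →L[ℂ] F k) :=
    ((ContinuousLinearMap.compL ℂ (lp F ∞) (F k) (F k)).flip p).restrictScalars ℝ
  have h2 := (R.contDiff.contDiffAt.comp _ h1).contMDiffAt.comp x hχ
  refine h2.congr_of_eventuallyEq ?_
  filter_upwards [isOpen_ball.mem_nhds hx.1] with y hy
  have hy' := (N a).ψ_χ (hball hy)
  ext v
  change (E k).triv b y (((N a).chart (Φ k) y).symm (v k)) =
    ((N a).comparison (Φ k) b ((N a).χ y)).toCLM (v k)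
  rw [(N a).comparison_eq (Φ k) b hy', (N a).chart_eq (Φ k) hy']
  rfl

end Product

end HilbertGBundle

/-! ### Bounds on covariant derivatives -/

section InducedConnection

open Set Metric HilbertGBundle Filter

namespace NormalChart

variable {d : ℕ} {X : Type*} [MetricSpace X] [ChartedSpace (EuclideanSpace ℝ (Fin d)) X]
  [RiemannianBundle (fun x : X => TangentSpace (𝓡 d) x)] {a : X} (N : NormalChart d a)

/-- Every tangent vector at a point near the centre of a chart is the velocity of a smooth curve
in the chart, defined on the whole real line, which is Lipschitz with a constant proportional to
the length of the vector. -/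
theorem exists_curve_of_tangent {x : X} (hx : x ∈ ball a N.ρ) (v : TangentSpace (𝓡 d) x) :
    ∃ c : ℝ → X, ContMDiff 𝓘(ℝ, ℝ) (𝓡 d) ∞ c ∧ c 0 = x ∧
      (mfderiv 𝓘(ℝ, ℝ) (𝓡 d) c 0 (1 : ℝ) : EuclideanSpace ℝ (Fin d)) = v ∧
      (∀ t, c t ∈ ball a N.ρ) ∧ ∀ s t, dist (c s) (c t) ≤ 4 * ‖v‖ * |s - t| := by
  obtain ⟨z, hz, rfl⟩ := N.ball_subset hx
  obtain ⟨u, hu'⟩ : ∃ u : EuclideanSpace ℝ (Fin d),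
      mfderiv 𝓘(ℝ, EuclideanSpace ℝ (Fin d)) (𝓡 d) N.ψ z u = v := by
    let D : EuclideanSpace ℝ (Fin d) →L[ℝ] EuclideanSpace ℝ (Fin d) :=
      mfderiv 𝓘(ℝ, EuclideanSpace ℝ (Fin d)) (𝓡 d) N.ψ z
    exact (LinearMap.injective_iff_surjective (f := D.toLinearMap)).mp
      (injective_mfderiv_of_leftInverse N.smooth_ψ N.χ_ψ N.isOpen_range N.smooth_χ z) v
  have hnorm : ‖u‖ ≤ 2 * ‖v‖ := by
    rw [← hu']
    exact N.le_norm_mfderiv z hz u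
  have hnear : ∀ᶠ y in 𝓝 z, N.ψ y ∈ ball a N.ρ ∧ y ∈ ball (0 : EuclideanSpace ℝ (Fin d)) N.r :=
    (N.smooth_ψ.continuous.continuousAt.eventually (isOpen_ball.mem_nhds hx)).and
      (isOpen_ball.mem_nhds hz)
  obtain ⟨δ', hδ', hball⟩ := Metric.eventually_nhds_iff_ball.mp hnear
  let δ : ℝ := δ' / (‖u‖ + 1)
  have hδ : 0 < δ := by positivity
  -- The sine keeps the curve within `δ * ‖u‖ < δ'` of `z` for all times, while its velocity at `0`
  -- is `u` and its Lipschitz constant `‖u‖` is not affected by `δ`.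
  let w : ℝ → EuclideanSpace ℝ (Fin d) := fun t => z + (δ * Real.sin (t / δ)) • u
  have hw : ContDiff ℝ ∞ w := by fun_prop
  have hwb : ∀ t, w t ∈ ball z δ' := fun t => by
    rw [mem_ball, dist_eq_norm, add_sub_cancel_left, norm_smul, norm_mul, Real.norm_eq_abs,
      Real.norm_eq_abs, abs_of_pos hδ]
    have h1 := Real.abs_sin_le_one (t / δ)
    have h2 : δ * (‖u‖ + 1) = δ' := div_mul_cancel₀ _ (by positivity)
    calc δ * |Real.sin (t / δ)| * ‖u‖ ≤ δ * 1 * ‖u‖ := by gcongr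
      _ < δ' := by rw [← h2]; linarith
  have hlip : ∀ s t, ‖w s - w t‖ ≤ |s - t| * ‖u‖ := fun s t => by
    have h1 : w s - w t = (δ * (Real.sin (s / δ) - Real.sin (t / δ))) • u := by
      simp only [w]
      module
    rw [h1, norm_smul, norm_mul, Real.norm_eq_abs, Real.norm_eq_abs, abs_of_pos hδ]
    have h2 := Real.abs_sin_sub_sin_le (s / δ) (t / δ)
    rw [← sub_div, abs_div, abs_of_pos hδ] at h2
    gcongr
    calc δ * |Real.sin (s / δ) - Real.sin (t / δ)| ≤ δ * (|s - t| / δ) := by gcongr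
      _ = |s - t| := mul_div_cancel₀ _ hδ.ne'
  have hw0 : w 0 = z := by simp [w]
  have hder : HasDerivAt w u 0 := by
    have h1 : HasDerivAt (fun t : ℝ => δ * Real.sin (t / δ)) 1 0 := by
      have h2 := (((hasDerivAt_id (0 : ℝ)).div_const δ).sin).const_mul δ
      simpa [hδ.ne'] using h2
    exact ((h1.smul_const u).const_add z).congr_deriv (one_smul ℝ u)
  refine ⟨fun t => N.ψ (w t), N.smooth_ψ_comp hw, congrArg N.ψ hw0, ?_,
    fun t => (hball _ (hwb t)).1, fun s t => ?_⟩
  · have h1 := mfderiv_param_comp N.smooth_ψ hder.differentiableAt 1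
    rw [fderiv_apply_one_eq_deriv, hder.deriv] at h1
    have h2 : ∀ y, y = z → (mfderiv 𝓘(ℝ, EuclideanSpace ℝ (Fin d)) (𝓡 d) N.ψ y u :
        EuclideanSpace ℝ (Fin d)) = mfderiv 𝓘(ℝ, EuclideanSpace ℝ (Fin d)) (𝓡 d) N.ψ z u := by
      rintro _ rfl
      rfl
    exact (h1.trans (h2 _ hw0)).trans hu'
  · refine (N.dist_ψ_le _ (hball _ (hwb s)).2 _ (hball _ (hwb t)).2).trans ?_
    rw [dist_eq_norm]
    calc 2 * ‖w s - w t‖ ≤ 2 * (|s - t| * (2 * ‖v‖)) := by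
          gcongr
          exact (hlip s t).trans (by gcongr)
      _ = _ := by ring

variable [IsManifold (𝓡 d) ∞ X] {Γ : Type*} [Group Γ] [MulAction Γ X]
  {B : Type*} [CStarAlgebra B] {F : Type*} [NormedAddCommGroup F] [NormedSpace ℂ F] [Module B F]
  [CStarModule B F] {E : HilbertGBundle Γ X B F} {Φ : E.ParallelTransport d}
  {ε : ℝ} (hΦ : Φ.IsCloseToId ε) {C : E.InvariantConnection d} (hC : Φ.ComesFrom C)
include hΦ hC

/-- The covariant derivative is the derivative of the section transported back along `c`. At time
`t` this has moved by at most `K L |t|`, from the section in the radial trivialization, plus `8 |ε|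
L |t| ‖s (c 0)‖`, from the transport. -/
theorem norm_nabla_velocity_le {s : ∀ x, E.fiber x} (hs : E.IsSmoothSection d s) {c : ℝ → X}
    (hc : ContMDiff 𝓘(ℝ, ℝ) (𝓡 d) ∞ c) (hball : ∀ t, c t ∈ ball a N.ρ) {L : ℝ} (hL0 : 0 ≤ L)
    (hL : ∀ s t, dist (c s) (c t) ≤ L * |s - t|) {K : ℝ≥0} {U : Set X} (hU : U ∈ 𝓝 (c 0))
    (hK : LipschitzOnWith K (fun y => N.chart Φ y (s y)) U) :
    ‖C.nabla s (c 0) (mfderiv 𝓘(ℝ, ℝ) (𝓡 d) c 0 (1 : ℝ))‖ ≤ (K + 8 * |ε| * ‖s (c 0)‖) * L := by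
  have hct : ∀ t : ℝ, ContMDiff 𝓘(ℝ, ℝ) (𝓡 d) ∞ fun r : ℝ => c (r * t) := fun t => by
    have : ContDiff ℝ ∞ fun r : ℝ => r * t := by fun_prop
    exact hc.comp this.contMDiff
  refine (hC c hc hct s hs).le_of_lip' (by positivity) ?_
  filter_upwards [hc.continuous.continuousAt.eventually hU] with t ht
  have h0 : (Φ.map (PSPath.ofSmooth (x := c 0) (y := c 0) (fun r : ℝ => c (r * 0)) (hct 0)
      (by simp) (by simp))).symm (s (c 0)) = s (c 0) := by
    set p : PSPath d (c 0) (c 0) := PSPath.ofSmooth (fun r : ℝ => c (r * 0)) _ _ _ with hp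
    have h1 := Φ.map_const p (fun r => congrArg c (mul_zero _)) (s (c 0))
    conv_lhs => rw [← h1]
    exact HilbertModuleIso.symm_apply_apply _ _
  change ‖(Φ.map _).symm (s (c t)) - (Φ.map _).symm (s (c 0))‖ ≤ _
  rw [h0, sub_zero]
  set p : PSPath d (c 0) (c t) := PSPath.ofSmooth (fun r : ℝ => c (r * t)) _ _ _ with hp
  have h1 := N.norm_chart_map_sub_le hΦ (hct t) (fun r => hball _) (L := L * |t|) (by positivity)
    (fun r r' => (hL _ _).trans_eq (by rw [← sub_mul, abs_mul]; ring)) (by simp) (by simp) p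
    (fun r => rfl) (N.chart Φ (c 0) (s (c 0)))
  have h2 := hK.dist_le_mul (c t) ht (c 0) (mem_of_mem_nhds hU)
  rw [HilbertModuleIso.symm_apply_apply, HilbertModuleIso.norm_map] at h1
  rw [dist_eq_norm] at h2
  have h3 : ‖(Φ.map p).symm (s (c t)) - s (c 0)‖ =
      ‖N.chart Φ (c t) (s (c t)) - N.chart Φ (c t) (Φ.map p (s (c 0)))‖ := by
    rw [← HilbertModuleIso.map_sub, HilbertModuleIso.norm_map,
      ← HilbertModuleIso.norm_map (Φ.map p), HilbertModuleIso.map_sub,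
      HilbertModuleIso.apply_symm_apply]
  rw [h3]
  refine (norm_sub_le_norm_sub_add_norm_sub _ (N.chart Φ (c 0) (s (c 0))) _).trans ?_
  rw [norm_sub_rev (N.chart Φ (c 0) (s (c 0)))]
  have h4 := hL t 0
  rw [sub_zero] at h4
  have h5 : (K : ℝ) * dist (c t) (c 0) ≤ K * (L * |t|) := by gcongr
  rw [Real.norm_eq_abs]
  calc _ ≤ (K : ℝ) * (L * |t|) + 8 * |ε| * (L * |t|) * ‖s (c 0)‖ := add_le_add (h2.trans h5) h1
    _ = _ := by ring

/-- The covariant derivative of a section is bounded in terms of its Lipschitz constant in the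
radial trivialization. -/
theorem norm_nabla_le {s : ∀ x, E.fiber x} (hs : E.IsSmoothSection d s) {x : X}
    (hx : x ∈ ball a N.ρ) {K : ℝ≥0} {U : Set X} (hU : U ∈ 𝓝 x)
    (hK : LipschitzOnWith K (fun y => N.chart Φ y (s y)) U) (v : TangentSpace (𝓡 d) x) :
    ‖C.nabla s x v‖ ≤ 4 * (K + 8 * |ε| * ‖s x‖) * ‖v‖ := by
  obtain ⟨c, hc, rfl, hv, hball, hL⟩ := N.exists_curve_of_tangent hx v
  have h := N.norm_nabla_velocity_le hΦ hC hs hc hball (by positivity) hL hU hK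
  have hv' : mfderiv 𝓘(ℝ, ℝ) (𝓡 d) c 0 (1 : ℝ) = v := hv
  rw [hv'] at h
  exact h.trans_eq (by ring)

end NormalChart

end InducedConnection

/-! ### The connection on the product bundle -/

namespace HilbertGBundle

open Set Metric

section Product

variable {d : ℕ} {X : Type*} [MetricSpace X] [ChartedSpace (EuclideanSpace ℝ (Fin d)) X]
  [RiemannianBundle (fun x : X => TangentSpace (𝓡 d) x)] [IsManifold (𝓡 d) ∞ X]
  {Γ : Type*} [Group Γ] [MulAction Γ X] [IsIsometricSMul Γ X]
  {B : ℕ → Type*} [∀ k, CStarAlgebra (B k)] [∀ k, Nontrivial (B k)]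
  {F : ℕ → Type*} [∀ k, NormedAddCommGroup (F k)] [∀ k, NormedSpace ℂ (F k)]
  [∀ k, Module (B k) (F k)] [∀ k, CStarModule (B k) (F k)]
  {E : ∀ k, HilbertGBundle Γ X (B k) (F k)}
  {hΓ : ∀ γ : Γ, ContMDiff (𝓡 d) (𝓡 d) ∞ (fun x : X => γ • x)}
  {Φ : ∀ k, (E k).ParallelTransport d} {hΦ : ∀ k, (Φ k).IsEquivariant}
  {ε : ℝ} {hε : ∀ k, (Φ k).IsCloseToId ε} {N : ∀ a : X, NormalChart d a}
  {C : ∀ k, (E k).InvariantConnection d}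

/-- The covariant derivatives of the components of `s` at `x` form bounded sequences. -/
def HasProductDerivAt (C : ∀ k, (E k).InvariantConnection d)
    (s : ∀ x, (productBundle hΓ hΦ hε N).fiber x) (x : X)
    (u : TangentSpace (𝓡 d) x →L[ℝ] lp (fun k => (E k).fiber x) ∞) : Prop :=
  ∀ k v, u v k = (C k).nabla (fun y => (productBundleComponent hΓ hΦ hε N k).proj y (s y)) x v

open Classical in
/-- The sequence of the covariant derivatives of the components of a section of the product
bundle. -/
noncomputable def productNabla (C : ∀ k, (E k).InvariantConnection d)
    (s : ∀ x, (productBundle hΓ hΦ hε N).fiber x) (x : X) :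
    TangentSpace (𝓡 d) x →L[ℝ] lp (fun k => (E k).fiber x) ∞ :=
  -- For an arbitrary section the sequence may be unbounded or fail to come from one bounded
  -- operator; the value is then set to zero.
  if h : ∃ u, HasProductDerivAt C s x u then h.choose else 0

/-- An operator into bounded sequences is determined by its components. The algebraic rules of the
connection follow by exhibiting a candidate with the right components. -/
theorem HasProductDerivAt.productNabla_eq {s : ∀ x, (productBundle hΓ hΦ hε N).fiber x} {x : X}
    {u : TangentSpace (𝓡 d) x →L[ℝ] lp (fun k => (E k).fiber x) ∞}
    (h : HasProductDerivAt C s x u) : productNabla C s x = u := by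
  have h' : ∃ u, HasProductDerivAt C s x u := ⟨u, h⟩
  rw [productNabla, dif_pos h']
  ext v k
  exact (h'.choose_spec k v).trans (h k v).symm

theorem norm_component_nabla_le (hC : ∀ k, (Φ k).ComesFrom (C k))
    {s : ∀ x, (productBundle hΓ hΦ hε N).fiber x}
    (hs : IsLipschitzSection d (productBundleComponent hΓ hΦ hε N) s) {a x : X}
    (hx : x ∈ (productBundle hΓ hΦ hε N).dom a) {K : ℝ≥0} {U : Set X} (hU : U ∈ 𝓝 x)
    (hK : LipschitzOnWith K (fun y => (productBundle hΓ hΦ hε N).triv a y (s y)) U) (k : ℕ)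
    (v : TangentSpace (𝓡 d) x) :
    ‖(C k).nabla (fun y => (productBundleComponent hΓ hΦ hε N k).proj y (s y)) x v‖ ≤
      4 * (K + 8 * |ε| * ‖s x‖) * ‖v‖ := by
  have hx' : x ∈ ball a (N a).ρ :=
    ball_subset_ball (by linarith [(N a).ρ_pos]) (show x ∈ ball a ((N a).ρ / 20) from hx)
  have hK' : LipschitzOnWith K (fun y => (N a).chart (Φ k) y
      ((productBundleComponent hΓ hΦ hε N k).proj y (s y))) U :=
    LipschitzOnWith.of_dist_le_mul fun y hy z hz => by
      refine le_trans ?_ (hK.dist_le_mul y hy z hz)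
      rw [dist_eq_norm, dist_eq_norm]
      exact lp.norm_apply_le_norm (by simp) ((productBundle hΓ hΦ hε N).triv a y (s y) -
        (productBundle hΓ hΦ hε N).triv a z (s z)) k
  refine ((N a).norm_nabla_le (hε k) (hC k) (hs.2 k) hx' hU hK' v).trans ?_
  gcongr
  exact lp.norm_apply_le_norm (E := fun k => (E k).fiber x) (by simp) (s x) k

theorem hasProductDerivAt_productNabla (hC : ∀ k, (Φ k).ComesFrom (C k))
    {s : ∀ x, (productBundle hΓ hΦ hε N).fiber x}
    (hs : IsLipschitzSection d (productBundleComponent hΓ hΦ hε N) s) (x : X) :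
    HasProductDerivAt C s x (productNabla C s x) := by
  have hx := (productBundle hΓ hΦ hε N).mem_dom x
  -- A single local Lipschitz constant for the whole sequence bounds the covariant derivatives of
  -- all components at once.
  obtain ⟨K, U, hU, hK⟩ := hs.1 x hx
  rw [((productBundle hΓ hΦ hε N).isOpen_dom x).nhdsWithin_eq hx] at hU
  have hbd := norm_component_nabla_le hC hs hx hU hK
  let u : TangentSpace (𝓡 d) x →ₗ[ℝ] lp (fun k => (E k).fiber x) ∞ :=
    { toFun := fun v => lp.ofBounded (fun k => (C k).nabla
        (fun y => (productBundleComponent hΓ hΦ hε N k).proj y (s y)) x v) _ fun k => hbd k v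
      map_add' := fun v w => by ext k; exact map_add _ _ _
      map_smul' := fun c v => by ext k; exact map_smul _ _ _ }
  have h : HasProductDerivAt C s x (u.mkContinuous _ fun v =>
    lp.norm_le_of_forall_le (by positivity) fun k => hbd k v) := fun k v => rfl
  rw [h.productNabla_eq]
  exact h

/-- The connection on the product bundle given by a sequence of connections. -/
noncomputable def productConnection (hC : ∀ k, (Φ k).ComesFrom (C k)) :
    InducedConnection d (productBundleComponent hΓ hΦ hε N) C where
  nabla := productNabla C
  component s hs k x v := hasProductDerivAt_productNabla hC hs x k v
  add s t hs ht x v := by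
    have h : HasProductDerivAt C (fun y => s y + t y) x
        (productNabla C s x + productNabla C t x) := fun k v => by
      refine (congrArg₂ (· + ·) (hasProductDerivAt_productNabla hC hs x k v)
        (hasProductDerivAt_productNabla hC ht x k v)).trans ?_
      exact ((C k).add _ _ (hs.2 k) (ht.2 k) x v).symm
    rw [h.productNabla_eq]
    rfl
  smul_alg b s hs x v := by
    let L : lp (fun k => (E k).fiber x) ∞ →L[ℝ] lp (fun k => (E k).fiber x) ∞ :=
      LinearMap.mkContinuous
        { toFun := fun w => b • w
          map_add' := smul_add b
          map_smul' := fun c w => CStarModule.smul_real_smul (A := lp B ∞) c b w } ‖b‖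
        (CStarModule.norm_alg_smul_le b)
    have h : HasProductDerivAt C (fun y => b • s y) x
        (L ∘L productNabla C s x) :=
      fun k v => by
        refine (congrArg (b k • ·) (hasProductDerivAt_productNabla hC hs x k v)).trans ?_
        exact ((C k).smul_alg (b k) _ (hs.2 k) x v).symm
    rw [h.productNabla_eq]
    rfl
  leibniz f s hf hs x v := by
    let w : lp (fun k => (E k).fiber x) ∞ := s x
    have h : HasProductDerivAt C (fun y => f y • s y) x
        ((dirDeriv d f x).smulRight w + f x • productNabla C s x) :=
      fun k v => by
        refine (congrArg (fun w => dirDeriv d f x v •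
          (productBundleComponent hΓ hΦ hε N k).proj x (s x) + f x • w) (hasProductDerivAt_productNabla hC hs x k v)).trans ?_
        exact ((C k).leibniz f _ hf (hs.2 k) x v).symm
    rw [h.productNabla_eq]
    rfl
  metric s t hs ht k x v := by
    refine ((C k).metric _ _ (hs.2 k) (ht.2 k) x v).trans ?_
    rw [← hasProductDerivAt_productNabla hC hs x k v, ← hasProductDerivAt_productNabla hC ht x k v]
    rfl
  invariant γ s s' hs hs' h x v := by
    refine lp.ext (funext fun k => ?_)
    refine (hasProductDerivAt_productNabla hC hs' (γ • x) k _).trans ?_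
    refine ((C k).invariant γ _ _ (hs.2 k) (hs'.2 k) (fun y => ?_) x v).trans ?_
    · rw [h y]
      rfl
    · exact congrArg ((E k).act γ rfl) (hasProductDerivAt_productNabla hC hs x k v).symm
  continuous := by
    -- This constant dominates both coefficients in `4 * (K + 8 * |ε| * ‖s x‖)`.
    refine ⟨4 * (1 + 8 * |ε|), fun s hs a x hx K U hU hK v => ?_⟩
    have hsx := norm_nonneg (s x)
    refine lp.norm_le_of_forall_le (E := fun k => (E k).fiber x) (by positivity) fun k => ?_
    refine (congrArg norm (hasProductDerivAt_productNabla hC hs x k v)).trans_le ?_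
    refine (norm_component_nabla_le hC hs hx hU hK k v).trans ?_
    gcongr ?_ * _
    have h1 : 0 ≤ |ε| * K := by positivity
    nlinarith [abs_nonneg ε]

end Product

end HilbertGBundle

theorem mainTheorem6 {d : ℕ} {X : Type*} [MetricSpace X] [CompleteSpace X]
    [ChartedSpace (EuclideanSpace ℝ (Fin d)) X] [IsManifold (𝓡 d) ∞ X]
    [RiemannianBundle (fun x : X => TangentSpace (𝓡 d) x)]
    [IsContMDiffRiemannianBundle (𝓡 d) ∞ (EuclideanSpace ℝ (Fin d))
      (fun x : X => TangentSpace (𝓡 d) x)]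
    [IsRiemannianManifold (𝓡 d) X]
    {Γ : Type*} [Group Γ] [MulAction Γ X] [IsIsometricSMul Γ X]
    (hΓ : ∀ γ : Γ, ContMDiff (𝓡 d) (𝓡 d) ∞ (fun x : X => γ • x))
    [CompactSpace (Quotient (MulAction.orbitRel Γ X))]
    {B : ℕ → Type*} [∀ k, CStarAlgebra (B k)] [∀ k, Nontrivial (B k)]
    {F : ℕ → Type*} [∀ k, NormedAddCommGroup (F k)] [∀ k, NormedSpace ℂ (F k)]
    [∀ k, Module (B k) (F k)] [∀ k, CStarModule (B k) (F k)] [∀ k, CompleteSpace (F k)]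
    (hF : ∃ n : ℕ, ∀ k, ∃ g : Fin n → F k, Submodule.span (B k) (Set.range g) = ⊤)
    (E : ∀ k, HilbertGBundle Γ X (B k) (F k))
    (Φ : ∀ k, (E k).ParallelTransport d) (hΦ : ∀ k, (Φ k).IsEquivariant)
    (ε : ℝ) (hε : ∀ k, (Φ k).IsCloseToId ε) :
    Module.Finite (lp B ∞) (lp F ∞) ∧
    ∃ (V : HilbertGBundle Γ X (lp B ∞) (lp F ∞)) (P : ∀ k, V.ComponentIso k (E k)),
      V.HasLipschitzTransitions ∧ V.HasDiagonalTransitions ∧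
      ((∀ k, (E k).IsSmooth d) →
        ∀ C : ∀ k, (E k).InvariantConnection d, (∀ k, (Φ k).ComesFrom (C k)) →
          (∀ k, (P k).IsSmooth d) ∧
          Nonempty (HilbertGBundle.InducedConnection d P C)) := by
  -- The charts depend on `X` alone, so one choice serves all the bundles `E k` simultaneously.
  let N : ∀ a : X, NormalChart d a := fun a => Classical.choice (NormalChart.exists_normalChart d a)
  refine ⟨finite_prod_of_generators hF, HilbertGBundle.productBundle hΓ hΦ hε N,
    HilbertGBundle.productBundleComponent hΓ hΦ hε N,
    HilbertGBundle.productBundle_hasLipschitzTransitions hΓ hΦ hε N,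
    HilbertGBundle.productBundle_hasDiagonalTransitions hΓ hΦ hε N,
    fun hE C hC => ⟨fun k => ?_, ⟨HilbertGBundle.productConnection hC⟩⟩⟩
  obtain ⟨n, hF⟩ := hF
  obtain ⟨g, hg⟩ := hF k
  exact HilbertGBundle.productBundleComponent_isSmooth hΓ hΦ hε N hg (hE k) (hC k)
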